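/- Let $k,m,n\ge 0$ be integers with $k\le\min(m,n)$. Assign to the $mn$ edges of the complete bipartite graph $K_{m,n}$ independent exponentially distributed costs of mean $1$, and let $C_{k,m,n}$ be the minimum total cost of a $k$-matching, that is, of a set of $k$ edges no two of which have a vertex in common. Let $F_{k,m,n}(t)=\mathbb{E}\big[\exp(t\,C_{k,m,n})\big]$ be its moment generating function, defined for those complex $t$ for which the expectation converges absolutely. Then $F_{k,m,n}$ is defined in a neighbourhood of $0$, and there is a real polynomial $P$ of degree exactly $\binom{k}{2}$ such that, with \[ Q(t)=\prod_{\substack{i,j\ge 0\\ i+j<k}}\left(1-\frac{(k-i-j)\,t}{(m-i)(n-j)}\right), \] a polynomial of degree exactly $\binom{k+1}{2}$, for every complex $t$ at which $F_{k,m,n}(t)$ is defined we have $Q(t)\ne 0$ and \[ F_{k,m,n}(t)=\frac{P(t)}{Q(t)}. \] Moreover, for every real $t\le 0$ the expectation converges and \[ (1-t)^{-k}\le F_{k,m,n}(t)\le\left(1-\frac{t}{mn}\right)^{-k}, \] where for $k=0$ all three quantities equal $1$. -/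

import Mathlib

open MeasureTheory ProbabilityTheory Topology

/-- A `k`-matching of the complete bipartite graph with vertex classes `Fin m` and `Fin n`,
whose edges are the pairs `(a, b)`: a set of `k` edges no two of which share a vertex. -/
def IsKMatching (k m n : ℕ) (M : Finset (Fin m × Fin n)) : Prop :=
  M.card = k ∧ ∀ e ∈ M, ∀ f ∈ M, e ≠ f → e.1 ≠ f.1 ∧ e.2 ≠ f.2

/-- The total cost of a set of edges. -/
noncomputable def totalCost {m n : ℕ} (c : Fin m × Fin n → ℝ)
    (M : Finset (Fin m × Fin n)) : ℝ :=
  ∑ e ∈ M, c e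

/-- The minimum total cost of a `k`-matching; the infimum is over a finite set, which is
nonempty when `k ≤ m` and `k ≤ n` (see `minMatchingCost_isLeast`). -/
noncomputable def minMatchingCost (k : ℕ) {m n : ℕ} (c : Fin m × Fin n → ℝ) : ℝ :=
  sInf (totalCost c '' {M | IsKMatching k m n M})

theorem exists_isKMatching {k m n : ℕ} (hm : k ≤ m) (hn : k ≤ n) :
    ∃ M, IsKMatching k m n M := by
  refine ⟨(Finset.univ : Finset (Fin k)).map
    ⟨fun i => (Fin.castLE hm i, Fin.castLE hn i), fun i j h => ?_⟩, ?_, ?_⟩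
  · simpa using congrArg Prod.fst h
  · simp
  · intro e he f hf hef
    simp only [Finset.mem_map, Finset.mem_univ, true_and] at he hf
    obtain ⟨i, rfl⟩ := he
    obtain ⟨j, rfl⟩ := hf
    have hij : i ≠ j := fun h => hef (by rw [h])
    change Fin.castLE hm i ≠ Fin.castLE hm j ∧ Fin.castLE hn i ≠ Fin.castLE hn j
    simpa using hij

/-- The minimum is attained. -/
theorem minMatchingCost_isLeast {k m n : ℕ} (hm : k ≤ m) (hn : k ≤ n)
    (c : Fin m × Fin n → ℝ) :
    IsLeast (totalCost c '' {M | IsKMatching k m n M}) (minMatchingCost k c) := by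
  obtain ⟨M, hM⟩ := exists_isKMatching hm hn
  have hfin : (totalCost c '' {M | IsKMatching k m n M}).Finite := (Set.toFinite _).image _
  exact ⟨Set.Nonempty.csInf_mem ⟨_, M, hM, rfl⟩ hfin,
    fun x hx => csInf_le hfin.bddBelow hx⟩

/-- The polynomial `∏_{i, j ≥ 0, i + j < k} (1 - (k - i - j) t / ((m - i) (n - j)))`.
The arithmetic in the coefficients takes place in `ℝ`. -/
noncomputable def matchingDenominator (k m n : ℕ) : Polynomial ℝ :=
  ∏ p ∈ (Finset.range k ×ˢ Finset.range k).filter (fun p => p.1 + p.2 < k),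
    (1 - Polynomial.C (((k : ℝ) - (p.1 : ℝ) - (p.2 : ℝ)) /
      (((m : ℝ) - (p.1 : ℝ)) * ((n : ℝ) - (p.2 : ℝ)))) * Polynomial.X)

set_option linter.unusedSectionVars false

/-! Put `t = -s` with `s > 0`. Enlarge the cost matrix by extra rows of infinitesimal rate: such a
row has a single finite entry, its column is summed over, and its cost follows Lebesgue measure on
the half-line, an infinite measure. Let `K_k(T, S)` (`coverIntegral`) be the integral of `exp (-s
C)`, with `C` the cost of the optimal `k`-matching with columns in `T`, over the event that this
matching covers all extra rows in `S`. For `S = ∅` and all columns this is the moment generating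
function at `-s`.

Let `N` be the optimal `r`-matching avoiding a column `b` of `T`, and `M` the optimal `(r +
1)`-matching in `T`. Almost surely all finite costs are distinct, and an exchange argument shows
`rows N ⊆ rows M` (`IsOptimal.rows_subset`), so exactly one row joins. Let `H_b(S)` be the integral
of `exp (-s cost M)` over the event that `N` covers `S`. Three facts produce a recursion.

If `M` covers `S`, then either `N` does, or `N` misses exactly one `a` in `S` and `a` joins
(`coverIntegral_eq_add_sum`). An extra row `a` that joins may be merged into any uncovered regular
row, because an infinitesimal edge cheaper than an exponential one has the law of the latter; there
are `m + |S| - r - 1` such rows, so the event that `a` joins contributes `H_b(S \ a) / (m + |S| - r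
- 1)` (`card_mul_eventIntegral`). Finally, a new extra row with edge of cost `x` in column `b` is
used exactly when `x + cost N < cost M`, and integrating over `x` gives `∑ H_b(S) + s K_{r+1}(T, S ∪
a) = ∑ K_r(T \ b, S)`, with sums over `b` in `T` (`mul_coverIntegral_insert`).

Eliminating `H_b` (`coverIntegral_recursion`) expresses `K_{r+1}(T, S)` times `1 + s |S| / (|T| (m +
|S| - r - 1))` through `K_{r+1}(T, S ∪ a)` and integrals for `r`. As `K_{r+1}(T, S) = 0` for `|S| >
r + 1`, descending induction on `|S|` inside an induction on `r` yields a polynomial over the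
product of these factors. They are the factors of `Q` with `j = 0`; those with `j > 0` form the
denominator for `r` and `n - 1`.

The lower bound compares the minimum with one fixed matching, the upper bound follows from the
recursion at `S = ∅`. Both decay like `|t|^(-k)` at `-∞`, which fixes the degree of `P`. The
expectation diverges at every zero of `Q`, and analytic continuation followed by dominated
convergence carries the identity from `t < 0` to the whole domain. -/

namespace Matching

open scoped ENNReal

/-! ### Exchange properties of matchings -/

section Exchange

variable {A B : Type*} [DecidableEq A] [DecidableEq B]

/-- A set of edges no two of which share a vertex. -/
def IsMatching (M : Finset (A × B)) : Prop :=
  (∀ e ∈ M, ∀ f ∈ M, e.1 = f.1 → e = f) ∧ ∀ e ∈ M, ∀ f ∈ M, e.2 = f.2 → e = f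

/-- The set of rows covered by a set of edges. -/
def rows (M : Finset (A × B)) : Finset A := M.image Prod.fst

/-- The set of columns covered by a set of edges. -/
def cols (M : Finset (A × B)) : Finset B := M.image Prod.snd

theorem mem_rows {M : Finset (A × B)} {a : A} : a ∈ rows M ↔ ∃ b, (a, b) ∈ M := by
  simp [rows]

theorem mem_cols {M : Finset (A × B)} {b : B} : b ∈ cols M ↔ ∃ a, (a, b) ∈ M := by
  simp [cols]

theorem rows_insert (a : A) (b : B) (M : Finset (A × B)) :
    rows (insert (a, b) M) = insert a (rows M) := by
  simp [rows]

theorem cols_insert (a : A) (b : B) (M : Finset (A × B)) :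
    cols (insert (a, b) M) = insert b (cols M) := by
  simp [cols]

theorem cols_mono {M N : Finset (A × B)} (h : M ⊆ N) : cols M ⊆ cols N :=
  Finset.image_subset_image h

theorem rows_mono {M N : Finset (A × B)} (h : M ⊆ N) : rows M ⊆ rows N :=
  Finset.image_subset_image h

theorem cols_union (M N : Finset (A × B)) : cols (M ∪ N) = cols M ∪ cols N :=
  Finset.image_union _ _

theorem notMem_of_row {M : Finset (A × B)} {a : A} (h : a ∉ rows M) (b : B) : (a, b) ∉ M :=
  fun h' => h (mem_rows.2 ⟨b, h'⟩)

theorem notMem_of_col {M : Finset (A × B)} {b : B} (h : b ∉ cols M) (a : A) : (a, b) ∉ M :=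
  fun h' => h (mem_cols.2 ⟨a, h'⟩)

theorem insert_inter_insert {M N : Finset (A × B)} {e f : A × B} (hef : e ≠ f) (he : e ∉ N)
    (hf : f ∉ M) : insert e M ∩ insert f N = M ∩ N := by
  rw [Finset.insert_inter_of_notMem (by simp [hef, he]), Finset.inter_insert_of_notMem hf]

namespace IsMatching

theorem subset {M N : Finset (A × B)} (hN : IsMatching N) (h : M ⊆ N) : IsMatching M :=
  ⟨fun e he f hf => hN.1 e (h he) f (h hf), fun e he f hf => hN.2 e (h he) f (h hf)⟩

theorem card_rows {M : Finset (A × B)} (hM : IsMatching M) : (rows M).card = M.card :=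
  Finset.card_image_of_injOn fun e he f hf => hM.1 e he f hf

theorem card_cols {M : Finset (A × B)} (hM : IsMatching M) : (cols M).card = M.card :=
  Finset.card_image_of_injOn fun e he f hf => hM.2 e he f hf

theorem insert {M : Finset (A × B)} (hM : IsMatching M) {a : A} {b : B}
    (ha : a ∉ rows M) (hb : b ∉ cols M) : IsMatching (insert (a, b) M) := by
  rw [mem_rows] at ha
  rw [mem_cols] at hb
  push Not at ha hb
  constructor
  · rintro ⟨x, y⟩ he ⟨z, w⟩ hf h
    simp only [Finset.mem_insert, Prod.mk.injEq] at he hf h ⊢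
    subst h
    rcases he with ⟨rfl, rfl⟩ | he <;> rcases hf with ⟨h1, rfl⟩ | hf
    · simp
    · exact absurd hf (ha _)
    · exact absurd he (h1 ▸ ha _)
    · simpa using hM.1 _ he _ hf rfl
  · rintro ⟨x, y⟩ he ⟨z, w⟩ hf h
    simp only [Finset.mem_insert, Prod.mk.injEq] at he hf h ⊢
    subst h
    rcases he with ⟨rfl, rfl⟩ | he <;> rcases hf with ⟨rfl, h1⟩ | hf
    · simp
    · exact absurd hf (hb _)
    · exact absurd he (h1 ▸ hb _)
    · simpa using hM.2 _ he _ hf rfl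

theorem exists_eq_insert {M : Finset (A × B)} (hM : IsMatching M) {a : A} {b : B}
    (h : (a, b) ∈ M) : ∃ M₁, M = Insert.insert (a, b) M₁ ∧ (a, b) ∉ M₁ ∧ IsMatching M₁ ∧
      a ∉ rows M₁ ∧ b ∉ cols M₁ := by
  refine ⟨M.erase (a, b), (Finset.insert_erase h).symm, by simp,
    hM.subset (Finset.erase_subset _ _), ?_, ?_⟩
  · rw [mem_rows]
    rintro ⟨y, hy⟩
    rw [Finset.mem_erase] at hy
    exact hy.1 (hM.1 _ hy.2 _ h rfl)
  · rw [mem_cols]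
    rintro ⟨y, hy⟩
    rw [Finset.mem_erase] at hy
    exact hy.1 (hM.2 _ hy.2 _ h rfl)

end IsMatching

/-- An alternating path, one step per induction: an edge of `N` in a column free in `M` moves to `M`
if its row is free there; otherwise the edges of that row are removed from both matchings and put
back after the induction. Keeping the union and the intersection keeps the total cost for every cost
matrix. -/
theorem exists_transfer (r : ℕ) : ∀ M N : Finset (A × B), M.card = r → IsMatching M →
    IsMatching N → M.card < N.card → ∃ M' N' : Finset (A × B), ∃ a ∈ rows N, a ∉ rows M ∧
      IsMatching M' ∧ IsMatching N' ∧ M' ∪ N' = M ∪ N ∧ M' ∩ N' = M ∩ N ∧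
      rows M' = insert a (rows M) ∧ rows N' = (rows N).erase a := by
  induction r with
  | zero =>
    intro M N hr hM hN hlt
    obtain rfl := Finset.card_eq_zero.1 hr
    obtain ⟨⟨a, d⟩, hd⟩ := Finset.card_pos.1 (by simpa using hlt : 0 < N.card)
    obtain ⟨N₁, rfl, hn, hN₁, ha, hd'⟩ := hN.exists_eq_insert hd
    refine ⟨{(a, d)}, N₁, a, by simp [rows_insert], by simp [rows],
      by simp [IsMatching], hN₁, by simp, by simp [hn], by simp [rows], ?_⟩
    rw [rows_insert, Finset.erase_insert ha]
  | succ r ih =>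
    intro M N hr hM hN hlt
    obtain ⟨d, hdN, hdM⟩ := Finset.exists_mem_notMem_of_card_lt_card
      (by rwa [hM.card_cols, hN.card_cols] : (cols M).card < (cols N).card)
    obtain ⟨a₁, ha₁⟩ := mem_cols.1 hdN
    obtain ⟨N₁, rfl, hn, hN₁, haN, hdN₁⟩ := hN.exists_eq_insert ha₁
    by_cases haM : a₁ ∈ rows M
    · obtain ⟨d₁, hd₁⟩ := mem_rows.1 haM
      obtain ⟨M₁, rfl, hm, hM₁, haM₁, hdM₁⟩ := hM.exists_eq_insert hd₁
      rw [Finset.card_insert_of_notMem hm] at hr hlt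
      rw [Finset.card_insert_of_notMem hn] at hlt
      obtain ⟨M', N', a, haN', haM', hM', hN', hU, hI, hrM, hrN⟩ :=
        ih M₁ N₁ (by omega) hM₁ hN₁ (by omega)
      have hne : a ≠ a₁ := fun h => haN (h ▸ haN')
      have hdd : d ≠ d₁ := fun h => hdM (by simp [h, cols_insert])
      have hdU : d ∉ cols M' ∪ cols N' := by
        rw [← cols_union, hU, cols_union]
        rw [cols_insert] at hdM
        simp_all
      have ha₁M' : a₁ ∉ rows M' := by simp [hrM, hne.symm, haM₁]
      have ha₁N' : a₁ ∉ rows N' := by simp [hrN, haN]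
      have hU' : ∀ e, e ∈ M' ∨ e ∈ N' ↔ e ∈ M₁ ∨ e ∈ N₁ := fun e => by
        rw [← Finset.mem_union, hU, Finset.mem_union]
      have hI' : ∀ e, e ∈ M' ∧ e ∈ N' ↔ e ∈ M₁ ∧ e ∈ N₁ := fun e => by
        rw [← Finset.mem_inter, hI, Finset.mem_inter]
      simp only [Finset.mem_union, not_or] at hdU
      -- Row `a₁` must return to both matchings, and column `d` is free in both; the position of
      -- `d₁` decides whether the two edges trade places. `d₁` is not occupied twice: both edges
      -- would come from `N₁`, hence coincide and lie in the intersection, but `M₁` has no edge in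
      -- column `d₁`.
      by_cases hc : d₁ ∈ cols M'
      · have hc' : d₁ ∉ cols N' := by
          intro h
          obtain ⟨x, hx⟩ := mem_cols.1 hc
          obtain ⟨y, hy⟩ := mem_cols.1 h
          have hx1 : (x, d₁) ∉ M₁ := fun h => hdM₁ (mem_cols.2 ⟨_, h⟩)
          have hy1 : (y, d₁) ∉ M₁ := fun h => hdM₁ (mem_cols.2 ⟨_, h⟩)
          have hx2 : (x, d₁) ∈ N₁ := by have := hU' (x, d₁); tauto
          have hy2 : (y, d₁) ∈ N₁ := by have := hU' (y, d₁); tauto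
          have hxy := hN₁.2 _ hx2 _ hy2 rfl
          rw [← hxy] at hy
          have := hI' (x, d₁)
          tauto
        refine ⟨insert (a₁, d) M', insert (a₁, d₁) N', a, ?_, ?_, hM'.insert ha₁M' hdU.1,
          hN'.insert ha₁N' hc', ?_, ?_, ?_, ?_⟩
        · simp [rows_insert, haN']
        · simp [rows_insert, hne, haM']
        · rw [Finset.insert_union, Finset.union_insert, hU, Finset.insert_union,
            Finset.union_insert, Finset.insert_comm]
        · rw [insert_inter_insert (by simpa using hdd) (notMem_of_row ha₁N' _)
            (notMem_of_row ha₁M' _), hI, insert_inter_insert (by simpa using hdd.symm)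
            (notMem_of_row haN _) (notMem_of_row haM₁ _)]
        · rw [rows_insert, rows_insert, hrM, Finset.insert_comm]
        · rw [rows_insert, rows_insert, hrN, Finset.erase_insert_of_ne hne.symm]
      · refine ⟨insert (a₁, d₁) M', insert (a₁, d) N', a, ?_, ?_, hM'.insert ha₁M' hc,
          hN'.insert ha₁N' hdU.2, ?_, ?_, ?_, ?_⟩
        · simp [rows_insert, haN']
        · simp [rows_insert, hne, haM']
        · rw [Finset.insert_union, Finset.union_insert, hU, Finset.insert_union,
            Finset.union_insert]
        · rw [insert_inter_insert (by simpa using hdd.symm) (notMem_of_row ha₁N' _)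
            (notMem_of_row ha₁M' _), hI, insert_inter_insert (by simpa using hdd.symm)
            (notMem_of_row haN _) (notMem_of_row haM₁ _)]
        · rw [rows_insert, rows_insert, hrM, Finset.insert_comm]
        · rw [rows_insert, rows_insert, hrN, Finset.erase_insert_of_ne hne.symm]
    · have hm : (a₁, d) ∉ M := fun h => haM (mem_rows.2 ⟨_, h⟩)
      refine ⟨insert (a₁, d) M, N₁, a₁, by simp [rows_insert], haM, hM.insert haM hdM, hN₁,
        by simp, ?_, rows_insert _ _ _, ?_⟩
      · rw [Finset.insert_inter_of_notMem hn, Finset.inter_insert_of_notMem hm]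
      · rw [rows_insert, Finset.erase_insert haN]

/-- The exchange property of the row sets of matchings. -/
theorem exists_exchange (r : ℕ) : ∀ (M N : Finset (A × B)) (a : A), M.card = r → IsMatching M →
    IsMatching N → M.card ≤ N.card → a ∈ rows M → a ∉ rows N →
    ∃ M' N' : Finset (A × B), ∃ a' ∈ rows N, a' ∉ rows M ∧
      IsMatching M' ∧ IsMatching N' ∧ M' ∪ N' = M ∪ N ∧ M' ∩ N' = M ∩ N ∧
      rows M' = insert a' ((rows M).erase a) ∧ rows N' = insert a ((rows N).erase a') := by
  induction r with
  | zero =>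
    intro M N a hr hM hN hlt ha
    obtain rfl := Finset.card_eq_zero.1 hr
    simp [rows] at ha
  | succ r ih =>
    intro M N a hr hM hN hlt ha haN
    obtain ⟨d, hd⟩ := mem_rows.1 ha
    obtain ⟨M₁, rfl, hm, hM₁, haM₁, hdM₁⟩ := hM.exists_eq_insert hd
    rw [Finset.card_insert_of_notMem hm] at hr hlt
    by_cases hdN : d ∈ cols N
    · obtain ⟨a₁, ha₁⟩ := mem_cols.1 hdN
      obtain ⟨N₁, rfl, hn, hN₁, haN₁, hdN₁⟩ := hN.exists_eq_insert ha₁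
      rw [Finset.card_insert_of_notMem hn] at hlt
      have hne : a₁ ≠ a := fun h => haN (mem_rows.2 ⟨d, h ▸ ha₁⟩)
      have haN₁' : a ∉ rows N₁ := fun h => haN (by simp [rows_insert, h])
      -- Both edges in column `d` are set aside. If `a₁` is covered by the rest of `M`, it takes
      -- over the role of `a`; in either case the two edges return crosswise.
      by_cases haM : a₁ ∈ rows M₁
      · obtain ⟨M', N', a', haN', haM', hM', hN', hU, hI, hrM, hrN⟩ :=
          ih M₁ N₁ a₁ (by omega) hM₁ hN₁ (by omega) haM haN₁
        have hne1 : a' ≠ a₁ := fun h => haN₁ (h ▸ haN')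
        have hne2 : a' ≠ a := fun h => haN₁' (h ▸ haN')
        have hdU : d ∉ cols M' ∪ cols N' := by
          rw [← cols_union, hU, cols_union]
          simp_all
        simp only [Finset.mem_union, not_or] at hdU
        have ha₁M' : a₁ ∉ rows M' := by simp [hrM, hne1.symm]
        have haN'' : a ∉ rows N' := by simp [hrN, hne.symm, haN₁']
        refine ⟨insert (a₁, d) M', insert (a, d) N', a', ?_, ?_, hM'.insert ha₁M' hdU.1,
          hN'.insert haN'' hdU.2, ?_, ?_, ?_, ?_⟩
        · simp [rows_insert, haN']
        · simp [rows_insert, hne2, haM']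
        · rw [Finset.insert_union, Finset.union_insert, hU, Finset.insert_union,
            Finset.union_insert, Finset.insert_comm]
        · rw [insert_inter_insert (by simpa using hne) (notMem_of_col hdU.2 _)
            (notMem_of_col hdU.1 _), hI, insert_inter_insert (by simpa using hne.symm)
            (notMem_of_col hdN₁ _) (notMem_of_col hdM₁ _)]
        · rw [rows_insert, rows_insert, hrM]
          ext x
          simp only [Finset.mem_insert, Finset.mem_erase]
          grind
        · rw [rows_insert, rows_insert, hrN]
          ext x
          simp only [Finset.mem_insert, Finset.mem_erase]
          grind
      · refine ⟨insert (a₁, d) M₁, insert (a, d) N₁, a₁, by simp [rows_insert], ?_,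
          hM₁.insert haM hdM₁, hN₁.insert haN₁' hdN₁, ?_, ?_, ?_, ?_⟩
        · simp [rows_insert, hne, haM]
        · rw [Finset.insert_union, Finset.union_insert, Finset.insert_union,
            Finset.union_insert, Finset.insert_comm]
        · rw [insert_inter_insert (by simpa using hne) (notMem_of_col hdN₁ _)
            (notMem_of_col hdM₁ _), insert_inter_insert (by simpa using hne.symm)
            (notMem_of_col hdN₁ _) (notMem_of_col hdM₁ _)]
        · rw [rows_insert, rows_insert, Finset.erase_insert haM₁]
        · rw [rows_insert, rows_insert, Finset.erase_insert haN₁]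
    -- Without `(a, d)` the first matching is strictly smaller, so a row can be transferred to it;
    -- `(a, d)` then goes to the second one, where column `d` is free.
    · obtain ⟨M', N', a', haN', haM', hM', hN', hU, hI, hrM, hrN⟩ :=
        exists_transfer _ M₁ N rfl hM₁ hN (by omega)
      have hne : a' ≠ a := fun h => haN (h ▸ haN')
      have hdU : d ∉ cols M' ∪ cols N' := by
        rw [← cols_union, hU, cols_union]
        simp_all
      simp only [Finset.mem_union, not_or] at hdU
      have haN'' : a ∉ rows N' := by simp [hrN, haN]
      have haM'' : a ∉ rows M' := by simp [hrM, haM₁, hne.symm]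
      refine ⟨M', insert (a, d) N', a', haN', ?_, hM', hN'.insert haN'' hdU.2, ?_, ?_, ?_, ?_⟩
      · simp [rows_insert, hne, haM']
      · rw [Finset.union_insert, hU, Finset.insert_union]
      · have h1 : (a, d) ∉ M' := fun h => haM'' (mem_rows.2 ⟨_, h⟩)
        have h2 : (a, d) ∉ N := fun h => haN (mem_rows.2 ⟨_, h⟩)
        rw [Finset.inter_insert_of_notMem h1, hI, Finset.insert_inter_of_notMem h2]
      · rw [rows_insert, Finset.erase_insert haM₁, hrM]
      · rw [rows_insert, hrN]

/-- The exchange property, leaving alone a column covered by the larger matching only. -/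
theorem exists_exchange_of_notMem_cols {M N : Finset (A × B)} {a : A} {b : B} (hM : IsMatching M)
    (hN : IsMatching N) (hc : M.card < N.card) (ha : a ∈ rows M) (haN : a ∉ rows N)
    (hb : b ∉ cols M) :
    ∃ M' N' : Finset (A × B), ∃ a' ∈ rows N, a' ∉ rows M ∧
      IsMatching M' ∧ IsMatching N' ∧ M' ∪ N' = M ∪ N ∧ M' ∩ N' = M ∩ N ∧
      rows M' = insert a' ((rows M).erase a) ∧ rows N' = insert a ((rows N).erase a') ∧
      b ∉ cols M' := by
  -- The edge of `N` in column `b` is set aside and returned to `N'` afterwards, so column `b`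
  -- cannot reach `M'`. The strict inequality of sizes leaves room for this.
  by_cases hbN : b ∈ cols N
  · obtain ⟨a₁, ha₁⟩ := mem_cols.1 hbN
    obtain ⟨N₁, rfl, hn, hN₁, haN₁, hdN₁⟩ := hN.exists_eq_insert ha₁
    rw [Finset.card_insert_of_notMem hn] at hc
    rw [rows_insert, Finset.mem_insert, not_or] at haN
    obtain ⟨M', N', a', haN', haM', hM', hN', hU, hI, hrM, hrN⟩ :=
      exists_exchange _ M N₁ a rfl hM hN₁ (by omega) ha haN.2
    have hdU : b ∉ cols M' ∪ cols N' := by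
      rw [← cols_union, hU, cols_union]
      simp_all
    simp only [Finset.mem_union, not_or] at hdU
    have h1 : a₁ ∉ rows N' := by simp [hrN, Ne.symm haN.1, haN₁]
    have hne : a₁ ≠ a' := fun h => haN₁ (h ▸ haN')
    refine ⟨M', insert (a₁, b) N', a', by simp [rows_insert, haN'], haM', hM',
      hN'.insert h1 hdU.2, ?_, ?_, hrM, ?_, hdU.1⟩
    · rw [Finset.union_insert, hU, Finset.union_insert]
    · have h1 : (a₁, b) ∉ M' := fun h => hdU.1 (mem_cols.2 ⟨_, h⟩)
      have h2 : (a₁, b) ∉ M := fun h => hb (mem_cols.2 ⟨_, h⟩)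
      rw [Finset.inter_insert_of_notMem h1, hI, Finset.inter_insert_of_notMem h2]
    · rw [rows_insert, rows_insert, hrN, Finset.erase_insert_of_ne hne, Finset.insert_comm]
  · obtain ⟨M', N', a', haN', haM', hM', hN', hU, hI, hrM, hrN⟩ :=
      exists_exchange _ M N a rfl hM hN hc.le ha haN
    refine ⟨M', N', a', haN', haM', hM', hN', hU, hI, hrM, hrN, fun h => ?_⟩
    have : b ∈ cols M' ∪ cols N' := Finset.mem_union_left _ h
    rw [← cols_union, hU, cols_union] at this
    simp_all

end Exchange

/-! ### Optimal matchings in a generic cost matrix -/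

section Optimal

variable {A B : Type*} [DecidableEq A] [DecidableEq B]

/-- The cost of a set of edges, where edges of cost `⊤` are regarded as absent. -/
noncomputable def cost (c : A → B → ℝ≥0∞) (M : Finset (A × B)) : ℝ≥0∞ :=
  ∑ e ∈ M, c e.1 e.2

/-- No two sets of edges have the same finite cost. -/
def Generic (c : A → B → ℝ≥0∞) : Prop :=
  ∀ M N : Finset (A × B), cost c M = cost c N → cost c M ≠ ⊤ → M = N

/-- The row with an edge of cost `x` to the column `b` and no other edges. -/
noncomputable def singleRow (b : B) (x : ℝ≥0∞) : B → ℝ≥0∞ :=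
  Function.update (fun _ => ⊤) b x

theorem cost_mono_set (c : A → B → ℝ≥0∞) {M N : Finset (A × B)} (h : M ⊆ N) :
    cost c M ≤ cost c N :=
  Finset.sum_le_sum_of_subset h

theorem cost_mono {c c' : A → B → ℝ≥0∞} (h : c ≤ c') (M : Finset (A × B)) :
    cost c M ≤ cost c' M :=
  Finset.sum_le_sum fun e _ => h e.1 e.2

theorem cost_insert (c : A → B → ℝ≥0∞) {a : A} {b : B} {M : Finset (A × B)} (h : (a, b) ∉ M) :
    cost c (insert (a, b) M) = c a b + cost c M :=
  Finset.sum_insert h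

theorem cost_exchange (c : A → B → ℝ≥0∞) {M N M' N' : Finset (A × B)} (hU : M' ∪ N' = M ∪ N)
    (hI : M' ∩ N' = M ∩ N) : cost c M' + cost c N' = cost c M + cost c N := by
  unfold cost
  rw [← Finset.sum_union_inter, hU, hI, Finset.sum_union_inter]

theorem ne_top_of_mem {c : A → B → ℝ≥0∞} {M : Finset (A × B)} (h : cost c M ≠ ⊤) {a : A} {b : B}
    (hm : (a, b) ∈ M) : c a b ≠ ⊤ :=
  ENNReal.sum_ne_top.1 h (a, b) hm

theorem notMem_rows_of_top {c : A → B → ℝ≥0∞} {M : Finset (A × B)} (h : cost c M ≠ ⊤) {a : A}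
    (ha : c a = fun _ => ⊤) : a ∉ rows M := by
  intro hm
  obtain ⟨b, hb⟩ := mem_rows.1 hm
  exact ne_top_of_mem h hb (by rw [ha])

theorem cost_congr {c c' : A → B → ℝ≥0∞} {M : Finset (A × B)}
    (h : ∀ a b, (a, b) ∈ M → c a b = c' a b) : cost c M = cost c' M :=
  Finset.sum_congr rfl fun e he => h e.1 e.2 he

theorem cost_update {c : A → B → ℝ≥0∞} {M : Finset (A × B)} {a : A} (ha : a ∉ rows M)
    (ρ : B → ℝ≥0∞) : cost (Function.update c a ρ) M = cost c M := by
  refine cost_congr fun x y h => ?_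
  rw [Function.update_of_ne]
  rintro rfl
  exact ha (mem_rows.2 ⟨_, h⟩)

variable {c : A → B → ℝ≥0∞} in
theorem IsMatching.exists_singleRow_edge {M : Finset (A × B)} {a : A} {b : B} {x : ℝ≥0∞}
    (hM : IsMatching M) (h : cost (Function.update c a (singleRow b x)) M ≠ ⊤)
    (ha : a ∈ rows M) : ∃ M₁, M = Insert.insert (a, b) M₁ ∧ (a, b) ∉ M₁ ∧ IsMatching M₁ ∧
      a ∉ rows M₁ ∧ b ∉ cols M₁ ∧
      cost (Function.update c a (singleRow b x)) M = x + cost c M₁ := by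
  obtain ⟨d, hd⟩ := mem_rows.1 ha
  have hdb : d = b := by
    by_contra hdb
    exact ne_top_of_mem h hd (by simp [singleRow, hdb])
  subst hdb
  obtain ⟨M₁, h1, h2, h3, h4, h5⟩ := hM.exists_eq_insert hd
  refine ⟨M₁, h1, h2, h3, h4, h5, ?_⟩
  rw [h1, cost_insert _ h2, cost_update h4]
  simp [singleRow]

variable {c : A → B → ℝ≥0∞} in
theorem cost_insert_singleRow {M : Finset (A × B)} {a : A} {b : B} (x : ℝ≥0∞) (ha : a ∉ rows M) :
    cost (Function.update c a (singleRow b x)) (insert (a, b) M) = x + cost c M := by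
  rw [cost_insert _ (notMem_of_row ha b), cost_update ha]
  simp [singleRow]

variable [Fintype A] [Fintype B]

open Classical in
/-- The matchings of size `r` whose columns belong to `T`. -/
noncomputable def matchings (A : Type*) {B : Type*} [DecidableEq A] [DecidableEq B] [Fintype A]
    [Fintype B] (r : ℕ) (T : Finset B) : Finset (Finset (A × B)) :=
  Finset.univ.filter fun M => IsMatching M ∧ M.card = r ∧ cols M ⊆ T

theorem mem_matchings {r : ℕ} {T : Finset B} {M : Finset (A × B)} :
    M ∈ matchings A r T ↔ IsMatching M ∧ M.card = r ∧ cols M ⊆ T := by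
  simp [matchings]

/-- `M` is a cheapest matching of size `r` with columns in `T`, and its cost is finite. -/
def IsOptimal (c : A → B → ℝ≥0∞) (r : ℕ) (T : Finset B) (M : Finset (A × B)) : Prop :=
  M ∈ matchings A r T ∧ cost c M ≠ ⊤ ∧ ∀ N ∈ matchings A r T, cost c M ≤ cost c N

/-- The minimum cost of a matching of size `r` with columns in `T`. -/
noncomputable def minCost (c : A → B → ℝ≥0∞) (r : ℕ) (T : Finset B) : ℝ≥0∞ :=
  ⨅ M ∈ matchings A r T, cost c M

open Classical in
/-- A cheapest matching of size `r` with columns in `T`. -/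
noncomputable def optimum (c : A → B → ℝ≥0∞) (r : ℕ) (T : Finset B) : Finset (A × B) :=
  if h : ∃ M, IsOptimal c r T M then h.choose else ∅

variable {c : A → B → ℝ≥0∞} {r : ℕ} {T : Finset B}

theorem IsOptimal.minCost_eq {M : Finset (A × B)} (h : IsOptimal c r T M) :
    minCost c r T = cost c M :=
  le_antisymm (iInf₂_le M h.1) (le_iInf₂ h.2.2)

theorem minCost_le {M : Finset (A × B)} (h : M ∈ matchings A r T) : minCost c r T ≤ cost c M :=
  iInf₂_le M h

theorem exists_cost_lt {y : ℝ≥0∞} (h : minCost c r T < y) :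
    ∃ M ∈ matchings A r T, cost c M < y := by
  simpa [minCost, iInf_lt_iff] using h

theorem IsOptimal.unique {M N : Finset (A × B)} (hc : Generic c) (hM : IsOptimal c r T M)
    (hN : IsOptimal c r T N) : M = N :=
  hc M N (le_antisymm (hM.2.2 N hN.1) (hN.2.2 M hM.1)) hM.2.1

theorem exists_isOptimal {M : Finset (A × B)} (hM : M ∈ matchings A r T) (h : cost c M ≠ ⊤) :
    ∃ N, IsOptimal c r T N := by
  obtain ⟨N, hN, h'⟩ := Finset.exists_min_image (matchings A r T) (cost c) ⟨M, hM⟩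
  exact ⟨N, hN, ne_top_of_le_ne_top h (h' M hM), h'⟩

theorem isOptimal_optimum (h : ∃ M, IsOptimal c r T M) : IsOptimal c r T (optimum c r T) := by
  rw [optimum, dif_pos h]
  exact h.choose_spec

/-- Every row of the cheapest `r`-matching avoiding a column is a row of the cheapest
`(r + 1)`-matching. -/
theorem IsOptimal.rows_subset {M N : Finset (A × B)} {b : B} (hc : Generic c)
    (hM : IsOptimal c r (T.erase b) M) (hN : IsOptimal c (r + 1) T N) : rows M ⊆ rows N := by
  intro a ha
  by_contra haN
  obtain ⟨hMm, hMt, hMo⟩ := hM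
  obtain ⟨hNm, hNt, hNo⟩ := hN
  rw [mem_matchings] at hMm hNm
  have hb : b ∉ cols M := fun h => by simpa using hMm.2.2 h
  obtain ⟨M', N', a', ha', haM', hM', hN', hU, hI, hrM, hrN, hbM'⟩ :=
    exists_exchange_of_notMem_cols hMm.1 hNm.1 (by omega) ha haN hb
  have hsub : cols M' ∪ cols N' ⊆ T := by
    rw [← cols_union, hU, cols_union]
    exact Finset.union_subset (hMm.2.2.trans (Finset.erase_subset _ _)) hNm.2.2
  have hcM : M'.card = r := by
    rw [← hM'.card_rows, hrM, Finset.card_insert_of_notMem (by simp [haM']),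
      Finset.card_erase_add_one ha, hMm.1.card_rows, hMm.2.1]
  have hcN : N'.card = r + 1 := by
    rw [← hN'.card_rows, hrN, Finset.card_insert_of_notMem (by simp [haN]),
      Finset.card_erase_add_one ha', hNm.1.card_rows, hNm.2.1]
  -- `M'` and `N'` compete with `M` and `N` at the same total cost, so `M'` is optimal too and
  -- equals `M` by genericity, although it omits row `a`.
  have h1 := hMo M' (mem_matchings.2 ⟨hM', hcM, fun x hx => Finset.mem_erase.2
    ⟨fun h => hbM' (h ▸ hx), hsub (Finset.mem_union_left _ hx)⟩⟩)
  have h2 := hNo N' (mem_matchings.2 ⟨hN', hcN, fun x hx => hsub (Finset.mem_union_right _ hx)⟩)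
  have h3 := cost_exchange c hU hI
  have h4 : cost c M' ≤ cost c M := by
    by_contra! h
    exact absurd h3 (ENNReal.add_lt_add_of_lt_of_le hNt h h2).ne'
  have h5 := hc M M' (le_antisymm h1 h4) hMt
  rw [h5, hrM] at ha
  simp only [Finset.mem_insert, Finset.mem_erase, ne_eq, not_true_eq_false, false_and,
    or_false] at ha
  exact haN (ha ▸ ha')

/-- Delete the edge in column `b`, or any edge if there is none. -/
theorem exists_subset_mem_matchings {N : Finset (A × B)} (b : B)
    (hN : N ∈ matchings A (r + 1) T) : ∃ M ∈ matchings A r (T.erase b), M ⊆ N := by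
  rw [mem_matchings] at hN
  obtain ⟨hN, hcard, hT⟩ := hN
  have key : ∀ e ∈ N, (b ∈ cols N → e.2 = b) → ∃ M ∈ matchings A r (T.erase b), M ⊆ N := by
    rintro ⟨a, d⟩ he hb
    obtain ⟨M, rfl, hm, hM, ha, hd⟩ := hN.exists_eq_insert he
    rw [Finset.card_insert_of_notMem hm] at hcard
    refine ⟨M, mem_matchings.2 ⟨hM, by omega, fun x hx => Finset.mem_erase.2
      ⟨fun h => hd ?_, hT (cols_mono (Finset.subset_insert _ _) hx)⟩⟩, Finset.subset_insert _ _⟩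
    have := hb (cols_mono (Finset.subset_insert _ _) (h ▸ hx))
    simp only at this
    rw [this, ← h]
    exact hx
  by_cases hb : b ∈ cols N
  · obtain ⟨a, ha⟩ := mem_cols.1 hb
    exact key _ ha fun _ => rfl
  · obtain ⟨e, he⟩ := Finset.card_pos.1 (by omega : 0 < N.card)
    exact key e he fun h => absurd h hb

theorem minCost_erase_le (c : A → B → ℝ≥0∞) (r : ℕ) (T : Finset B) (b : B) :
    minCost c r (T.erase b) ≤ minCost c (r + 1) T := by
  refine le_iInf₂ fun N hN => ?_
  obtain ⟨M, hM, hMN⟩ := exists_subset_mem_matchings b hN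
  exact (minCost_le hM).trans (cost_mono_set c hMN)

theorem insert_mem_matchings {M : Finset (A × B)} {a : A} {b : B}
    (hM : M ∈ matchings A r (T.erase b)) (ha : a ∉ rows M) (hb : b ∈ T) :
    insert (a, b) M ∈ matchings A (r + 1) T := by
  rw [mem_matchings] at hM ⊢
  have hbM : b ∉ cols M := fun h => by simpa using hM.2.2 h
  refine ⟨hM.1.insert ha hbM, ?_, ?_⟩
  · rw [Finset.card_insert_of_notMem (notMem_of_row ha b), hM.2.1]
  · rw [cols_insert]
    exact Finset.insert_subset hb (hM.2.2.trans (Finset.erase_subset _ _))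

/-- Replacing the row of an edge of a matching. -/
theorem insert_mem_matchings_of_insert {M : Finset (A × B)} {a u : A} {b : B}
    (hM : insert (a, b) M ∈ matchings A r T) (ha : (a, b) ∉ M) (hb : b ∉ cols M)
    (hu : u ∉ rows M) : insert (u, b) M ∈ matchings A r T := by
  rw [mem_matchings] at hM ⊢
  refine ⟨(hM.1.subset (Finset.subset_insert _ _)).insert hu hb, ?_, ?_⟩
  · rw [Finset.card_insert_of_notMem (notMem_of_row hu b), ← hM.2.1,
      Finset.card_insert_of_notMem ha]
  · rw [cols_insert]
    rw [cols_insert] at hM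
    exact hM.2.2

/-- `N` with the edge `(a, b)` beats every matching without row `a`, so the new optimum uses this
edge; the rest is an `r`-matching avoiding `b` that is no dearer than `N`, hence is `N`. -/
theorem IsOptimal.mem_rows_of_lt {M N : Finset (A × B)} {a : A} {b : B} {x : ℝ≥0∞}
    (hc : Generic c) (ha : c a = fun _ => ⊤)
    (hM : IsOptimal (Function.update c a (singleRow b x)) (r + 1) T M)
    (hN : IsOptimal c r (T.erase b) N) (hb : b ∈ T) (h : x + cost c N < minCost c (r + 1) T) :
    rows M = insert a (rows N) ∧
      cost (Function.update c a (singleRow b x)) M = x + cost c N := by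
  have haN : a ∉ rows N := notMem_rows_of_top hN.2.1 ha
  have h1 := hM.2.2 _ (insert_mem_matchings hN.1 haN hb)
  rw [cost_insert_singleRow x haN] at h1
  have haM : a ∈ rows M := by
    by_contra haM
    rw [cost_update haM] at h1
    exact absurd (h1.trans_lt h) (minCost_le hM.1).not_gt
  obtain ⟨M₁, rfl, hm, hM₁, haM₁, hbM₁, hcost⟩ :=
    (mem_matchings.1 hM.1).1.exists_singleRow_edge hM.2.1 haM
  have hMm := mem_matchings.1 hM.1
  rw [Finset.card_insert_of_notMem hm, cols_insert] at hMm
  have hM₁m : M₁ ∈ matchings A r (T.erase b) := mem_matchings.2 ⟨hM₁, by omega, fun y hy =>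
    Finset.mem_erase.2 ⟨fun h => hbM₁ (h ▸ hy), hMm.2.2 (Finset.mem_insert_of_mem hy)⟩⟩
  have hx : x ≠ ⊤ := fun hx => hM.2.1 (by rw [hcost, hx, top_add])
  rw [hcost] at h1
  have h2 : cost c M₁ ≤ cost c N := (ENNReal.add_le_add_iff_left hx).1 h1
  have h3 := hc N M₁ (le_antisymm (hN.2.2 _ hM₁m) h2) hN.2.1
  subst h3
  exact ⟨rows_insert _ _ _, hcost⟩

theorem IsOptimal.notMem_rows_of_lt {M : Finset (A × B)} {a : A} {b : B} {x : ℝ≥0∞}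
    (ha : c a = fun _ => ⊤)
    (hM : IsOptimal (Function.update c a (singleRow b x)) (r + 1) T M)
    (h : minCost c (r + 1) T < x + minCost c r (T.erase b)) : a ∉ rows M := by
  intro haM
  obtain ⟨M₁, rfl, hm, hM₁, haM₁, hbM₁, hcost⟩ :=
    (mem_matchings.1 hM.1).1.exists_singleRow_edge hM.2.1 haM
  have hMm := mem_matchings.1 hM.1
  rw [Finset.card_insert_of_notMem hm, cols_insert] at hMm
  have hM₁m : M₁ ∈ matchings A r (T.erase b) := mem_matchings.2 ⟨hM₁, by omega, fun y hy =>
    Finset.mem_erase.2 ⟨fun h => hbM₁ (h ▸ hy), hMm.2.2 (Finset.mem_insert_of_mem hy)⟩⟩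
  obtain ⟨N, hN, hlt⟩ := exists_cost_lt h
  have h1 := hM.2.2 N hN
  rw [cost_update (notMem_rows_of_top (hlt.trans_le le_top).ne ha), hcost] at h1
  exact absurd (h1.trans_lt hlt) (not_lt.2 (add_le_add le_rfl (minCost_le hM₁m)))

theorem IsOptimal.notMem_rows_of_notMem {M : Finset (A × B)} {a : A} {b : B} {x : ℝ≥0∞}
    (hM : IsOptimal (Function.update c a (singleRow b x)) r T M) (hb : b ∉ T) : a ∉ rows M := by
  intro haM
  obtain ⟨M₁, rfl, -⟩ :=
    (mem_matchings.1 hM.1).1.exists_singleRow_edge hM.2.1 haM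
  exact hb ((mem_matchings.1 hM.1).2.2 (by simp [cols_insert]))

end Optimal

/-! ### Merging an extra row into another row -/

section Merge

variable {A B : Type*} [DecidableEq A] [DecidableEq B]
variable {c : A → B → ℝ≥0∞} {a u : A} {d : B} {x : ℝ≥0∞}

/-- The cost matrix with the entry in row `u` and column `d` replaced by `x`. -/
noncomputable def setEntry (c : A → B → ℝ≥0∞) (u : A) (d : B) (x : ℝ≥0∞) : A → B → ℝ≥0∞ :=
  Function.update c u (Function.update (c u) d x)

theorem setEntry_self : setEntry c u d x u d = x := by simp [setEntry]

theorem setEntry_of_ne {v : A} {b : B} (h : (v, b) ≠ (u, d)) : setEntry c u d x v b = c v b := by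
  unfold setEntry
  by_cases hv : v = u
  · subst hv
    have hb : b ≠ d := fun hb => h (by rw [hb])
    simp [hb]
  · simp [hv]

theorem setEntry_top (hau : a ≠ u) (ha : c a = fun _ => ⊤) :
    setEntry c u d x a = fun _ => ⊤ := by
  rw [setEntry, Function.update_of_ne hau, ha]

theorem cost_setEntry_of_notMem {M : Finset (A × B)} (h : (u, d) ∉ M) :
    cost (setEntry c u d x) M = cost c M :=
  cost_congr fun _ _ hm => setEntry_of_ne fun he => h (he ▸ hm)

theorem cost_setEntry_insert {M : Finset (A × B)} (h : (u, d) ∉ M) :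
    cost (setEntry c u d x) (insert (u, d) M) = x + cost c M := by
  rw [cost_insert _ h, setEntry_self, cost_setEntry_of_notMem h]

/-- Trading `(u, d)` for `(a, d)` turns sets of finite cost for the merged matrix injectively into
sets of the same cost for the matrix with the extra row. -/
theorem Generic.setEntry (hg : Generic (Function.update c a (singleRow d x)))
    (hau : a ≠ u) (ha : c a = fun _ => ⊤) : Generic (setEntry c u d x) := by
  have key : ∀ M : Finset (A × B), cost (Matching.setEntry c u d x) M ≠ ⊤ →
      ∃ M₁, a ∉ rows M₁ ∧ (u, d) ∉ M₁ ∧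
        ((M = M₁ ∧ cost (Function.update c a (singleRow d x)) M₁ =
          cost (Matching.setEntry c u d x) M) ∨
        (M = insert (u, d) M₁ ∧
          cost (Function.update c a (singleRow d x)) (insert (a, d) M₁) =
          cost (Matching.setEntry c u d x) M)) := by
    intro M hM
    have haM : a ∉ rows M := notMem_rows_of_top hM (setEntry_top hau ha)
    by_cases h : (u, d) ∈ M
    · have h1 : a ∉ rows (M.erase (u, d)) := fun h' => haM (rows_mono (Finset.erase_subset _ _) h')
      have h2 : (u, d) ∉ M.erase (u, d) := by simp
      refine ⟨M.erase (u, d), h1, h2, Or.inr ⟨(Finset.insert_erase h).symm, ?_⟩⟩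
      rw [cost_insert_singleRow x h1, ← cost_setEntry_insert h2, Finset.insert_erase h]
    · exact ⟨M, haM, h, Or.inl ⟨rfl, by rw [cost_update haM, cost_setEntry_of_notMem h]⟩⟩
  intro M N hMN hM
  obtain ⟨M₁, hM1, hM2, hM3⟩ := key M hM
  obtain ⟨N₁, hN1, hN2, hN3⟩ := key N (hMN ▸ hM)
  have e1 : (a, d) ∉ M₁ := notMem_of_row hM1 d
  have e2 : (a, d) ∉ N₁ := notMem_of_row hN1 d
  rcases hM3 with ⟨rfl, h1⟩ | ⟨rfl, h1⟩ <;> rcases hN3 with ⟨rfl, h2⟩ | ⟨rfl, h2⟩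
  · exact hg _ _ (h1.trans (hMN.trans h2.symm)) (by rwa [h1])
  · have := hg _ _ (h1.trans (hMN.trans h2.symm)) (by rwa [h1])
    exact absurd (this ▸ Finset.mem_insert_self _ _) e1
  · have := hg _ _ (h1.trans (hMN.trans h2.symm)) (by rwa [h1])
    exact absurd (this ▸ Finset.mem_insert_self _ _) e2
  · have := hg _ _ (h1.trans (hMN.trans h2.symm)) (by rwa [h1])
    rw [← Finset.erase_insert e1, ← Finset.erase_insert e2, this]

variable [Fintype A] [Fintype B] {r : ℕ} {T : Finset B}

theorem exists_split_of_mem {L : Finset (A × B)} (hL : L ∈ matchings A r T) (h : (u, d) ∈ L) :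
    ∃ L₁, L = insert (u, d) L₁ ∧ (u, d) ∉ L₁ ∧ u ∉ rows L₁ ∧ d ∉ cols L₁ := by
  obtain ⟨L₁, h1, h2, -, h3, h4⟩ := (mem_matchings.1 hL).1.exists_eq_insert h
  exact ⟨L₁, h1, h2, h3, h4⟩

/-- A matching for the modified matrix lifts to one for the matrix with the additional row. -/
theorem exists_lift (hau : a ≠ u) (ha : c a = fun _ => ⊤) {L : Finset (A × B)}
    (hL : L ∈ matchings A r T) :
    ∃ L' ∈ matchings A r T,
      cost (Function.update c a (singleRow d x)) L' ≤ cost (setEntry c u d x) L := by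
  by_cases ht : cost (setEntry c u d x) L = ⊤
  · exact ⟨L, hL, by simp [ht]⟩
  have haL : a ∉ rows L := notMem_rows_of_top ht (setEntry_top hau ha)
  by_cases h : (u, d) ∈ L
  · obtain ⟨L₁, rfl, h1, h2, h3⟩ := exists_split_of_mem hL h
    have haL₁ : a ∉ rows L₁ := fun h' => haL (rows_mono (Finset.subset_insert _ _) h')
    refine ⟨insert (a, d) L₁, insert_mem_matchings_of_insert hL h1 h3 haL₁, ?_⟩
    rw [cost_insert_singleRow x haL₁, cost_setEntry_insert h1]
  · exact ⟨L, hL, by rw [cost_update haL, cost_setEntry_of_notMem h]⟩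

/-- A matching not covering both the additional row and the row `u` projects to one for the
modified matrix. -/
theorem exists_proj (hx : x ≤ c u d) {L : Finset (A × B)} (hL : L ∈ matchings A r T)
    (hnot : a ∉ rows L ∨ u ∉ rows L) :
    ∃ L' ∈ matchings A r T,
      cost (setEntry c u d x) L' ≤ cost (Function.update c a (singleRow d x)) L := by
  by_cases ht : cost (Function.update c a (singleRow d x)) L = ⊤
  · exact ⟨L, hL, by simp [ht]⟩
  by_cases haL : a ∈ rows L
  · obtain ⟨L₁, rfl, h1, h2, h3, h4, hcost⟩ :=
      (mem_matchings.1 hL).1.exists_singleRow_edge ht haL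
    have hu : u ∉ rows L₁ := fun h' => hnot.elim (absurd haL)
      fun h => h (rows_mono (Finset.subset_insert _ _) h')
    refine ⟨insert (u, d) L₁, insert_mem_matchings_of_insert hL h1 h4 hu, ?_⟩
    rw [hcost, cost_setEntry_insert (notMem_of_row hu d)]
  · refine ⟨L, hL, ?_⟩
    rw [cost_update haL]
    refine cost_mono (fun v b => ?_) L
    by_cases h : (v, b) = (u, d)
    · obtain ⟨rfl, rfl⟩ := Prod.mk.inj h
      rwa [setEntry_self]
    · rw [setEntry_of_ne h]

variable {b : B} {M₁ N₁ M₂ N₂ : Finset (A × B)}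

/-- If the additional row `a` joins the optimum while the row `u` does not, then merging `a`
into `u` makes `u` join the optimum. -/
theorem merge_of_join (hg : Generic (Function.update c a (singleRow d x))) (hau : a ≠ u)
    (ha : c a = fun _ => ⊤)
    (hM₁ : IsOptimal (Function.update c a (singleRow d x)) (r + 1) T M₁)
    (hN₁ : IsOptimal (Function.update c a (singleRow d x)) r (T.erase b) N₁)
    (hM₂ : IsOptimal (setEntry c u d x) (r + 1) T M₂)
    (hN₂ : IsOptimal (setEntry c u d x) r (T.erase b) N₂)
    (haM : a ∈ rows M₁) (haN : a ∉ rows N₁) (huM : u ∉ rows M₁) :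
    x < c u d ∧ (u, d) ∈ M₂ ∧ u ∉ rows N₂ ∧ N₂ = N₁ ∧
      cost (Function.update c a (singleRow d x)) M₁ = cost (setEntry c u d x) M₂ := by
  have hg₂ := hg.setEntry hau ha
  have huN : u ∉ rows N₁ := fun h => huM (hN₁.rows_subset hg hM₁ h)
  obtain ⟨L, rfl, h1, h2, h3, h4, hcost⟩ :=
      (mem_matchings.1 hM₁.1).1.exists_singleRow_edge hM₁.2.1 haM
  have huL : u ∉ rows L := fun h' => huM (rows_mono (Finset.subset_insert _ _) h')
  have hmem : insert (u, d) L ∈ matchings A (r + 1) T :=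
    insert_mem_matchings_of_insert hM₁.1 h1 h4 huL
  -- Otherwise trading `(a, d)` for `(u, d)` in the optimum would not raise the cost, against
  -- genericity.
  have hlt : x < c u d := by
    by_contra! hle
    have h5 := hM₁.2.2 _ hmem
    have haL : a ∉ rows (insert (u, d) L) := by simp [rows_insert, hau, h3]
    have h6 : cost (Function.update c a (singleRow d x)) (insert (u, d) L) ≤
        cost (Function.update c a (singleRow d x)) (insert (a, d) L) := by
      rw [hcost, cost_update haL, cost_insert _ (notMem_of_row huL d)]
      gcongr
    have h7 := hg _ _ (le_antisymm h5 h6) hM₁.2.1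
    exact haL (h7 ▸ haM)
  have hcM : cost (setEntry c u d x) (insert (u, d) L) =
      cost (Function.update c a (singleRow d x)) (insert (a, d) L) := by
    rw [hcost, cost_setEntry_insert (notMem_of_row huL d)]
  have hoM : IsOptimal (setEntry c u d x) (r + 1) T (insert (u, d) L) := by
    refine ⟨hmem, hcM ▸ hM₁.2.1, fun K hK => ?_⟩
    obtain ⟨K', hK', hle⟩ := exists_lift (d := d) (x := x) hau ha hK
    rw [hcM]
    exact (hM₁.2.2 K' hK').trans hle
  have hcN : cost (setEntry c u d x) N₁ = cost (Function.update c a (singleRow d x)) N₁ := by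
    rw [cost_update haN, cost_setEntry_of_notMem (notMem_of_row huN d)]
  have hoN : IsOptimal (setEntry c u d x) r (T.erase b) N₁ := by
    refine ⟨hN₁.1, hcN ▸ hN₁.2.1, fun K hK => ?_⟩
    obtain ⟨K', hK', hle⟩ := exists_lift (d := d) (x := x) hau ha hK
    rw [hcN]
    exact (hN₁.2.2 K' hK').trans hle
  obtain rfl := hoM.unique hg₂ hM₂
  obtain rfl := hoN.unique hg₂ hN₂
  exact ⟨hlt, Finset.mem_insert_self _ _, huN, rfl, hcM.symm⟩

/-- The converse of `merge_of_join`. -/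
theorem join_of_merge (hg : Generic (Function.update c a (singleRow d x))) (hau : a ≠ u)
    (ha : c a = fun _ => ⊤)
    (hM₁ : IsOptimal (Function.update c a (singleRow d x)) (r + 1) T M₁)
    (hN₁ : IsOptimal (Function.update c a (singleRow d x)) r (T.erase b) N₁)
    (hM₂ : IsOptimal (setEntry c u d x) (r + 1) T M₂)
    (hN₂ : IsOptimal (setEntry c u d x) r (T.erase b) N₂)
    (hlt : x < c u d) (hmem : (u, d) ∈ M₂) (huN : u ∉ rows N₂) :
    a ∈ rows M₁ ∧ a ∉ rows N₁ ∧ u ∉ rows M₁ := by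
  have haN : a ∉ rows N₂ := notMem_rows_of_top hN₂.2.1 (setEntry_top hau ha)
  have hcN : cost (Function.update c a (singleRow d x)) N₂ = cost (setEntry c u d x) N₂ := by
    rw [cost_update haN, cost_setEntry_of_notMem (notMem_of_row huN d)]
  have hone : ∀ L ∈ matchings A r (T.erase b), (a ∉ rows L ∨ u ∉ rows L) →
      cost (setEntry c u d x) N₂ ≤ cost (Function.update c a (singleRow d x)) L := by
    intro L hL hnot
    obtain ⟨L', hL', hle⟩ := exists_proj hlt.le hL hnot
    exact (hN₂.2.2 L' hL').trans hle
  have hN : N₁ = N₂ := by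
    refine hg _ _ (le_antisymm (hN₁.2.2 _ hN₂.1) ?_) hN₁.2.1
    rw [hcN]
    by_cases hnot : a ∉ rows N₁ ∨ u ∉ rows N₁
    · exact hone N₁ hN₁.1 hnot
    · push Not at hnot
      have hm1 := mem_matchings.1 hN₁.1
      have hm2 := mem_matchings.1 hN₂.1
      -- If `N₁` covers both `a` and `u`, exchanging `a` with `N₂` leaves one matching without `a`
      -- and one without `u`. Both project to the merged matrix, so their total cost is at least
      -- twice that of `N₂`.
      obtain ⟨M', N', a', ha', haM', hM', hN', hU, hI, hrM, hrN⟩ :=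
        exists_exchange _ N₁ N₂ a rfl hm1.1 hm2.1 (by omega) hnot.1 haN
      have hsub : cols M' ∪ cols N' ⊆ T.erase b := by
        rw [← cols_union, hU, cols_union]
        exact Finset.union_subset hm1.2.2 hm2.2.2
      have hcM' : M'.card = r := by
        rw [← hM'.card_rows, hrM, Finset.card_insert_of_notMem (by simp [haM']),
          Finset.card_erase_add_one hnot.1, hm1.1.card_rows, hm1.2.1]
      have hcN' : N'.card = r := by
        rw [← hN'.card_rows, hrN, Finset.card_insert_of_notMem (by simp [haN]),
          Finset.card_erase_add_one ha', hm2.1.card_rows, hm2.2.1]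
      have hne : a ≠ a' := fun h => haN (h ▸ ha')
      have h1 := hone M' (mem_matchings.2 ⟨hM', hcM', Finset.union_subset_left hsub⟩)
        (Or.inl (by simp [hrM, hne]))
      have h2 := hone N' (mem_matchings.2 ⟨hN', hcN', Finset.union_subset_right hsub⟩)
        (Or.inr (by simp [hrN, hau.symm, huN]))
      have h3 := cost_exchange (Function.update c a (singleRow d x)) hU hI
      by_contra! h
      have h4 := ENNReal.add_lt_add_of_lt_of_le hN₂.2.1 h le_rfl
        (c := cost (setEntry c u d x) N₂)
      rw [hcN] at h3
      rw [← h3] at h4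
      exact absurd h4 (not_lt.2 (add_le_add h1 h2))
  subst hN
  have hsub := hN₁.rows_subset hg hM₁
  have hmM := mem_matchings.1 hM₁.1
  have hmN := mem_matchings.1 hN₁.1
  -- `M₁` has only one row more than `N₁`, which covers neither `a` nor `u`.
  have hnot : a ∉ rows M₁ ∨ u ∉ rows M₁ := by
    by_contra! h
    have h1 : insert a (insert u (rows N₁)) ⊆ rows M₁ :=
      Finset.insert_subset h.1 (Finset.insert_subset h.2 hsub)
    have h2 := Finset.card_le_card h1
    rw [Finset.card_insert_of_notMem (by simp [hau, haN]), Finset.card_insert_of_notMem huN,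
      hmN.1.card_rows, hmM.1.card_rows] at h2
    omega
  obtain ⟨L, rfl, h1, h2, h3⟩ := exists_split_of_mem hM₂.1 hmem
  have haL : a ∉ rows L := fun h => notMem_rows_of_top hM₂.2.1 (setEntry_top hau ha)
    (rows_mono (Finset.subset_insert _ _) h)
  have h4 : insert (a, d) L ∈ matchings A (r + 1) T :=
    insert_mem_matchings_of_insert hM₂.1 h1 h3 haL
  have hcM : cost (Function.update c a (singleRow d x)) (insert (a, d) L) =
      cost (setEntry c u d x) (insert (u, d) L) := by
    rw [cost_insert_singleRow x haL, cost_setEntry_insert h1]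
  obtain ⟨K, hK, hle⟩ := exists_proj hlt.le hM₁.1 hnot
  have h5 : M₁ = insert (a, d) L := by
    refine hg _ _ (le_antisymm (hM₁.2.2 _ h4) ?_) hM₁.2.1
    rw [hcM]
    exact (hM₂.2.2 K hK).trans hle
  subst h5
  exact ⟨by simp [rows_insert], haN, by simp [rows_insert, hau.symm, h2]⟩

end Merge

/-! ### Product measures with one factor replaced -/

section Update

variable {ι : Type*} [Fintype ι] [DecidableEq ι] {X : Type*} [MeasurableSpace X]

theorem lmarginal_congr_measure {μ ν : ι → Measure X} {s : Finset ι}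
    (h : ∀ i ∈ s, ν i = μ i) (f : (ι → X) → ℝ≥0∞) : lmarginal ν s f = lmarginal μ s f := by
  ext x
  have : (fun i : s => ν i) = fun i : s => μ i := funext fun i => h i i.2
  unfold lmarginal
  rw [this]

theorem measurable_lintegral_update (ν : Measure X) [SFinite ν] (a : ι)
    {f : (ι → X) → ℝ≥0∞} (hf : Measurable f) :
    Measurable fun c => ∫⁻ y, f (Function.update c a y) ∂ν :=
  Measurable.lintegral_prod_right' (f := fun p : (ι → X) × X => f (Function.update p.1 a p.2))
    (hf.comp measurable_update')

/-- Integrating with respect to a product measure after replacing one of the factors. -/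
theorem lintegral_pi_update [Nonempty X] (μ ν : ι → Measure X) [∀ i, SigmaFinite (μ i)]
    [∀ i, SigmaFinite (ν i)] (a : ι) [IsProbabilityMeasure (μ a)] (h : ∀ i, i ≠ a → ν i = μ i)
    {f : (ι → X) → ℝ≥0∞} (hf : Measurable f) :
    ∫⁻ c, f c ∂Measure.pi ν = ∫⁻ c, ∫⁻ y, f (Function.update c a y) ∂ν a ∂Measure.pi μ := by
  inhabit X
  have hg := measurable_lintegral_update (ν a) a hf
  rw [lintegral_eq_lmarginal_univ default, lintegral_eq_lmarginal_univ default,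
    lmarginal_erase' (μ := ν) f hf (Finset.mem_univ a), lmarginal_erase' (μ := μ) _ hg (Finset.mem_univ a)]
  rw [lmarginal_congr_measure (fun i hi => h i (Finset.ne_of_mem_erase hi))]
  -- The inner integral no longer depends on coordinate `a`, and `μ a` has mass one.
  simp

theorem ae_pi_update [Nonempty X] (μ ν : ι → Measure X) [∀ i, SigmaFinite (μ i)]
    [∀ i, SigmaFinite (ν i)] (a : ι) [IsProbabilityMeasure (μ a)] (h : ∀ i, i ≠ a → ν i = μ i)
    {p : (ι → X) → Prop} (hp : MeasurableSet {c | p c}) :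
    (∀ᵐ c ∂Measure.pi ν, p c) ↔
      ∀ᵐ c ∂Measure.pi μ, ∀ᵐ y ∂ν a, p (Function.update c a y) := by
  have hm : Measurable (Set.indicator {c | p c}ᶜ (1 : (ι → X) → ℝ≥0∞)) :=
    measurable_one.indicator hp.compl
  have h1 : Measure.pi ν {c | p c}ᶜ =
      ∫⁻ c, ν a {y | ¬ p (Function.update c a y)} ∂Measure.pi μ := by
    rw [← lintegral_indicator_one hp.compl, lintegral_pi_update μ ν a h hm]
    refine lintegral_congr fun c => ?_
    have hm' : MeasurableSet {y | ¬ p (Function.update c a y)} :=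
      (measurable_update c hp).compl
    rw [← lintegral_indicator_one hm']
    rfl
  have h2 : Measurable fun c => ν a {y | ¬ p (Function.update c a y)} := by
    convert measurable_lintegral_update (ν a) a hm using 2 with c
    have hm' : MeasurableSet {y | ¬ p (Function.update c a y)} :=
      (measurable_update c hp).compl
    rw [← lintegral_indicator_one hm']
    rfl
  rw [ae_iff]
  change Measure.pi ν {c | p c}ᶜ = 0 ↔ _
  rw [h1, lintegral_eq_zero_iff h2]
  rfl

end Update

/-! ### The exponential law and infinitesimal rows -/

section Laws

theorem sigmaFinite_map_of_leftInverse {X Y : Type*} [MeasurableSpace X] [MeasurableSpace Y]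
    {μ : Measure X} [SigmaFinite μ] {f : X → Y} {g : Y → X} (hf : Measurable f)
    (hg : Measurable g) (h : ∀ᵐ x ∂μ, g (f x) = x) : SigmaFinite (μ.map f) := by
  refine ⟨⟨⟨fun n => g ⁻¹' spanningSets μ n, fun _ => trivial, fun n => ?_, ?_⟩⟩⟩
  · rw [Measure.map_apply hf (hg (measurableSet_spanningSets μ n))]
    refine lt_of_eq_of_lt (measure_congr ?_) (measure_spanningSets_lt_top μ n)
    filter_upwards [h] with x hx
    refine propext ?_
    change g (f x) ∈ spanningSets μ n ↔ x ∈ spanningSets μ n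
    rw [hx]
  · rw [← Set.preimage_iUnion, iUnion_spanningSets, Set.preimage_univ]

/-- Lebesgue measure on the half-line, as a measure on `ℝ≥0∞`. -/
noncomputable def halfLine : Measure ℝ≥0∞ :=
  (volume.restrict (Set.Ici (0 : ℝ))).map ENNReal.ofReal

/-- The exponential distribution of mean `1`, as a measure on `ℝ≥0∞`. -/
noncomputable def expLaw : Measure ℝ≥0∞ :=
  halfLine.withDensity fun x => ENNReal.ofReal (Real.exp (-x.toReal))

theorem lintegral_halfLine {f : ℝ≥0∞ → ℝ≥0∞} (hf : Measurable f) :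
    ∫⁻ x, f x ∂halfLine = ∫⁻ x in Set.Ici (0 : ℝ), f (ENNReal.ofReal x) := by
  rw [halfLine, lintegral_map hf ENNReal.measurable_ofReal]

instance : SigmaFinite halfLine := by
  refine sigmaFinite_map_of_leftInverse ENNReal.measurable_ofReal ENNReal.measurable_toReal ?_
  filter_upwards [ae_restrict_mem measurableSet_Ici] with x hx
  exact ENNReal.toReal_ofReal hx

instance : NullSingletonClass halfLine where
  measure_singleton y := by
    rw [halfLine, Measure.map_apply ENNReal.measurable_ofReal (measurableSet_singleton y),
      Measure.restrict_apply (ENNReal.measurable_ofReal (measurableSet_singleton y))]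
    refine Set.Subsingleton.measure_zero ?_ _
    rintro x ⟨hx, hx'⟩ z ⟨hz, hz'⟩
    have := congrArg ENNReal.toReal (show ENNReal.ofReal x = ENNReal.ofReal z from
      (Set.mem_singleton_iff.1 hx).trans (Set.mem_singleton_iff.1 hz).symm)
    rwa [ENNReal.toReal_ofReal hx', ENNReal.toReal_ofReal hz'] at this

instance : NullSingletonClass expLaw := by
  unfold expLaw
  infer_instance

theorem lintegral_expLaw {f : ℝ≥0∞ → ℝ≥0∞} (hf : Measurable f) :
    ∫⁻ x, f x ∂expLaw = ∫⁻ x, ENNReal.ofReal (Real.exp (-x.toReal)) * f x ∂halfLine := by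
  rw [expLaw, lintegral_withDensity_eq_lintegral_mul _ (by fun_prop) hf]
  rfl

theorem expLaw_eq_map : expLaw = (expMeasure 1).map ENNReal.ofReal := by
  refine Measure.ext_of_lintegral _ fun f hf => ?_
  rw [lintegral_expLaw hf, lintegral_halfLine (by fun_prop),
    lintegral_map hf ENNReal.measurable_ofReal]
  change _ = ∫⁻ x, f (ENNReal.ofReal x) ∂(volume.withDensity (exponentialPDF 1))
  have hm : Measurable (exponentialPDF 1) := (measurable_exponentialPDFReal 1).ennreal_ofReal
  have hm' : Measurable fun x => f (ENNReal.ofReal x) := hf.comp ENNReal.measurable_ofReal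
  rw [lintegral_withDensity_eq_lintegral_mul _ hm hm', ← lintegral_indicator measurableSet_Ici]
  refine lintegral_congr fun x => ?_
  by_cases hx : 0 ≤ x
  · simp [exponentialPDF_eq, hx]
  · simp [exponentialPDF_eq, hx]

instance : IsProbabilityMeasure expLaw := by
  have := isProbabilityMeasure_expMeasure one_pos
  rw [expLaw_eq_map]
  exact Measure.isProbabilityMeasure_map ENNReal.measurable_ofReal.aemeasurable

theorem expLaw_Ioi {x : ℝ≥0∞} (hx : x ≠ ⊤) :
    expLaw (Set.Ioi x) = ENNReal.ofReal (Real.exp (-x.toReal)) := by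
  have := isProbabilityMeasure_expMeasure one_pos
  have h1 := cdf_expMeasure_eq one_pos x.toReal
  rw [if_pos ENNReal.toReal_nonneg, one_mul, cdf_eq_real] at h1
  have h2 : ENNReal.ofReal ⁻¹' Set.Ioi x = (Set.Iic x.toReal)ᶜ := by
    ext y
    simp [ENNReal.lt_ofReal_iff_toReal_lt hx]
  rw [expLaw_eq_map, Measure.map_apply ENNReal.measurable_ofReal measurableSet_Ioi, h2,
    ← ofReal_measureReal, probReal_compl_eq_one_sub measurableSet_Iic, h1]
  simp

theorem ae_halfLine_ne_top : ∀ᵐ x ∂halfLine, x ≠ ⊤ := by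
  simp [ae_iff]

theorem ae_expLaw_ne_top : ∀ᵐ x ∂expLaw, x ≠ ⊤ := by
  simp [ae_iff]

/-- An infinitesimal edge that is cheaper than an exponential one has the law of the latter. -/
theorem lintegral_expLaw_halfLine {g : ℝ≥0∞ → ℝ≥0∞} (hg : Measurable g) :
    ∫⁻ y, ∫⁻ x, (Set.Iio y).indicator g x ∂halfLine ∂expLaw = ∫⁻ y, g y ∂expLaw := by
  have hm : Measurable fun p : ℝ≥0∞ × ℝ≥0∞ => (Set.Iio p.1).indicator g p.2 := by
    have : (fun p : ℝ≥0∞ × ℝ≥0∞ => (Set.Iio p.1).indicator g p.2) =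
        {p : ℝ≥0∞ × ℝ≥0∞ | p.2 < p.1}.indicator fun p => g p.2 := by
      ext p
      simp [Set.indicator]
    rw [this]
    exact (hg.comp measurable_snd).indicator (measurableSet_lt measurable_snd measurable_fst)
  -- After the swap, the inner integral is `g x` times the tail `exp (-x)`, which is also the
  -- density of the exponential law.
  rw [lintegral_lintegral_swap hm.aemeasurable, lintegral_expLaw hg]
  refine lintegral_congr_ae ?_
  filter_upwards [ae_halfLine_ne_top] with x hx
  have : ∀ y, (Set.Iio y).indicator g x = (Set.Ioi x).indicator (fun _ => g x) y := by
    intro y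
    simp [Set.indicator]
  simp_rw [this]
  rw [lintegral_indicator_const measurableSet_Ioi, expLaw_Ioi hx, mul_comm]

variable (β : Type*) [Fintype β] [DecidableEq β]

/-- The law of a row of independent exponential costs. -/
noncomputable def regularRow : Measure (β → ℝ≥0∞) := Measure.pi fun _ => expLaw

/-- The infinite measure describing a row of exponential costs of infinitesimal rate. -/
noncomputable def extraRow : Measure (β → ℝ≥0∞) :=
  Measure.sum fun b => halfLine.map (singleRow b)

instance : IsProbabilityMeasure (regularRow β) := by
  unfold regularRow
  infer_instance

variable {β}

theorem measurable_singleRow (b : β) : Measurable (singleRow b) :=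
  measurable_update _

variable (β) in
instance : SigmaFinite (extraRow β) := by
  have (b : β) : SigmaFinite (halfLine.map (singleRow b)) :=
    sigmaFinite_map_of_leftInverse (g := fun ρ => ρ b) (measurable_singleRow b)
      (measurable_pi_apply b) (by simp [singleRow])
  unfold extraRow
  infer_instance

theorem lintegral_extraRow {f : (β → ℝ≥0∞) → ℝ≥0∞} (hf : Measurable f) :
    ∫⁻ ρ, f ρ ∂extraRow β = ∑ b, ∫⁻ x, f (singleRow b x) ∂halfLine := by
  rw [extraRow, lintegral_sum_measure, tsum_fintype]
  exact Finset.sum_congr rfl fun b _ => lintegral_map hf (measurable_singleRow b)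

theorem ae_extraRow {p : (β → ℝ≥0∞) → Prop} (hp : MeasurableSet {ρ | p ρ}) :
    (∀ᵐ ρ ∂extraRow β, p ρ) ↔ ∀ b, ∀ᵐ x ∂halfLine, p (singleRow b x) := by
  rw [extraRow, Measure.ae_sum_iff]
  exact forall_congr' fun b => ae_map_iff (measurable_singleRow b).aemeasurable hp

/-- An infinitesimal edge in a column, cheaper than the entry of a regular row in that column,
may replace this entry. -/
theorem lintegral_regularRow_halfLine {g : (β → ℝ≥0∞) → ℝ≥0∞} (hg : Measurable g) (d : β) :
    ∫⁻ ρ, ∫⁻ x, (Set.Iio (ρ d)).indicator (fun x => g (Function.update ρ d x)) x ∂halfLine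
      ∂regularRow β = ∫⁻ ρ, g ρ ∂regularRow β := by
  have hm : Measurable fun p : (β → ℝ≥0∞) × ℝ≥0∞ =>
      (Set.Iio (p.1 d)).indicator (fun x => g (Function.update p.1 d x)) p.2 := by
    have : (fun p : (β → ℝ≥0∞) × ℝ≥0∞ =>
        (Set.Iio (p.1 d)).indicator (fun x => g (Function.update p.1 d x)) p.2) =
        {p : (β → ℝ≥0∞) × ℝ≥0∞ | p.2 < p.1 d}.indicator
          fun p => g (Function.update p.1 d p.2) := by
      ext p
      simp [Set.indicator]
    rw [this]
    exact (hg.comp measurable_update').indicator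
      (measurableSet_lt measurable_snd ((measurable_pi_apply d).comp measurable_fst))
  unfold regularRow
  rw [lintegral_pi_update (fun _ => expLaw) (fun _ => expLaw) d (fun _ _ => rfl)
    (Measurable.lintegral_prod_right' hm), lintegral_pi_update (fun _ => expLaw) (fun _ => expLaw) d
    (fun _ _ => rfl) hg]
  refine lintegral_congr fun ρ => ?_
  simp only [Function.update_self, Function.update_idem]
  exact lintegral_expLaw_halfLine (hg.comp (measurable_update ρ))

end Laws

/-! ### Measurability of costs and optima -/

section Measurability

variable {A B : Type*} [DecidableEq A] [DecidableEq B] [Fintype A] [Fintype B]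

theorem measurable_cost (M : Finset (A × B)) :
    Measurable fun c : A → B → ℝ≥0∞ => cost c M := by
  unfold cost
  fun_prop

theorem measurable_minCost (r : ℕ) (T : Finset B) :
    Measurable fun c : A → B → ℝ≥0∞ => minCost c r T := by
  unfold minCost
  exact Measurable.biInf _ (Finset.countable_toSet _) fun M _ => measurable_cost M

theorem measurable_cost_ne_top (M : Finset (A × B)) :
    Measurable fun c : A → B → ℝ≥0∞ => cost c M ≠ ⊤ :=
  (measurableSet_setOfPred.1 (measurable_cost M (measurableSet_singleton ⊤))).not

theorem measurable_isOptimal (r : ℕ) (T : Finset B) (M : Finset (A × B)) :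
    Measurable fun c : A → B → ℝ≥0∞ => IsOptimal c r T M := by
  unfold IsOptimal
  refine measurable_const.and ((measurable_cost_ne_top M).and ?_)
  exact Measurable.forall fun N => measurable_const.imp
    (measurableSet_setOfPred.1 (measurableSet_le (measurable_cost M) (measurable_cost N)))

theorem optimum_congr {c c' : A → B → ℝ≥0∞} {r : ℕ} {T : Finset B}
    (h : {M | IsOptimal c r T M} = {M | IsOptimal c' r T M}) : optimum c r T = optimum c' r T := by
  have : IsOptimal c r T = IsOptimal c' r T := h
  unfold optimum
  rw [this]

/-- The choice made by `optimum` depends only on the set of optimal matchings, which takes finitely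
many values, each on a measurable set. -/
theorem measurable_optimum (r : ℕ) (T : Finset B) (p : Finset (A × B) → Prop) :
    Measurable fun c : A → B → ℝ≥0∞ => p (optimum c r T) := by
  have : (fun c : A → B → ℝ≥0∞ => p (optimum c r T)) = fun c =>
      ∃ Q : Set (Finset (A × B)), (∃ c : A → B → ℝ≥0∞,
        p (optimum c r T) ∧ {M | IsOptimal c r T M} = Q) ∧ ∀ M, IsOptimal c r T M ↔ M ∈ Q := by
    ext c
    constructor
    · exact fun h => ⟨_, ⟨c, h, rfl⟩, fun M => Iff.rfl⟩
    · rintro ⟨_, ⟨c', h', rfl⟩, hQ⟩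
      rw [optimum_congr (Set.ext hQ)]
      exact h'
  rw [this]
  exact Measurable.exists fun Q => measurable_const.and
    (Measurable.forall fun M => (measurable_isOptimal r T M).iff measurable_const)

theorem measurable_generic : Measurable fun c : A → B → ℝ≥0∞ => Generic c := by
  unfold Generic
  exact Measurable.forall fun M => Measurable.forall fun N =>
    (measurableSet_setOfPred.1 (measurableSet_eq_fun (measurable_cost M) (measurable_cost N))).imp
      ((measurable_cost_ne_top M).imp measurable_const)

theorem measurable_setEntry (u : A) (d : B) :
    Measurable fun p : (A → B → ℝ≥0∞) × ℝ≥0∞ => setEntry p.1 u d p.2 := by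
  unfold setEntry
  have h0 : Measurable fun p : (A → B → ℝ≥0∞) × ℝ≥0∞ => (p.1 u, p.2) :=
    ((measurable_pi_apply u).comp measurable_fst).prodMk measurable_snd
  have h1 : Measurable fun p : (A → B → ℝ≥0∞) × ℝ≥0∞ => (p.1, Function.update (p.1 u) d p.2) :=
    measurable_fst.prodMk
      ((measurable_update' (X := fun _ : B => ℝ≥0∞) (a := d)).comp h0)
  exact (measurable_update' (X := fun _ : A => B → ℝ≥0∞) (a := u)).comp h1

/-- As a function of this entry the cost of `N` is constant, while that of `M` is the entry plus a
constant. -/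
theorem subsingleton_cost_eq (c : A → B → ℝ≥0∞) {M N : Finset (A × B)} {a : A} {b : B}
    (hM : (a, b) ∈ M) (hN : (a, b) ∉ N) :
    {y | cost (setEntry c a b y) M = cost (setEntry c a b y) N ∧
      cost (setEntry c a b y) M ≠ ⊤}.Subsingleton := by
  have key : ∀ y, cost (setEntry c a b y) M = y + cost c (M.erase (a, b)) := fun y => by
    rw [← cost_setEntry_insert (Finset.notMem_erase (a, b) M), Finset.insert_erase hM]
  rintro y ⟨h1, h2⟩ z ⟨h3, h4⟩
  rw [cost_setEntry_of_notMem hN, key] at h1 h3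
  rw [key] at h2
  rw [← h3] at h1
  exact (ENNReal.add_left_inj (ne_top_of_le_ne_top h2 le_add_self)).1 h1

theorem update_update_eq_setEntry (c : A → B → ℝ≥0∞) (a : A) (ρ : B → ℝ≥0∞) (b : B) (y : ℝ≥0∞) :
    Function.update c a (Function.update ρ b y) = setEntry (Function.update c a ρ) a b y := by
  simp [setEntry]

end Measurability

/-! ### The law of the enlarged matrix and its almost sure properties -/

section MatrixLaw

variable {α β ε : Type*} [DecidableEq α] [DecidableEq β] [DecidableEq ε]
  [Fintype α] [Fintype β] [Fintype ε]

/-- The laws of the rows of a matrix whose rows are indexed by regular rows and extra rows; only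
the extra rows in `S` are present. -/
noncomputable def rowLaw (S : Finset ε) : α ⊕ ε → Measure (β → ℝ≥0∞) :=
  Sum.elim (fun _ => regularRow β)
    fun e => if e ∈ S then extraRow β else Measure.dirac fun _ => ⊤

instance (S : Finset ε) (a : α ⊕ ε) : SigmaFinite (rowLaw (β := β) S a) := by
  rcases a with i | e
  · change SigmaFinite (regularRow β)
    infer_instance
  · change SigmaFinite (if e ∈ S then extraRow β else Measure.dirac fun _ => ⊤)
    split_ifs <;> infer_instance

instance (S : Finset ε) (i : α) : IsProbabilityMeasure (rowLaw (β := β) S (Sum.inl i : α ⊕ ε)) :=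
  inferInstanceAs (IsProbabilityMeasure (regularRow β))

theorem rowLaw_inr_of_mem {S : Finset ε} {e : ε} (h : e ∈ S) :
    rowLaw S (Sum.inr e : α ⊕ ε) = extraRow β := if_pos h

theorem rowLaw_inr_of_notMem {S : Finset ε} {e : ε} (h : e ∉ S) :
    rowLaw S (Sum.inr e : α ⊕ ε) = Measure.dirac (fun _ : β => (⊤ : ℝ≥0∞)) := if_neg h

variable (α β) in
/-- The law of a random matrix with independent rows. -/
noncomputable def matrixLaw (S : Finset ε) : Measure (α ⊕ ε → β → ℝ≥0∞) :=
  Measure.pi (rowLaw S)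

theorem rowLaw_insert {S : Finset ε} {e : ε} (i : α ⊕ ε) (hi : i ≠ Sum.inr e) :
    rowLaw (β := β) (insert e S) i = rowLaw S i := by
  rcases i with i | f
  · rfl
  · have hf : f ≠ e := fun h => hi (by rw [h])
    by_cases hfS : f ∈ S
    · rw [rowLaw_inr_of_mem hfS, rowLaw_inr_of_mem (Finset.mem_insert_of_mem hfS)]
    · rw [rowLaw_inr_of_notMem hfS, rowLaw_inr_of_notMem (by simp [hf, hfS])]

theorem lintegral_matrixLaw_insert {S : Finset ε} {e : ε} (he : e ∉ S)
    {f : (α ⊕ ε → β → ℝ≥0∞) → ℝ≥0∞} (hf : Measurable f) :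
    ∫⁻ c, f c ∂matrixLaw α β (insert e S) =
      ∫⁻ c, ∑ b, ∫⁻ x, f (Function.update c (Sum.inr e) (singleRow b x)) ∂halfLine
        ∂matrixLaw α β S := by
  have : IsProbabilityMeasure (rowLaw (β := β) S (Sum.inr e : α ⊕ ε)) := by
    rw [rowLaw_inr_of_notMem he]
    infer_instance
  unfold matrixLaw
  rw [lintegral_pi_update (rowLaw S) (rowLaw (insert e S)) (Sum.inr e) rowLaw_insert hf,
    rowLaw_inr_of_mem (Finset.mem_insert_self e S)]
  exact lintegral_congr fun c => lintegral_extraRow (hf.comp (measurable_update c))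

theorem ae_matrixLaw_insert {S : Finset ε} {e : ε} (he : e ∉ S)
    {p : (α ⊕ ε → β → ℝ≥0∞) → Prop} (hp : MeasurableSet {c | p c}) :
    (∀ᵐ c ∂matrixLaw α β (insert e S), p c) ↔
      ∀ᵐ c ∂matrixLaw α β S, ∀ b, ∀ᵐ x ∂halfLine,
        p (Function.update c (Sum.inr e) (singleRow b x)) := by
  have : IsProbabilityMeasure (rowLaw (β := β) S (Sum.inr e : α ⊕ ε)) := by
    rw [rowLaw_inr_of_notMem he]
    infer_instance
  unfold matrixLaw
  rw [ae_pi_update (rowLaw S) (rowLaw (insert e S)) (Sum.inr e) rowLaw_insert hp,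
    rowLaw_inr_of_mem (Finset.mem_insert_self e S)]
  refine Filter.eventually_congr (Filter.Eventually.of_forall fun c => ?_)
  exact ae_extraRow (measurable_update c hp)

/-- The almost sure properties of the matrices of law `matrixLaw α β S`. -/
def Good (S : Finset ε) (c : α ⊕ ε → β → ℝ≥0∞) : Prop :=
  Generic c ∧ (∀ i b, c (Sum.inl i) b ≠ ⊤) ∧ ∀ e, e ∉ S → c (Sum.inr e) = fun _ => ⊤

theorem measurable_good (S : Finset ε) :
    Measurable fun c : α ⊕ ε → β → ℝ≥0∞ => Good S c := by
  unfold Good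
  refine measurable_generic.and (Measurable.and ?_ ?_)
  · refine Measurable.forall fun i => Measurable.forall fun b => ?_
    have : Measurable fun c : α ⊕ ε → β → ℝ≥0∞ => c (Sum.inl i) b := by fun_prop
    exact (measurableSet_setOfPred.1 (this (measurableSet_singleton ⊤))).not
  · exact Measurable.forall fun e => measurable_const.imp
      (measurableSet_setOfPred.1 (measurable_pi_apply (Sum.inr e) (measurableSet_singleton _)))

/-- Distinct sets differ in some edge; given all other entries, a tie of finite costs allows one
value of its cost, and the laws have no atoms. In an extra row whose finite entry lies in another
column, the edge has cost `⊤` and nothing is to be shown. -/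
theorem ae_generic (S : Finset ε) : ∀ᵐ c ∂matrixLaw α β S, Generic c := by
  have key : ∀ (M N : Finset ((α ⊕ ε) × β)) (a : α ⊕ ε) (b : β), (a, b) ∈ M → (a, b) ∉ N →
      ∀ᵐ c ∂matrixLaw α β S, ¬ (cost c M = cost c N ∧ cost c M ≠ ⊤) := by
    intro M N a b hM hN
    have hp : MeasurableSet {c : α ⊕ ε → β → ℝ≥0∞ | ¬ (cost c M = cost c N ∧ cost c M ≠ ⊤)} :=
      (((measurableSet_setOfPred.1 (measurableSet_eq_fun (measurable_cost M)
        (measurable_cost N))).and (measurable_cost_ne_top M)).not).setOf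
    have hsub : ∀ (c : α ⊕ ε → β → ℝ≥0∞) (ρ : β → ℝ≥0∞) (μ : Measure ℝ≥0∞)
        [NullSingletonClass μ], ∀ᵐ y ∂μ,
          ¬ (cost (Function.update c a (Function.update ρ b y)) M =
            cost (Function.update c a (Function.update ρ b y)) N ∧
            cost (Function.update c a (Function.update ρ b y)) M ≠ ⊤) := by
      intro c ρ μ _
      simp_rw [update_update_eq_setEntry]
      rw [ae_iff]
      simp only [not_not]
      exact (subsingleton_cost_eq _ hM hN).measure_zero μ
    have htop : ∀ (c : α ⊕ ε → β → ℝ≥0∞) (ρ : β → ℝ≥0∞), ρ b = ⊤ →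
        cost (Function.update c a ρ) M = ⊤ := by
      intro c ρ hρ
      by_contra h
      exact ne_top_of_mem h hM (by simp [hρ])
    -- The reference measure needs a probability measure in coordinate `a`, whereas the law of an
    -- extra row may be infinite.
    let μ : α ⊕ ε → Measure (β → ℝ≥0∞) :=
      Function.update (rowLaw S) a (Measure.dirac fun _ => ⊤)
    have h1 (i : α ⊕ ε) : SigmaFinite (μ i) := by
      by_cases hi : i = a
      · subst hi
        simp only [μ, Function.update_self]
        infer_instance
      · simp only [μ, Function.update_of_ne hi]
        infer_instance
    have h2 : IsProbabilityMeasure (μ a) := by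
      simp only [μ, Function.update_self]
      infer_instance
    unfold matrixLaw
    rw [ae_pi_update μ (rowLaw S) a (fun i hi => by simp [μ, Function.update_of_ne hi]) hp]
    refine Filter.Eventually.of_forall fun c => ?_
    have hpc : MeasurableSet {ρ : β → ℝ≥0∞ | ¬ (cost (Function.update c a ρ) M =
        cost (Function.update c a ρ) N ∧ cost (Function.update c a ρ) M ≠ ⊤)} :=
      measurable_update c (a := a) hp
    rcases a with i | e
    · change ∀ᵐ ρ ∂(Measure.pi fun _ => expLaw), _
      rw [ae_pi_update (fun _ => expLaw) (fun _ => expLaw) b (fun _ _ => rfl) hpc]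
      exact Filter.Eventually.of_forall fun ρ => hsub c ρ expLaw
    · by_cases he : e ∈ S
      · rw [rowLaw_inr_of_mem he, ae_extraRow hpc]
        intro d
        by_cases hd : d = b
        · subst hd
          exact hsub c _ halfLine
        · refine Filter.Eventually.of_forall fun x h => h.2 (htop c _ ?_)
          simp [singleRow, Ne.symm hd]
      · rw [rowLaw_inr_of_notMem he, ae_dirac_iff hpc]
        exact fun h => h.2 (htop c _ rfl)
  unfold Generic
  rw [ae_all_iff]
  intro M
  rw [ae_all_iff]
  intro N
  by_cases hMN : M = N
  · exact Filter.Eventually.of_forall fun _ _ _ => hMN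
  by_cases hsub : M ⊆ N
  · obtain ⟨⟨a, b⟩, hN, hM⟩ := Finset.exists_of_ssubset (hsub.ssubset_of_ne hMN)
    filter_upwards [key N M a b hN hM] with c hc h1 h2
    exact absurd ⟨h1.symm, h1 ▸ h2⟩ hc
  · obtain ⟨⟨a, b⟩, hM, hN⟩ := Finset.not_subset.1 hsub
    filter_upwards [key M N a b hM hN] with c hc h1 h2
    exact absurd ⟨h1, h2⟩ hc

theorem ae_good (S : Finset ε) : ∀ᵐ c ∂matrixLaw α β S, Good S c := by
  refine (ae_generic S).and (Filter.Eventually.and ?_ ?_)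
  · rw [ae_all_iff]
    intro i
    have : ∀ᵐ ρ ∂rowLaw S (Sum.inl i : α ⊕ ε), ∀ b : β, ρ b ≠ ⊤ := by
      change ∀ᵐ ρ ∂(Measure.pi fun _ => expLaw), _
      rw [ae_all_iff]
      intro b
      exact (Measure.tendsto_eval_ae_ae (μ := fun _ : β => expLaw) (i := b)).eventually
        ae_expLaw_ne_top
    exact Measure.tendsto_eval_ae_ae.eventually this
  · rw [ae_all_iff]
    intro e
    by_cases he : e ∈ S
    · simp [he]
    have : ∀ᵐ ρ ∂rowLaw S (Sum.inr e : α ⊕ ε), ρ = fun _ : β => (⊤ : ℝ≥0∞) := by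
      rw [rowLaw_inr_of_notMem he, ae_dirac_eq]
      exact rfl
    filter_upwards [Measure.tendsto_eval_ae_ae.eventually this] with c hc _
    exact hc

theorem exists_isOptimal_of_regular {c : α ⊕ ε → β → ℝ≥0∞} (hc : ∀ i b, c (Sum.inl i) b ≠ ⊤)
    {r : ℕ} {T : Finset β} (hr : r ≤ Fintype.card α) (hT : r ≤ T.card) :
    ∃ M, IsOptimal c r T M := by
  obtain ⟨f⟩ : Nonempty (Fin r ↪ α) := Function.Embedding.nonempty_of_card_le (by simpa using hr)
  obtain ⟨g⟩ : Nonempty (Fin r ↪ T) := Function.Embedding.nonempty_of_card_le (by simpa using hT)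
  let M : Finset ((α ⊕ ε) × β) := Finset.univ.map
    ⟨fun i => (Sum.inl (f i), (g i : β)), fun i j h => f.injective (by simpa using congrArg Prod.fst h)⟩
  refine exists_isOptimal (M := M) (mem_matchings.2 ⟨⟨?_, ?_⟩, by simp [M], ?_⟩) ?_
  · intro x hx y hy h
    simp only [M, Finset.mem_map, Finset.mem_univ, true_and] at hx hy
    obtain ⟨i, rfl⟩ := hx
    obtain ⟨j, rfl⟩ := hy
    rw [f.injective (Sum.inl_injective h)]
  · intro x hx y hy h
    simp only [M, Finset.mem_map, Finset.mem_univ, true_and] at hx hy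
    obtain ⟨i, rfl⟩ := hx
    obtain ⟨j, rfl⟩ := hy
    rw [g.injective (Subtype.ext h)]
  · intro b hb
    obtain ⟨a, ha⟩ := mem_cols.1 hb
    simp only [M, Finset.mem_map, Finset.mem_univ, true_and] at ha
    obtain ⟨i, hi⟩ := ha
    rw [← (Prod.mk.inj hi).2]
    exact (g i).2
  · refine ENNReal.sum_ne_top.2 fun e he => ?_
    simp only [M, Finset.mem_map, Finset.mem_univ, true_and] at he
    obtain ⟨i, rfl⟩ := he
    exact hc _ _

theorem Good.isOptimal_optimum {S : Finset ε} {c : α ⊕ ε → β → ℝ≥0∞} (hc : Good S c)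
    {r : ℕ} {T : Finset β} (hr : r ≤ Fintype.card α) (hT : r ≤ T.card) :
    IsOptimal c r T (optimum c r T) :=
  Matching.isOptimal_optimum (exists_isOptimal_of_regular hc.2.1 hr hT)

end MatrixLaw

/-! ### Integrating out an infinitesimal cost -/

section ExpCost

/-- The function `x ↦ exp (-s x)` on `ℝ≥0∞`. -/
noncomputable def expCost (s : ℝ) (x : ℝ≥0∞) : ℝ≥0∞ :=
  ({⊤}ᶜ : Set ℝ≥0∞).indicator (fun x => ENNReal.ofReal (Real.exp (-(s * x.toReal)))) x

theorem expCost_of_ne_top (s : ℝ) {x : ℝ≥0∞} (hx : x ≠ ⊤) :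
    expCost s x = ENNReal.ofReal (Real.exp (-(s * x.toReal))) := by
  simp [expCost, hx]

theorem measurable_expCost (s : ℝ) : Measurable (expCost s) := by
  unfold expCost
  exact Measurable.indicator (by fun_prop) (measurableSet_singleton _).compl

theorem expCost_le_one {s : ℝ} (hs : 0 ≤ s) (x : ℝ≥0∞) : expCost s x ≤ 1 := by
  by_cases hx : x = ⊤
  · simp [expCost, hx]
  · rw [expCost_of_ne_top s hx, ENNReal.ofReal_le_one, Real.exp_le_one_iff, neg_nonpos]
    positivity

theorem setLIntegral_Ico_exp {s : ℝ} (hs : 0 < s) {l u : ℝ} (h : l ≤ u) :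
    ENNReal.ofReal s * (∫⁻ x in Set.Ico 0 (u - l), ENNReal.ofReal (Real.exp (-(s * (x + l))))) +
      ENNReal.ofReal (Real.exp (-(s * u))) = ENNReal.ofReal (Real.exp (-(s * l))) := by
  have hd : ∀ x ∈ Set.uIcc 0 (u - l), HasDerivAt (fun x => -Real.exp (-(s * (x + l))) / s)
      (Real.exp (-(s * (x + l)))) x := by
    intro x _
    have h1 : HasDerivAt (fun x => -(s * (x + l))) (-(s * 1)) x :=
      (((hasDerivAt_id x).add_const l).const_mul s).neg
    have h2 := (h1.exp.neg).div_const s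
    have h3 : -(Real.exp (-(s * (x + l))) * -(s * 1)) / s = Real.exp (-(s * (x + l))) := by
      field_simp
    rwa [h3] at h2
  have hcont : Continuous fun x => Real.exp (-(s * (x + l))) := by fun_prop
  have hint := intervalIntegral.integral_eq_sub_of_hasDerivAt hd (hcont.intervalIntegrable _ _)
  have h0 : 0 ≤ u - l := sub_nonneg.2 h
  rw [intervalIntegral.integral_of_le h0, ← integral_Ico_eq_integral_Ioc] at hint
  rw [← ofReal_integral_eq_lintegral_ofReal, hint, ← ENNReal.ofReal_mul hs.le,
    ← ENNReal.ofReal_add _ (Real.exp_pos _).le]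
  · congr 1
    field_simp
    simp
  · have : Real.exp (-(s * u)) ≤ Real.exp (-(s * l)) :=
      Real.exp_le_exp.2 (neg_le_neg (mul_le_mul_of_nonneg_left h hs.le))
    have h2 : s * (-Real.exp (-(s * (u - l + l))) / s - -Real.exp (-(s * (0 + l))) / s) =
      Real.exp (-(s * l)) - Real.exp (-(s * u)) := by
      field_simp
      simp
      ring
    rw [h2]
    linarith
  · exact (hcont.integrableOn_Icc (a := 0) (b := u - l)).mono_set Set.Ico_subset_Icc_self
  · exact Filter.Eventually.of_forall fun x => (Real.exp_pos _).le

/-- In the application `l` is the cost of the optimal `r`-matching avoiding the column of an extra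
edge and `u` the cost of the best `(r + 1)`-matching without this edge; `x + l < u` is the condition
for its use. The additive form avoids truncated subtraction. -/
theorem lintegral_halfLine_expCost {s : ℝ} (hs : 0 < s) {l u : ℝ≥0∞} (h : l ≤ u) (hu : u ≠ ⊤) :
    ENNReal.ofReal s * ∫⁻ x, {x | x + l < u}.indicator (fun x => expCost s (x + l)) x ∂halfLine +
      expCost s u = expCost s l := by
  have hl : l ≠ ⊤ := ne_top_of_le_ne_top hu h
  have hm : MeasurableSet {x : ℝ≥0∞ | x + l < u} :=
    measurableSet_lt (by fun_prop) measurable_const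
  have hm' : Measurable fun x => expCost s (x + l) :=
    (measurable_expCost s).comp (measurable_id.add_const l)
  rw [lintegral_halfLine (hm'.indicator hm),
    expCost_of_ne_top s hu, expCost_of_ne_top s hl,
    ← setLIntegral_Ico_exp hs (ENNReal.toReal_mono hu h), ← lintegral_indicator measurableSet_Ici,
    ← lintegral_indicator measurableSet_Ico]
  congr 3
  ext x
  by_cases hx : 0 ≤ x
  · have h1 : ENNReal.ofReal x + l ≠ ⊤ := by simp [hl]
    have h2 : (ENNReal.ofReal x + l).toReal = x + l.toReal := by
      rw [ENNReal.toReal_add (by simp) hl, ENNReal.toReal_ofReal hx]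
    have h3 : ENNReal.ofReal x + l < u ↔ x < u.toReal - l.toReal := by
      rw [← ENNReal.toReal_lt_toReal h1 hu, h2, lt_sub_iff_add_lt]
    by_cases hlt : x < u.toReal - l.toReal
    · simp [hx, hlt, h3.2 hlt, expCost_of_ne_top s h1, h2]
    · have h4 : ¬ ENNReal.ofReal x + l < u := fun h => hlt (h3.1 h)
      rw [Set.indicator_of_mem (Set.mem_Ici.2 hx), Set.indicator_of_notMem (by simpa using h4),
        Set.indicator_of_notMem (fun h => hlt h.2)]
  · simp [hx]

end ExpCost

/-! ### Joining, merging and integrating out extra rows -/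

section Integrals

variable {α β ε : Type*} [DecidableEq α] [DecidableEq β] [DecidableEq ε]
  [Fintype α] [Fintype β] [Fintype ε]

/-- All the extra rows in `S` are covered. -/
def Covers (S : Finset ε) (M : Finset ((α ⊕ ε) × β)) : Prop := ∀ e ∈ S, Sum.inr e ∈ rows M

theorem Covers.mono_rows {S : Finset ε} {M N : Finset ((α ⊕ ε) × β)} (h : Covers S M)
    (hMN : rows M ⊆ rows N) : Covers S N := fun e he => hMN (h e he)

variable {A B : Type*} [DecidableEq A] [DecidableEq B] [Fintype A] [Fintype B] in
theorem measurable_optimum₂ (r r' : ℕ) (T T' : Finset B)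
    (p : Finset (A × B) → Finset (A × B) → Prop) :
    Measurable fun c : A → B → ℝ≥0∞ => p (optimum c r T) (optimum c r' T') := by
  have : (fun c : A → B → ℝ≥0∞ => p (optimum c r T) (optimum c r' T')) = fun c =>
      ∃ M, optimum c r T = M ∧ p M (optimum c r' T') := by
    ext c
    simp
  rw [this]
  exact Measurable.exists fun M => (measurable_optimum r T (· = M)).and
    (measurable_optimum r' T' (p M))

open Classical in
/-- The integrand of `eventIntegral`. -/
noncomputable def eventWeight (s : ℝ) (r : ℕ) (T : Finset β) (b : β)
    (p : Finset ((α ⊕ ε) × β) → Finset ((α ⊕ ε) × β) → Prop) (c : α ⊕ ε → β → ℝ≥0∞) : ℝ≥0∞ :=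
  if p (optimum c r (T.erase b)) (optimum c (r + 1) T) then expCost s (minCost c (r + 1) T) else 0

theorem measurable_eventWeight (s : ℝ) (r : ℕ) (T : Finset β) (b : β)
    (p : Finset ((α ⊕ ε) × β) → Finset ((α ⊕ ε) × β) → Prop) :
    Measurable (eventWeight s r T b p) := by
  unfold eventWeight
  exact Measurable.ite (measurable_optimum₂ _ _ _ _ p).setOf
    ((measurable_expCost s).comp (measurable_minCost _ _)) measurable_const

/-- The integral of `exp (-s C)`, where `C` is the cost of the optimal `(r + 1)`-matching with
columns in `T`, over an event depending on this matching and on the optimal `r`-matching avoiding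
the column `b`. -/
noncomputable def eventIntegral (s : ℝ) (r : ℕ) (T : Finset β) (b : β) (S : Finset ε)
    (p : Finset ((α ⊕ ε) × β) → Finset ((α ⊕ ε) × β) → Prop) : ℝ≥0∞ :=
  ∫⁻ c, eventWeight s r T b p c ∂matrixLaw α β S

open Classical in
variable (α) in
/-- The integral of `exp (-s C)`, where `C` is the cost of the optimal `k`-matching with columns
in `T`, over the event that this matching covers all the extra rows in `S`. -/
noncomputable def coverIntegral (s : ℝ) (k : ℕ) (T : Finset β) (S : Finset ε) : ℝ≥0∞ :=
  ∫⁻ c, (if Covers S (optimum c k T) then expCost s (minCost c k T) else 0) ∂matrixLaw α β S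

theorem coverIntegral_succ (s : ℝ) (r : ℕ) (T : Finset β) (b : β) (S : Finset ε) :
    coverIntegral α s (r + 1) T S =
      eventIntegral (α := α) s r T b S fun _ M => Covers S M := rfl

variable {s : ℝ} {r : ℕ} {T : Finset β} {b : β} {S : Finset ε}

theorem measurable_coverWeight [DecidablePred fun M : Finset ((α ⊕ ε) × β) => Covers S M]
    (s : ℝ) (k : ℕ) (T : Finset β) :
    Measurable fun c : α ⊕ ε → β → ℝ≥0∞ =>
      if Covers S (optimum c k T) then expCost s (minCost c k T) else 0 :=
  Measurable.ite (measurable_optimum k T (Covers S)).setOf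
    ((measurable_expCost s).comp (measurable_minCost _ _)) measurable_const

/-- The optimal matchings for a matrix with the almost sure properties. -/
theorem Good.optima {c : α ⊕ ε → β → ℝ≥0∞} (hc : Good S c) (hr : r + 1 ≤ Fintype.card α)
    (hT : r + 1 ≤ T.card) (b : β) :
    IsOptimal c r (T.erase b) (optimum c r (T.erase b)) ∧
      IsOptimal c (r + 1) T (optimum c (r + 1) T) ∧
      rows (optimum c r (T.erase b)) ⊆ rows (optimum c (r + 1) T) ∧
      (rows (optimum c r (T.erase b))).card = r ∧ (rows (optimum c (r + 1) T)).card = r + 1 := by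
  have h1 := hc.isOptimal_optimum (r := r) (T := T.erase b) (by omega)
    (by have := Finset.pred_card_le_card_erase (s := T) (a := b); omega)
  have h2 := hc.isOptimal_optimum (r := r + 1) (T := T) hr hT
  refine ⟨h1, h2, h1.rows_subset hc.1 h2, ?_, ?_⟩
  · rw [(mem_matchings.1 h1.1).1.card_rows, (mem_matchings.1 h1.1).2.1]
  · rw [(mem_matchings.1 h2.1).1.card_rows, (mem_matchings.1 h2.1).2.1]

theorem insert_eq_of_card {A : Type*} [DecidableEq A] {R R' : Finset A} {a : A} (h : R ⊆ R')
    (hR : R'.card = R.card + 1) (ha : a ∈ R') (ha' : a ∉ R) : R' = insert a R :=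
  (Finset.eq_of_subset_of_card_le (Finset.insert_subset ha h)
    (by rw [hR, Finset.card_insert_of_notMem ha'])).symm

/-- Exactly one row is added in passing from `N` to `M`, so if `M` covers `S` and `N` does not, this
row is the only element of `S` that `N` misses. -/
theorem coverIntegral_eq_add_sum (s : ℝ) (hr : r + 1 ≤ Fintype.card α) (hT : r + 1 ≤ T.card)
    (b : β) (S : Finset ε) :
    coverIntegral α s (r + 1) T S =
      eventIntegral (α := α) s r T b S (fun N _ => Covers S N) +
      ∑ a ∈ S, eventIntegral (α := α) s r T b S fun N M =>
        Covers (S.erase a) N ∧ Sum.inr a ∉ rows N ∧ Sum.inr a ∈ rows M := by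
  rw [coverIntegral_succ s r T b S]
  unfold eventIntegral
  rw [← lintegral_finsetSum _ fun a _ => measurable_eventWeight _ _ _ _ _,
    ← lintegral_add_left (measurable_eventWeight _ _ _ _ _)]
  refine lintegral_congr_ae ?_
  filter_upwards [ae_good S] with c hc
  obtain ⟨-, -, hsub, hN, hM⟩ := hc.optima hr hT b
  unfold eventWeight
  set N := optimum c r (T.erase b)
  set M := optimum c (r + 1) T
  by_cases h1 : Covers S N
  · rw [if_pos h1, if_pos (h1.mono_rows hsub), Finset.sum_eq_zero, add_zero]
    intro a ha
    rw [if_neg]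
    exact fun h => h.2.1 (h1 a ha)
  · rw [if_neg h1, zero_add]
    by_cases h2 : Covers S M
    · rw [if_pos h2]
      unfold Covers at h1
      push Not at h1
      obtain ⟨a, ha, haN⟩ := h1
      have hins := insert_eq_of_card hsub (by rw [hN, hM]) (h2 a ha) haN
      rw [Finset.sum_eq_single_of_mem a ha, if_pos]
      · refine ⟨fun e he => ?_, haN, h2 a ha⟩
        rw [Finset.mem_erase] at he
        have := h2 e he.2
        rw [hins, Finset.mem_insert] at this
        exact this.resolve_left (by simpa using he.1)
      · intro e he hea
        rw [if_neg]
        exact fun h => haN (h.1 a (Finset.mem_erase.2 ⟨hea.symm, ha⟩))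
    · rw [if_neg h2, Finset.sum_eq_zero]
      intro a ha
      rw [if_neg]
      rintro ⟨h3, -, h4⟩
      refine h2 fun e he => ?_
      by_cases hea : e = a
      · exact hea ▸ h4
      · exact hsub (h3 e (Finset.mem_erase.2 ⟨hea, he⟩))

/-- An extra row joining the optimal matching may be merged into any row not covered. -/
theorem eventIntegral_merge (s : ℝ) (hr : r + 1 ≤ Fintype.card α) (hT : r + 1 ≤ T.card) (b : β)
    {a : ε} (ha : a ∉ S) (u : α) :
    eventIntegral (α := α) s r T b (insert a S) (fun N M => Covers S N ∧ Sum.inr a ∉ rows N ∧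
      Sum.inr a ∈ rows M ∧ Sum.inl u ∉ rows M) =
    eventIntegral (α := α) s r T b S (fun N M => Covers S N ∧ Sum.inl u ∉ rows N ∧
      Sum.inl u ∈ rows M) := by
  -- Splitting by the column `d` of the edge at `u`, to be compared with the column of the extra
  -- edge.
  let p : β → Finset ((α ⊕ ε) × β) → Finset ((α ⊕ ε) × β) → Prop :=
    fun d N M => Covers S N ∧ Sum.inl u ∉ rows N ∧ (Sum.inl u, d) ∈ M
  have hsum : eventIntegral (α := α) s r T b S (fun N M => Covers S N ∧ Sum.inl u ∉ rows N ∧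
      Sum.inl u ∈ rows M) = ∑ d, eventIntegral (α := α) s r T b S (p d) := by
    unfold eventIntegral
    rw [← lintegral_finsetSum _ fun a _ => measurable_eventWeight _ _ _ _ _]
    refine lintegral_congr_ae ?_
    filter_upwards [ae_good S] with c hc
    obtain ⟨-, hMo, -⟩ := hc.optima hr hT b
    have hM := (mem_matchings.1 hMo.1).1
    unfold eventWeight
    set N := optimum c r (T.erase b)
    set M := optimum c (r + 1) T
    by_cases h : Covers S N ∧ Sum.inl u ∉ rows N ∧ Sum.inl u ∈ rows M
    · rw [if_pos h]
      obtain ⟨d, hd⟩ := mem_rows.1 h.2.2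
      rw [Finset.sum_eq_single_of_mem d (Finset.mem_univ d), if_pos ⟨h.1, h.2.1, hd⟩]
      intro d' _ hne
      rw [if_neg]
      exact fun h' => hne (Prod.mk.inj (hM.1 _ h'.2.2 _ hd rfl)).2
    · rw [if_neg h, Finset.sum_eq_zero]
      intro d _
      rw [if_neg]
      exact fun h' => h ⟨h'.1, h'.2.1, mem_rows.2 ⟨d, h'.2.2⟩⟩
  have hmeas : ∀ d, Measurable fun q : (α ⊕ ε → β → ℝ≥0∞) × ℝ≥0∞ =>
      (Set.Iio (q.1 (Sum.inl u) d)).indicator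
        (fun x => eventWeight s r T b (p d) (setEntry q.1 (Sum.inl u) d x)) q.2 := by
    intro d
    have : (fun q : (α ⊕ ε → β → ℝ≥0∞) × ℝ≥0∞ =>
        (Set.Iio (q.1 (Sum.inl u) d)).indicator
          (fun x => eventWeight s r T b (p d) (setEntry q.1 (Sum.inl u) d x)) q.2) =
        {q : (α ⊕ ε → β → ℝ≥0∞) × ℝ≥0∞ | q.2 < q.1 (Sum.inl u) d}.indicator
          fun q => eventWeight s r T b (p d) (setEntry q.1 (Sum.inl u) d q.2) := by
      ext q
      simp [Set.indicator]
    rw [this]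
    refine ((measurable_eventWeight _ _ _ _ _).comp (measurable_setEntry _ d)).indicator
      (measurableSet_lt measurable_snd ?_)
    exact (measurable_pi_apply d).comp ((measurable_pi_apply _).comp measurable_fst)
  -- An infinitesimal edge cheaper than the entry `(u, d)` has the law of that entry, so it may
  -- replace it.
  have hres : ∀ d, ∫⁻ c, ∫⁻ x, (Set.Iio (c (Sum.inl u) d)).indicator
      (fun x => eventWeight s r T b (p d) (setEntry c (Sum.inl u) d x)) x ∂halfLine
        ∂matrixLaw α β S = eventIntegral (α := α) s r T b S (p d) := by
    intro d
    unfold eventIntegral matrixLaw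
    rw [lintegral_pi_update (rowLaw S) (rowLaw S) (Sum.inl u) (fun _ _ => rfl)
      (Measurable.lintegral_prod_right' (hmeas d)),
      lintegral_pi_update (rowLaw S) (rowLaw S) (Sum.inl u) (fun _ _ => rfl)
      (measurable_eventWeight _ _ _ _ _)]
    refine lintegral_congr fun c => ?_
    simp only [setEntry, Function.update_self, Function.update_idem]
    exact lintegral_regularRow_halfLine
      (g := fun ρ => eventWeight s r T b (p d) (Function.update c (Sum.inl u) ρ))
      ((measurable_eventWeight _ _ _ _ _).comp (measurable_update c)) d
  rw [hsum]
  simp_rw [← hres]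
  rw [← lintegral_finsetSum _ fun d _ => Measurable.lintegral_prod_right' (hmeas d)]
  unfold eventIntegral
  rw [lintegral_matrixLaw_insert ha (measurable_eventWeight _ _ _ _ _)]
  refine lintegral_congr_ae ?_
  filter_upwards [ae_good S, (ae_matrixLaw_insert ha (measurable_good _).setOf).1
    (ae_good (α := α) (β := β) (insert a S))] with c hc hc1
  refine Finset.sum_congr rfl fun d _ => lintegral_congr_ae ?_
  filter_upwards [hc1 d, ae_halfLine_ne_top] with x hx hxt
  have hau : (Sum.inr a : α ⊕ ε) ≠ Sum.inl u := Sum.inr_ne_inl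
  have hct := hc.2.2 a ha
  have hreg : ∀ i b, setEntry c (Sum.inl u) d x (Sum.inl i) b ≠ ⊤ := by
    intro i b'
    by_cases h : ((Sum.inl i : α ⊕ ε), b') = (Sum.inl u, d)
    · obtain ⟨h1, rfl⟩ := Prod.mk.inj h
      rw [h1, setEntry_self]
      exact hxt
    · rw [setEntry_of_ne h]
      exact hc.2.1 i b'
  have hg2 : Good S (setEntry c (Sum.inl u) d x) :=
    ⟨hx.1.setEntry hau hct, hreg, fun e he => setEntry_top Sum.inr_ne_inl (hc.2.2 e he)⟩
  obtain ⟨hN1, hM1, -⟩ := hx.optima hr hT b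
  obtain ⟨hN2, hM2, -⟩ := hg2.optima hr hT b
  unfold eventWeight
  rw [hM1.minCost_eq]
  set N₁ := optimum (Function.update c (Sum.inr a) (singleRow d x)) r (T.erase b)
  set M₁ := optimum (Function.update c (Sum.inr a) (singleRow d x)) (r + 1) T
  -- Pointwise, `a` joining with `u` uncovered is the same event as `u` joining through a cheaper
  -- edge of cost `x`; the costs agree.
  by_cases h : Covers S N₁ ∧ Sum.inr a ∉ rows N₁ ∧ Sum.inr a ∈ rows M₁ ∧ Sum.inl u ∉ rows M₁
  · obtain ⟨h1, h2, h3, h4, h5⟩ := merge_of_join hx.1 hau hct hM1 hN1 hM2 hN2 h.2.2.1 h.2.1 h.2.2.2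
    rw [if_pos h, Set.indicator_of_mem (Set.mem_Iio.2 h1), if_pos ⟨h4 ▸ h.1, h3, h2⟩,
      hM2.minCost_eq, h5]
  · rw [if_neg h]
    symm
    rw [Set.indicator_apply_eq_zero]
    intro h1
    rw [if_neg]
    rintro ⟨h2, h3, h4⟩
    obtain ⟨h5, h6, h7⟩ := join_of_merge hx.1 hau hct hM1 hN1 hM2 hN2 h1 h4 h3
    obtain ⟨-, -, -, h8, -⟩ := merge_of_join hx.1 hau hct hM1 hN1 hM2 hN2 h5 h6 h7
    exact h ⟨h8 ▸ h2, h6, h5, h7⟩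

/-- When `a` joins, `M` covers all `|S| + 1` extra rows and `r - |S|` regular ones, leaving `card α
+ |S| - r` regular rows into which `a` can be merged. After merging, the sum over `u` counts the
joining row once: it is unique, and regular because `N` already covers `S`. -/
theorem card_mul_eventIntegral (s : ℝ) (hr : r + 1 ≤ Fintype.card α) (hT : r + 1 ≤ T.card) (b : β)
    {a : ε} (ha : a ∉ S) :
    ((Fintype.card α + S.card - r : ℕ) : ℝ≥0∞) *
      eventIntegral (α := α) s r T b (insert a S)
        (fun N M => Covers S N ∧ Sum.inr a ∉ rows N ∧ Sum.inr a ∈ rows M) =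
    eventIntegral (α := α) s r T b S fun N _ => Covers S N := by
  have h1 : ((Fintype.card α + S.card - r : ℕ) : ℝ≥0∞) *
      eventIntegral (α := α) s r T b (insert a S)
        (fun N M => Covers S N ∧ Sum.inr a ∉ rows N ∧ Sum.inr a ∈ rows M) =
      ∑ u, eventIntegral (α := α) s r T b (insert a S) (fun N M => Covers S N ∧
        Sum.inr a ∉ rows N ∧ Sum.inr a ∈ rows M ∧ Sum.inl u ∉ rows M) := by
    unfold eventIntegral
    rw [← lintegral_finsetSum _ fun a _ => measurable_eventWeight _ _ _ _ _,
      ← lintegral_const_mul _ (measurable_eventWeight _ _ _ _ _)]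
    refine lintegral_congr_ae ?_
    filter_upwards [ae_good (insert a S)] with c hc
    obtain ⟨-, hMo, hsub, hN, hM⟩ := hc.optima hr hT b
    unfold eventWeight
    set N := optimum c r (T.erase b)
    set M := optimum c (r + 1) T
    by_cases h : Covers S N ∧ Sum.inr a ∉ rows N ∧ Sum.inr a ∈ rows M
    · rw [if_pos h]
      have hR : (rows M).toRight = insert a S := by
        ext e
        rw [Finset.mem_toRight]
        constructor
        · intro he
          by_contra hne
          exact notMem_rows_of_top hMo.2.1 (hc.2.2 e hne) he
        · intro he
          rcases Finset.mem_insert.1 he with rfl | he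
          · exact h.2.2
          · exact hsub (h.1 e he)
      have hL : (rows M).toLeft.card + (S.card + 1) = r + 1 := by
        rw [← hM, ← Finset.card_toLeft_add_card_toRight, hR, Finset.card_insert_of_notMem ha]
      have hcount : (Finset.univ.filter fun u : α => Sum.inl u ∉ rows M).card =
          Fintype.card α + S.card - r := by
        have : (Finset.univ.filter fun u : α => Sum.inl u ∉ rows M) = (rows M).toLeftᶜ := by
          ext u
          simp
        rw [this, Finset.card_compl]
        omega
      simp only [h, not_false_eq_true, true_and]
      rw [← Finset.sum_filter, Finset.sum_const, hcount, nsmul_eq_mul]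
    · rw [if_neg h, mul_zero, Finset.sum_eq_zero]
      intro u _
      rw [if_neg]
      exact fun h' => h ⟨h'.1, h'.2.1, h'.2.2.1⟩
  rw [h1]
  simp_rw [eventIntegral_merge s hr hT b ha]
  unfold eventIntegral
  rw [← lintegral_finsetSum _ fun a _ => measurable_eventWeight _ _ _ _ _]
  refine lintegral_congr_ae ?_
  filter_upwards [ae_good S] with c hc
  obtain ⟨-, hMo, hsub, hN, hM⟩ := hc.optima hr hT b
  unfold eventWeight
  set N := optimum c r (T.erase b)
  set M := optimum c (r + 1) T
  by_cases h : Covers S N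
  · obtain ⟨x, hxM, hxN⟩ := Finset.exists_mem_notMem_of_card_lt_card
      (by omega : (rows N).card < (rows M).card)
    have hins := insert_eq_of_card hsub (by rw [hN, hM]) hxM hxN
    rcases x with u | e
    · rw [if_pos h, Finset.sum_eq_single_of_mem u (Finset.mem_univ u), if_pos ⟨h, hxN, hxM⟩]
      intro v _ hvu
      rw [if_neg]
      rintro ⟨-, h1, h2⟩
      rw [hins, Finset.mem_insert] at h2
      exact h2.elim (fun h => hvu (Sum.inl_injective h)) h1
    · exfalso
      by_cases he : e ∈ S
      · exact hxN (h e he)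
      · exact notMem_rows_of_top hMo.2.1 (hc.2.2 e he) hxM
  · rw [if_neg h, Finset.sum_eq_zero]
    intro u _
    rw [if_neg]
    exact fun h' => h h'.1

/-- The extra row `a` joining the optimal matching, in terms of the matrix without this row. -/
theorem mul_coverIntegral_insert {s : ℝ} (hs : 0 < s) (hr : r + 1 ≤ Fintype.card α)
    (hT : r + 1 ≤ T.card) {a : ε} (ha : a ∉ S) :
    ∑ b ∈ T, eventIntegral (α := α) s r T b S (fun N _ => Covers S N) +
      ENNReal.ofReal s * coverIntegral α s (r + 1) T (insert a S) =
    ∑ b ∈ T, coverIntegral α s r (T.erase b) S := by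
  classical
  let φ : β → (α ⊕ ε → β → ℝ≥0∞) → ℝ≥0∞ := fun b c =>
    if Covers S (optimum c r (T.erase b)) then expCost s (minCost c r (T.erase b)) else 0
  have h1 : ENNReal.ofReal s * coverIntegral α s (r + 1) T (insert a S) =
      ∫⁻ c, ∑ b ∈ T, (φ b c - eventWeight s r T b (fun N _ => Covers S N) c)
        ∂matrixLaw α β S := by
    unfold coverIntegral
    rw [lintegral_matrixLaw_insert ha (measurable_coverWeight _ _ _), ← lintegral_const_mul']
    swap
    · exact ENNReal.ofReal_ne_top
    refine lintegral_congr_ae ?_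
    filter_upwards [ae_good S, (ae_matrixLaw_insert ha (measurable_good _).setOf).1
      (ae_good (α := α) (β := β) (insert a S))] with c hc hc1
    rw [← Finset.sum_subset (Finset.subset_univ T), Finset.mul_sum]
    · refine Finset.sum_congr rfl fun b hb => ?_
      obtain ⟨hNo, hMo, -⟩ := hc.optima hr hT b
      have hle := minCost_erase_le c r T b
      have hMt : minCost c (r + 1) T ≠ ⊤ := by
        rw [hMo.minCost_eq]
        exact hMo.2.1
      have hNt := ne_top_of_le_ne_top hMt hle
      have h2 : ∀ᵐ x ∂halfLine, x + minCost c r (T.erase b) ≠ minCost c (r + 1) T := by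
        rw [ae_iff]
        simp only [ne_eq, not_not]
        refine Set.Subsingleton.measure_zero ?_ _
        intro x hx y hy
        have hxy : x + minCost c r (T.erase b) = y + minCost c r (T.erase b) :=
          Eq.trans hx (Eq.symm hy)
        exact (ENNReal.add_left_inj hNt).1 hxy
      -- The optimum uses the new edge exactly when `x` is below the threshold, and its other rows
      -- are then those of the optimal `r`-matching avoiding `b`.
      have h3 : ∫⁻ x, (if Covers (insert a S)
            (optimum (Function.update c (Sum.inr a) (singleRow b x)) (r + 1) T) then
            expCost s (minCost (Function.update c (Sum.inr a) (singleRow b x)) (r + 1) T) else 0)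
            ∂halfLine =
          if Covers S (optimum c r (T.erase b)) then
            ∫⁻ x, {x | x + minCost c r (T.erase b) < minCost c (r + 1) T}.indicator
              (fun x => expCost s (x + minCost c r (T.erase b))) x ∂halfLine else 0 := by
        have h4 : ∀ᵐ x ∂halfLine, (if Covers (insert a S)
            (optimum (Function.update c (Sum.inr a) (singleRow b x)) (r + 1) T) then
            expCost s (minCost (Function.update c (Sum.inr a) (singleRow b x)) (r + 1) T) else 0) =
            if Covers S (optimum c r (T.erase b)) then
              {x | x + minCost c r (T.erase b) < minCost c (r + 1) T}.indicator
              (fun x => expCost s (x + minCost c r (T.erase b))) x else 0 := by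
          filter_upwards [h2, hc1 b] with x hx hx1
          obtain ⟨-, hM1, -⟩ := hx1.optima hr hT b
          rcases lt_or_gt_of_ne hx with hlt | hgt
          · have hlt' := hlt
            rw [hNo.minCost_eq] at hlt
            obtain ⟨h5, h6⟩ := hM1.mem_rows_of_lt hc.1 (hc.2.2 a ha) hNo hb hlt
            rw [hM1.minCost_eq, h6, Set.indicator_of_mem (by exact hlt'), hNo.minCost_eq]
            refine if_congr ?_ rfl rfl
            unfold Covers
            rw [h5]
            constructor
            · intro h e he
              have := h e (Finset.mem_insert_of_mem he)
              rw [Finset.mem_insert] at this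
              exact this.resolve_left fun h => ha (Sum.inr_injective h ▸ he)
            · intro h e he
              rcases Finset.mem_insert.1 he with rfl | he
              · exact Finset.mem_insert_self _ _
              · exact Finset.mem_insert_of_mem (h e he)
          · have h5 := hM1.notMem_rows_of_lt (hc.2.2 a ha) hgt
            rw [if_neg fun h => h5 (h a (Finset.mem_insert_self a S)),
              Set.indicator_of_notMem (by exact hgt.not_gt), ite_self]
        rw [lintegral_congr_ae h4]
        split_ifs
        · rfl
        · simp
      rw [h3]
      unfold eventWeight
      by_cases hcov : Covers S (optimum c r (T.erase b))
      · simp only [φ, hcov, if_true]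
        rw [← lintegral_halfLine_expCost hs hle hMt, ENNReal.add_sub_cancel_right]
        exact ((expCost_le_one hs.le _).trans_lt ENNReal.one_lt_top).ne
      · simp [φ, hcov]
    · intro b _ hb
      rw [lintegral_eq_zero_of_ae_eq_zero]
      filter_upwards [hc1 b] with x hx1
      obtain ⟨-, hM1, -⟩ := hx1.optima hr hT b
      exact if_neg fun h => hM1.notMem_rows_of_notMem hb (h a (Finset.mem_insert_self a S))
  rw [h1]
  unfold eventIntegral coverIntegral
  rw [← lintegral_finsetSum _ fun b _ => measurable_eventWeight _ _ _ _ _,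
    ← lintegral_finsetSum _ fun b _ => measurable_coverWeight s r (T.erase b),
    ← lintegral_add_left (Finset.measurable_sum _ fun b _ => measurable_eventWeight _ _ _ _ _)]
  refine lintegral_congr fun c => ?_
  rw [← Finset.sum_add_distrib]
  refine Finset.sum_congr rfl fun b _ => ?_
  -- The subtraction is not truncated: the `(r + 1)`-matching is at least as costly, so its weight
  -- is smaller.
  refine add_tsub_cancel_of_le ?_
  unfold eventWeight
  by_cases hcov : Covers S (optimum c r (T.erase b))
  · simp only [φ, hcov, if_true]
    by_cases hMt : minCost c (r + 1) T = ⊤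
    · simp [expCost, hMt]
    · rw [← lintegral_halfLine_expCost hs (minCost_erase_le c r T b) hMt]
      exact le_add_self
  · simp [φ, hcov]

end Integrals

/-! ### The recursion and the upper bound -/

section Recursion

variable {α β ε : Type*} [DecidableEq α] [DecidableEq β] [DecidableEq ε]
  [Fintype α] [Fintype β] [Fintype ε] {s : ℝ} {r : ℕ} {T : Finset β} {b : β} {S : Finset ε}

instance : IsProbabilityMeasure (matrixLaw α β (∅ : Finset ε)) := by
  have (a : α ⊕ ε) : IsProbabilityMeasure (rowLaw (β := β) (∅ : Finset ε) a) := by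
    rcases a with i | e
    · infer_instance
    · rw [rowLaw_inr_of_notMem (by simp)]
      infer_instance
  unfold matrixLaw
  infer_instance

theorem matchings_zero {A B : Type*} [DecidableEq A] [DecidableEq B] [Fintype A] [Fintype B]
    (T : Finset B) : matchings A 0 T = {∅} := by
  ext M
  rw [mem_matchings, Finset.mem_singleton]
  constructor
  · exact fun h => Finset.card_eq_zero.1 h.2.1
  · rintro rfl
    simp [IsMatching, cols]

theorem coverIntegral_zero_empty (s : ℝ) (T : Finset β) :
    coverIntegral α s 0 T (∅ : Finset ε) = 1 := by
  have h : ∀ c : α ⊕ ε → β → ℝ≥0∞, minCost c 0 T = 0 := fun c => by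
    simp [minCost, matchings_zero, cost]
  unfold coverIntegral
  simp [h, Covers, expCost_of_ne_top]

theorem card_rows_optimum_le {A B : Type*} [DecidableEq A] [DecidableEq B] [Fintype A] [Fintype B]
    (c : A → B → ℝ≥0∞) (k : ℕ) (T : Finset B) : (rows (optimum c k T)).card ≤ k := by
  by_cases h : ∃ M, IsOptimal c k T M
  · have := mem_matchings.1 (isOptimal_optimum h).1
    rw [this.1.card_rows, this.2.1]
  · rw [optimum, dif_neg h]
    simp [rows]

/-- A `k`-matching covers only `k` rows. This starts the descending induction on `S.card`. -/
theorem coverIntegral_of_lt_card (s : ℝ) {k : ℕ} (T : Finset β) (hS : k < S.card) :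
    coverIntegral α s k T S = 0 := by
  unfold coverIntegral
  rw [lintegral_eq_zero_of_ae_eq_zero]
  refine Filter.Eventually.of_forall fun c => if_neg fun h => ?_
  have h1 : S.map Function.Embedding.inr ⊆ rows (optimum c k T) := by
    intro x hx
    obtain ⟨e, he, rfl⟩ := Finset.mem_map.1 hx
    exact h e he
  have h2 := (Finset.card_le_card h1).trans (card_rows_optimum_le c k T)
  rw [Finset.card_map] at h2
  omega

theorem coverIntegral_empty_le_one (hs : 0 ≤ s) (k : ℕ) (T : Finset β) :
    coverIntegral α s k T (∅ : Finset ε) ≤ 1 := by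
  unfold coverIntegral
  calc _ ≤ ∫⁻ _, 1 ∂matrixLaw α β (∅ : Finset ε) := by
        refine lintegral_mono fun c => ?_
        split_ifs
        · exact expCost_le_one hs _
        · exact zero_le_one
    _ = 1 := by simp

/-- The law with extra rows has infinite mass, so finiteness is not automatic;
`mul_coverIntegral_insert` bounds `s` times the integral by integrals for smaller matchings and one
extra row fewer. -/
theorem coverIntegral_ne_top (hs : 0 < s) : ∀ (k : ℕ) (T : Finset β) (S : Finset ε),
    k ≤ Fintype.card α → k ≤ T.card → coverIntegral α s k T S ≠ ⊤ := by
  intro k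
  induction k with
  | zero =>
    intro T S _ _
    rcases S.eq_empty_or_nonempty with rfl | hS
    · simp [coverIntegral_zero_empty]
    · rw [coverIntegral_of_lt_card s T hS.card_pos]
      simp
  | succ r ih =>
    intro T S hr hT
    rcases S.eq_empty_or_nonempty with rfl | ⟨a, ha⟩
    · exact ((coverIntegral_empty_le_one hs.le _ _).trans_lt ENNReal.one_lt_top).ne
    · have h := mul_coverIntegral_insert (α := α) hs hr hT (Finset.notMem_erase a S)
      rw [Finset.insert_erase ha] at h
      have h1 : ∑ b ∈ T, coverIntegral α s r (T.erase b) (S.erase a) ≠ ⊤ := by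
        refine ENNReal.sum_ne_top.2 fun b _ => ih _ _ (by omega) ?_
        have := Finset.pred_card_le_card_erase (s := T) (a := b)
        omega
      rw [← h] at h1
      intro h2
      rw [h2, ENNReal.mul_top (by simpa using hs), add_top] at h1
      exact h1 rfl

theorem eventIntegral_le_coverIntegral (hr : r + 1 ≤ Fintype.card α) (hT : r + 1 ≤ T.card)
    (b : β) : eventIntegral (α := α) s r T b S (fun N _ => Covers S N) ≤
      coverIntegral α s (r + 1) T S := by
  rw [coverIntegral_eq_add_sum s hr hT b S]
  exact le_self_add

theorem card_erase_ge (hT : r + 1 ≤ T.card) (b : β) : r ≤ (T.erase b).card := by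
  have := Finset.pred_card_le_card_erase (s := T) (a := b)
  omega

theorem sum_toReal_eventIntegral (hs : 0 < s) (hr : r + 1 ≤ Fintype.card α) (hT : r + 1 ≤ T.card)
    {a : ε} (ha : a ∉ S) :
    ∑ b ∈ T, (eventIntegral (α := α) s r T b S (fun N _ => Covers S N)).toReal =
      ∑ b ∈ T, (coverIntegral α s r (T.erase b) S).toReal -
        s * (coverIntegral α s (r + 1) T (insert a S)).toReal := by
  have h := congrArg ENNReal.toReal (mul_coverIntegral_insert (α := α) hs hr hT ha)
  have hH (b : β) : eventIntegral (α := α) s r T b S (fun N _ => Covers S N) ≠ ⊤ :=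
    ne_top_of_le_ne_top (coverIntegral_ne_top hs _ T S hr hT)
      (eventIntegral_le_coverIntegral hr hT b)
  have hK (S : Finset ε) := coverIntegral_ne_top (α := α) hs (r + 1) T S hr hT
  rw [ENNReal.toReal_add (ENNReal.sum_ne_top.2 fun b _ => hH b)
    (ENNReal.mul_ne_top ENNReal.ofReal_ne_top (hK _)), ENNReal.toReal_sum fun b _ => hH b,
    ENNReal.toReal_mul, ENNReal.toReal_ofReal hs.le,
    ENNReal.toReal_sum fun b _ => coverIntegral_ne_top hs _ _ _ (by omega) (card_erase_ge hT b)]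
    at h
  linarith

theorem toReal_coverIntegral_eq (hs : 0 < s) (hr : r + 1 ≤ Fintype.card α) (hT : r + 1 ≤ T.card)
    (b : β) (S : Finset ε) :
    (coverIntegral α s (r + 1) T S).toReal =
      (eventIntegral (α := α) s r T b S (fun N _ => Covers S N)).toReal +
      ((Fintype.card α : ℝ) + S.card - (r + 1))⁻¹ * ∑ a ∈ S,
        (eventIntegral (α := α) s r T b (S.erase a) (fun N _ => Covers (S.erase a) N)).toReal := by
  have h := coverIntegral_eq_add_sum (α := α) s hr hT b S
  have hK := coverIntegral_ne_top (α := α) hs (r + 1) T S hr hT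
  have hH : eventIntegral (α := α) s r T b S (fun N _ => Covers S N) ≠ ⊤ :=
    ne_top_of_le_ne_top hK (eventIntegral_le_coverIntegral hr hT b)
  have hJ : ∑ a ∈ S, eventIntegral (α := α) s r T b S (fun N M =>
        Covers (S.erase a) N ∧ Sum.inr a ∉ rows N ∧ Sum.inr a ∈ rows M) ≠ ⊤ :=
    ne_top_of_le_ne_top hK (h ▸ le_add_self)
  rw [h, ENNReal.toReal_add hH hJ, ENNReal.toReal_sum (ENNReal.sum_ne_top.1 hJ), Finset.mul_sum]
  congr 1
  refine Finset.sum_congr rfl fun a ha => ?_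
  have h1 := congrArg ENNReal.toReal
    (card_mul_eventIntegral (α := α) s hr hT b (Finset.notMem_erase a S))
  have hpos : 0 < S.card := Finset.card_pos.2 ⟨a, ha⟩
  rw [Finset.insert_erase ha, ENNReal.toReal_mul, ENNReal.toReal_natCast,
    Finset.card_erase_of_mem ha, Nat.cast_sub (by omega), Nat.cast_add, Nat.cast_sub hpos] at h1
  -- This uses that `S` is nonempty; for `S = ∅` the number may vanish, but the sum is then empty.
  have hne : (Fintype.card α : ℝ) + S.card - (r + 1) ≠ 0 := by
    have h2 : ((r + 1 : ℕ) : ℝ) ≤ Fintype.card α := Nat.cast_le.2 hr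
    have h3 : (0 : ℝ) < S.card := Nat.cast_pos.2 hpos
    push_cast at h2
    intro h
    linarith
  rw [← h1, eq_inv_mul_iff_mul_eq₀ hne]
  push_cast
  ring

/-- The recursion for the integrals `coverIntegral`. -/
theorem coverIntegral_recursion (hs : 0 < s) (hr : r + 1 ≤ Fintype.card α) (hT : r + 1 ≤ T.card)
    {a : ε} (ha : a ∉ S) :
    (coverIntegral α s (r + 1) T S).toReal *
      (T.card + s * (S.card * ((Fintype.card α : ℝ) + S.card - (r + 1))⁻¹)) =
    ∑ b ∈ T, (coverIntegral α s r (T.erase b) S).toReal -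
      s * (coverIntegral α s (r + 1) T (insert a S)).toReal +
      ((Fintype.card α : ℝ) + S.card - (r + 1))⁻¹ *
        ∑ a ∈ S, ∑ b ∈ T, (coverIntegral α s r (T.erase b) (S.erase a)).toReal := by
  have h1 : (T.card : ℝ) * (coverIntegral α s (r + 1) T S).toReal =
      ∑ b ∈ T, (eventIntegral (α := α) s r T b S (fun N _ => Covers S N)).toReal +
      ((Fintype.card α : ℝ) + S.card - (r + 1))⁻¹ * ∑ a ∈ S, ∑ b ∈ T,
        (eventIntegral (α := α) s r T b (S.erase a) (fun N _ => Covers (S.erase a) N)).toReal := by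
    rw [← nsmul_eq_mul, ← Finset.sum_const, Finset.sum_comm, Finset.mul_sum,
      ← Finset.sum_add_distrib]
    exact Finset.sum_congr rfl fun b _ => toReal_coverIntegral_eq hs hr hT b S
  -- Putting `a` back into `S.erase a` reproduces the integral for `S`; this is the source of the
  -- term with `s` in the factor on the left.
  have h2 : ∑ a ∈ S, ∑ b ∈ T, (eventIntegral (α := α) s r T b (S.erase a)
      (fun N _ => Covers (S.erase a) N)).toReal =
      ∑ a ∈ S, ∑ b ∈ T, (coverIntegral α s r (T.erase b) (S.erase a)).toReal -
        S.card * (s * (coverIntegral α s (r + 1) T S).toReal) := by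
    rw [← nsmul_eq_mul, ← Finset.sum_const, ← Finset.sum_sub_distrib]
    refine Finset.sum_congr rfl fun a ha => ?_
    rw [sum_toReal_eventIntegral hs hr hT (Finset.notMem_erase a S), Finset.insert_erase ha]
  rw [h2, sum_toReal_eventIntegral hs hr hT ha] at h1
  linear_combination h1

/-- The right side splits into the contribution of `a` joining, which equals the left side, and that
of `a` being covered already, which is dropped. -/
theorem coverIntegral_singleton_ge (hs : 0 < s) (hr : r + 1 ≤ Fintype.card α)
    (hT : r + 1 ≤ T.card) (a : ε) :
    ((Fintype.card α : ℝ) - r)⁻¹ * (coverIntegral α s (r + 1) T (∅ : Finset ε)).toReal ≤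
      (coverIntegral α s (r + 1) T {a}).toReal := by
  obtain ⟨b, -⟩ : T.Nonempty := Finset.card_pos.1 (by omega)
  have h1 := toReal_coverIntegral_eq (α := α) hs hr hT b ({a} : Finset ε)
  have h2 := toReal_coverIntegral_eq (α := α) hs hr hT b (∅ : Finset ε)
  simp only [Finset.sum_singleton, Finset.card_singleton, Finset.erase_singleton,
    Finset.sum_empty, mul_zero, add_zero, Nat.cast_one] at h1 h2
  rw [h1, h2, show (Fintype.card α : ℝ) + 1 - (r + 1) = Fintype.card α - r by ring]
  exact le_add_of_nonneg_left ENNReal.toReal_nonneg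

/-- At `S = ∅` the recursion and `coverIntegral_singleton_ge` show that each step gains a factor `1
+ s / (|T| (card α - r))`, which is at least `1 + s / (card α * ν)`. The bound `ν` stays fixed while
columns are deleted. -/
theorem toReal_coverIntegral_le (hs : 0 < s) [Nonempty ε] {ν : ℕ} :
    ∀ (k : ℕ) (T : Finset β), k ≤ Fintype.card α → k ≤ T.card → T.card ≤ ν →
    (coverIntegral α s k T (∅ : Finset ε)).toReal ≤
      1 / (1 + s / ((Fintype.card α : ℝ) * ν)) ^ k := by
  intro k
  induction k with
  | zero =>
    intro T _ _ _
    simp [coverIntegral_zero_empty]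
  | succ r ih =>
    intro T hr hT hν
    obtain ⟨a⟩ := ‹Nonempty ε›
    have h1 := coverIntegral_recursion (α := α) hs hr hT (Finset.notMem_empty a)
    have h2 := coverIntegral_singleton_ge (α := α) hs hr hT a
    simp only [Finset.card_empty, Nat.cast_zero, zero_mul, mul_zero, add_zero, Finset.sum_empty,
      insert_empty_eq] at h1
    have hN : ((r + 1 : ℕ) : ℝ) ≤ Fintype.card α := Nat.cast_le.2 hr
    have hTr : ((r + 1 : ℕ) : ℝ) ≤ T.card := Nat.cast_le.2 hT
    have hνr : (T.card : ℝ) ≤ ν := Nat.cast_le.2 hν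
    have hr0 : (0 : ℝ) ≤ r := Nat.cast_nonneg r
    push_cast at hN hTr
    set N : ℝ := (Fintype.card α : ℝ)
    set F := (coverIntegral α s (r + 1) T (∅ : Finset ε)).toReal
    have hF : 0 ≤ F := ENNReal.toReal_nonneg
    set q := 1 + s / (N * ν)
    have hNpos : 0 < N := by linarith
    have hTpos : (0 : ℝ) < T.card := by linarith
    have hνpos : (0 : ℝ) < ν := by linarith
    have hq : 0 < q := by positivity
    have h3 : ∑ b ∈ T, (coverIntegral α s r (T.erase b) (∅ : Finset ε)).toReal ≤
        T.card * (1 / q ^ r) := by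
      rw [← nsmul_eq_mul]
      refine Finset.sum_le_card_nsmul _ _ _ fun b _ => ih _ (by omega) (card_erase_ge hT b) ?_
      exact (Finset.card_le_card (Finset.erase_subset _ _)).trans hν
    have h4 : F * T.card + s * ((N - r)⁻¹ * F) ≤ T.card * (1 / q ^ r) := by
      have := mul_le_mul_of_nonneg_left h2 hs.le
      linarith
    have h5 : q * T.card ≤ T.card + s * (N - r)⁻¹ := by
      have h6 : s / (N * ν) * T.card ≤ s * (N - r)⁻¹ := by
        have h7 : (0 : ℝ) < N - r := by linarith
        rw [div_mul_eq_mul_div, ← div_eq_mul_inv, div_le_div_iff₀ (by positivity) h7]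
        have : (T.card : ℝ) * (N - r) ≤ ν * N :=
          mul_le_mul hνr (by linarith) h7.le hνpos.le
        nlinarith
      simp only [q]
      linarith
    have h8 : F * q ≤ 1 / q ^ r := by
      have h9 := mul_le_mul_of_nonneg_left h5 hF
      have h10 : (T.card : ℝ) * (F * q) ≤ T.card * (1 / q ^ r) := by linarith
      exact le_of_mul_le_mul_left h10 hTpos
    rw [le_div_iff₀ (by positivity)] at h8
    rw [le_div_iff₀ (by positivity), pow_succ]
    linarith

end Recursion

/-! ### Rationality with the expected denominator -/

section Rational

open Polynomial

/-- The function agrees on the positive half-line with a polynomial in `-s`. -/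
def IsPoly (g : ℝ → ℝ) : Prop := ∃ p : ℝ[X], ∀ s, 0 < s → g s = p.eval (-s)

namespace IsPoly

theorem eval (p : ℝ[X]) : IsPoly fun s => p.eval (-s) := ⟨p, fun _ _ => rfl⟩

theorem const (c : ℝ) : IsPoly fun _ => c := ⟨C c, by simp⟩

theorem neg_id : IsPoly fun s => -s := ⟨X, by simp⟩

theorem add {g h : ℝ → ℝ} (hg : IsPoly g) (hh : IsPoly h) : IsPoly fun s => g s + h s := by
  obtain ⟨p, hp⟩ := hg
  obtain ⟨q, hq⟩ := hh
  exact ⟨p + q, fun s hs => by simp [hp s hs, hq s hs]⟩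

theorem mul {g h : ℝ → ℝ} (hg : IsPoly g) (hh : IsPoly h) : IsPoly fun s => g s * h s := by
  obtain ⟨p, hp⟩ := hg
  obtain ⟨q, hq⟩ := hh
  exact ⟨p * q, fun s hs => by simp [hp s hs, hq s hs]⟩

theorem sum {ι : Type*} (I : Finset ι) {g : ι → ℝ → ℝ} (hg : ∀ i ∈ I, IsPoly (g i)) :
    IsPoly fun s => ∑ i ∈ I, g i s := by
  classical
  induction I using Finset.induction_on with
  | empty => simpa using const 0
  | insert i I hi ih =>
    simp only [Finset.sum_insert hi]
    exact (hg i (by simp)).add (ih fun j hj => hg j (Finset.mem_insert_of_mem hj))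

theorem congr {g h : ℝ → ℝ} (hg : IsPoly g) (hh : ∀ s, 0 < s → h s = g s) : IsPoly h := by
  obtain ⟨p, hp⟩ := hg
  exact ⟨p, fun s hs => by rw [hh s hs, hp s hs]⟩

end IsPoly

/-- The factors of `matchingDenominator (r + 1) m n` with second index `0`. -/
noncomputable def boundaryFactor (r m n f : ℕ) : ℝ[X] :=
  1 - C ((f : ℝ) / (((m : ℝ) + f - (r + 1)) * n)) * X

theorem matchingDenominator_zero (m n : ℕ) : matchingDenominator 0 m n = 1 := by
  simp [matchingDenominator]

theorem matchingDenominator_succ (r m : ℕ) {n : ℕ} (hn : 1 ≤ n) :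
    matchingDenominator (r + 1) m n =
      (∏ f ∈ Finset.range (r + 2), boundaryFactor r m n f) * matchingDenominator r m (n - 1) := by
  unfold matchingDenominator
  rw [Finset.prod_filter, Finset.prod_filter, Finset.prod_product_right, Finset.prod_product_right,
    Finset.prod_range_succ', mul_comm]
  congr 1
  -- The factor with `f = 0` is `1`; the others correspond to the first index `i = r + 1 - f`.
  · rw [Finset.prod_range_succ' _ (r + 1)]
    simp only [boundaryFactor, Nat.cast_zero, zero_div, map_zero, zero_mul, sub_zero, mul_one]
    rw [← Finset.prod_range_reflect]
    refine Finset.prod_congr rfl fun i hi => ?_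
    rw [Finset.mem_range] at hi
    rw [if_pos (by omega)]
    have : ((r + 1 - 1 - i : ℕ) : ℝ) = r - i := by
      rw [Nat.add_sub_cancel, Nat.cast_sub (by omega)]
    rw [this]
    push_cast
    congr 4 <;> ring
  · refine Finset.prod_congr rfl fun j hj => ?_
    rw [Finset.prod_range_succ, if_neg (by omega), mul_one]
    refine Finset.prod_congr rfl fun i hi => ?_
    refine if_congr (by omega) ?_ rfl
    rw [Nat.cast_sub hn]
    push_cast
    congr 4 <;> ring

variable {α β ε : Type*} [DecidableEq α] [DecidableEq β] [DecidableEq ε]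
  [Fintype α] [Fintype β] [Fintype ε]

/-- The integrals `coverIntegral` are rational functions with the expected denominator. -/
theorem isPoly_coverIntegral : ∀ (k : ℕ) (T : Finset β) (S : Finset ε),
    k ≤ Fintype.card α → k ≤ T.card → k < Fintype.card ε →
    IsPoly fun s => (coverIntegral α s k T S).toReal *
      (matchingDenominator k (Fintype.card α) T.card).eval (-s) := by
  intro k
  induction k with
  | zero =>
    intro T S _ _ _
    rcases S.eq_empty_or_nonempty with rfl | hS
    · simpa [matchingDenominator_zero, coverIntegral_zero_empty] using IsPoly.const 1
    · simpa [coverIntegral_of_lt_card _ T hS.card_pos] using IsPoly.const 0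
  | succ r ih =>
    intro T S hr hT hε
    set D := matchingDenominator r (Fintype.card α) (T.card - 1)
    have hih : ∀ b ∈ T, ∀ S : Finset ε,
        IsPoly fun s => (coverIntegral α s r (T.erase b) S).toReal * D.eval (-s) := by
      intro b hb S
      have := ih (T.erase b) S (by omega) (card_erase_ge hT b) (by omega)
      rwa [Finset.card_erase_of_mem hb] at this
    have hT0 : (0 : ℝ) < T.card := Nat.cast_pos.2 (by omega)
    -- Descending induction on `S.card`: `d` bounds the distance to `r + 2`, where the integral
    -- vanishes. Each step contributes the factor with `f = S.card`, and `hε` guarantees a row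
    -- outside `S`.
    have key : ∀ (d : ℕ) (S : Finset ε), r + 2 ≤ S.card + d →
        IsPoly fun s => (coverIntegral α s (r + 1) T S).toReal *
          ((∏ f ∈ Finset.Ico S.card (r + 2), boundaryFactor r (Fintype.card α) T.card f) *
            D).eval (-s) := by
      intro d
      induction d with
      | zero =>
        intro S hS
        simpa [coverIntegral_of_lt_card _ T (show r + 1 < S.card by omega)] using IsPoly.const 0
      | succ d ihd =>
        intro S hS
        by_cases hlt : r + 2 ≤ S.card
        · simpa [coverIntegral_of_lt_card _ T (show r + 1 < S.card by omega)] using IsPoly.const 0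
        obtain ⟨a, ha⟩ : ∃ a, a ∉ S := by
          by_contra! h
          have : S = Finset.univ := Finset.eq_univ_iff_forall.2 h
          rw [this, Finset.card_univ] at hlt
          omega
        have h1 := ihd (insert a S) (by rw [Finset.card_insert_of_notMem ha]; omega)
        rw [Finset.card_insert_of_notMem ha] at h1
        set E := ∏ f ∈ Finset.Ico (S.card + 1) (r + 2),
          boundaryFactor r (Fintype.card α) T.card f
        rw [Finset.prod_eq_prod_Ico_succ_bot (by omega)]
        set κ : ℝ := ((Fintype.card α : ℝ) + S.card - (r + 1))⁻¹
        have h2 : IsPoly fun s => (∑ b ∈ T,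
            (coverIntegral α s r (T.erase b) S).toReal * D.eval (-s)) * E.eval (-s) :=
          (IsPoly.sum T fun b hb => hih b hb S).mul (IsPoly.eval E)
        have h3 : IsPoly fun s => (∑ a ∈ S, ∑ b ∈ T,
            (coverIntegral α s r (T.erase b) (S.erase a)).toReal * D.eval (-s)) * E.eval (-s) :=
          (IsPoly.sum S fun a _ => IsPoly.sum T fun b hb => hih b hb _).mul (IsPoly.eval E)
        refine (((h2.add (IsPoly.neg_id.mul h1)).add ((IsPoly.const κ).mul h3)).mul
          (IsPoly.const (T.card : ℝ)⁻¹)).congr fun s hs => ?_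
        have hrec := coverIntegral_recursion (α := α) hs hr hT ha
        have hfac : (boundaryFactor r (Fintype.card α) T.card S.card).eval (-s) =
            (T.card : ℝ)⁻¹ * (T.card + s * (S.card * κ)) := by
          simp only [boundaryFactor, eval_sub, eval_one, eval_mul, eval_C, eval_X, κ]
          rw [mul_add, inv_mul_cancel₀ hT0.ne', div_eq_mul_inv, mul_inv]
          ring
        simp only [eval_mul, hfac, ← Finset.sum_mul]
        linear_combination (T.card : ℝ)⁻¹ * D.eval (-s) * E.eval (-s) * hrec
    -- The factors with `f < S.card` are supplied here; beyond `r + 2` the integral is zero, whence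
    -- the `min`.
    have h := (key (r + 2) S (by omega)).mul
      (IsPoly.eval (∏ f ∈ Finset.range (min S.card (r + 2)),
        boundaryFactor r (Fintype.card α) T.card f))
    refine h.congr fun s _ => ?_
    rw [matchingDenominator_succ r _ (by omega : 1 ≤ T.card)]
    by_cases hS : S.card ≤ r + 2
    · rw [min_eq_left hS, ← Finset.prod_range_mul_prod_Ico _ hS]
      simp only [eval_mul]
      ring
    · simp [coverIntegral_of_lt_card _ T (show r + 1 < S.card by omega)]

end Rational

/-! ### Passage to real edge costs -/

section CostLaw

instance : IsProbabilityMeasure (expMeasure 1) := isProbabilityMeasure_expMeasure one_pos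

theorem ae_expMeasure_nonneg : ∀ᵐ x ∂expMeasure 1, 0 ≤ x := by
  have h : expMeasure 1 (Set.Iio 0) = 0 := by
    change (volume.withDensity (exponentialPDF 1)) _ = 0
    rw [withDensity_apply _ measurableSet_Iio, lintegral_exponentialPDF_of_nonpos le_rfl]
  filter_upwards [measure_eq_zero_iff_ae_notMem.1 h] with x hx
  exact not_lt.1 hx

theorem expLaw_map_toReal : expLaw.map ENNReal.toReal = expMeasure 1 := by
  rw [expLaw_eq_map, Measure.map_map ENNReal.measurable_toReal ENNReal.measurable_ofReal]
  conv_rhs => rw [← Measure.map_id (μ := expMeasure 1)]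
  refine Measure.map_congr ?_
  filter_upwards [ae_expMeasure_nonneg] with x hx
  exact ENNReal.toReal_ofReal hx

/-- The law of independent exponential edge costs. -/
noncomputable def costLaw (m n : ℕ) : Measure (Fin m × Fin n → ℝ) :=
  Measure.pi fun _ => expMeasure 1

instance (m n : ℕ) : IsProbabilityMeasure (costLaw m n) :=
  inferInstanceAs (IsProbabilityMeasure (Measure.pi _))

variable {k m n : ℕ}

/-- The costs of the edges in the regular rows. -/
noncomputable def regularCosts {ε : Type*} (c : Fin m ⊕ ε → Fin n → ℝ≥0∞) (e : Fin m × Fin n) :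
    ℝ :=
  (c (Sum.inl e.1) e.2).toReal

variable {ε : Type*} [DecidableEq ε] [Fintype ε]

theorem measurable_regularCosts :
    Measurable (regularCosts : (Fin m ⊕ ε → Fin n → ℝ≥0∞) → Fin m × Fin n → ℝ) := by
  unfold regularCosts
  fun_prop

theorem map_regularCosts :
    (matrixLaw (Fin m) (Fin n) (∅ : Finset ε)).map regularCosts = costLaw m n := by
  refine (Measure.pi_eq fun s hs => ?_).symm
  rw [Measure.map_apply measurable_regularCosts (MeasurableSet.univ_pi hs)]
  have h : (regularCosts : (Fin m ⊕ ε → Fin n → ℝ≥0∞) → _) ⁻¹' Set.univ.pi s =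
      Set.univ.pi (Sum.elim (fun a => Set.univ.pi fun b => ENNReal.toReal ⁻¹' s (a, b))
        fun _ => Set.univ) := by
    ext c
    simp [Set.mem_pi, regularCosts]
  have h1 : ∀ e, expLaw (ENNReal.toReal ⁻¹' s e) = expMeasure 1 (s e) := fun e => by
    rw [← expLaw_map_toReal, Measure.map_apply ENNReal.measurable_toReal (hs e)]
  have h2 : ∀ e : ε, rowLaw (∅ : Finset ε) (Sum.inr e : Fin m ⊕ ε)
      (Set.univ : Set (Fin n → ℝ≥0∞)) = 1 := fun e => by
    rw [rowLaw_inr_of_notMem (Finset.notMem_empty e), measure_univ]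
  rw [h, matrixLaw, Measure.pi_pi, Fintype.prod_sum_type, Fintype.prod_prod_type]
  simp only [Sum.elim_inl, Sum.elim_inr, h2, Finset.prod_const_one, mul_one]
  refine Finset.prod_congr rfl fun a _ => ?_
  change (Measure.pi fun _ => expLaw) _ = _
  rw [Measure.pi_pi]
  exact Finset.prod_congr rfl fun b _ => h1 _

theorem minMatchingCost_le (c : Fin m × Fin n → ℝ) (hm : k ≤ m) (hn : k ≤ n)
    {M : Finset (Fin m × Fin n)} (hM : IsKMatching k m n M) :
    minMatchingCost k c ≤ totalCost c M :=
  (minMatchingCost_isLeast hm hn c).2 ⟨M, hM, rfl⟩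

theorem exists_totalCost_eq (c : Fin m × Fin n → ℝ) (hm : k ≤ m) (hn : k ≤ n) :
    ∃ M, IsKMatching k m n M ∧ totalCost c M = minMatchingCost k c :=
  (minMatchingCost_isLeast hm hn c).1

theorem measurable_minMatchingCost (hm : k ≤ m) (hn : k ≤ n) :
    Measurable (minMatchingCost k : (Fin m × Fin n → ℝ) → ℝ) := by
  refine measurable_of_Iio fun x => ?_
  have h : (minMatchingCost k : (Fin m × Fin n → ℝ) → ℝ) ⁻¹' Set.Iio x =
      ⋃ M ∈ {M | IsKMatching k m n M}, (fun c => totalCost c M) ⁻¹' Set.Iio x := by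
    ext c
    simp only [Set.mem_preimage, Set.mem_Iio, Set.mem_iUnion, exists_prop]
    constructor
    · intro h
      obtain ⟨M, hM, hc⟩ := exists_totalCost_eq c hm hn
      exact ⟨M, hM, hc ▸ h⟩
    · rintro ⟨M, hM, h⟩
      exact (minMatchingCost_le c hm hn hM).trans_lt h
  rw [h]
  refine MeasurableSet.biUnion (Set.to_countable _) fun M _ => ?_
  have : Measurable fun c : Fin m × Fin n → ℝ => totalCost c M := by
    unfold totalCost
    fun_prop
  exact this measurableSet_Iio

/-- The inclusion of the edges in the regular rows. -/
def regularEdge : Fin m × Fin n ↪ (Fin m ⊕ ε) × Fin n :=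
  Function.Embedding.inl.prodMap (Function.Embedding.refl _)

theorem regularEdge_apply (e : Fin m × Fin n) :
    (regularEdge e : (Fin m ⊕ ε) × Fin n) = (Sum.inl e.1, e.2) := rfl

theorem map_regularEdge_mem_matchings {M : Finset (Fin m × Fin n)} :
    M.map regularEdge ∈ matchings (Fin m ⊕ ε) k Finset.univ ↔ IsKMatching k m n M := by
  simp only [mem_matchings, IsMatching, IsKMatching, Finset.card_map, Finset.subset_univ, and_true,
    Finset.forall_mem_map, regularEdge_apply, Sum.inl.injEq, Prod.mk.injEq]
  constructor
  · rintro ⟨⟨h1, h2⟩, h3⟩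
    exact ⟨h3, fun e he f hf hne => ⟨fun h => hne (Prod.ext h (h1 e he f hf h).2),
      fun h => hne (Prod.ext (h2 e he f hf h).1 h)⟩⟩
  · rintro ⟨h3, h⟩
    refine ⟨⟨fun e he f hf h' => ?_, fun e he f hf h' => ?_⟩, h3⟩
    · have := not_imp_not.1 (fun hne => (h e he f hf hne).1) h'
      simp [this]
    · have := not_imp_not.1 (fun hne => (h e he f hf hne).2) h'
      simp [this]

theorem toReal_cost_map {c : Fin m ⊕ ε → Fin n → ℝ≥0∞} (hc : ∀ i b, c (Sum.inl i) b ≠ ⊤)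
    (M : Finset (Fin m × Fin n)) :
    (cost c (M.map regularEdge)).toReal = totalCost (regularCosts c) M := by
  rw [cost, Finset.sum_map]
  exact ENNReal.toReal_sum fun e _ => hc _ _

/-- With no extra row present, an optimal matching of finite cost uses regular rows only. -/
theorem Good.toReal_minCost {c : Fin m ⊕ ε → Fin n → ℝ≥0∞} (hc : Good ∅ c) (hm : k ≤ m)
    (hn : k ≤ n) :
    (minCost c k Finset.univ).toReal = minMatchingCost k (regularCosts c) := by
  have hopt := hc.isOptimal_optimum (r := k) (T := Finset.univ) (by simpa using hm) (by simpa using hn)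
  rw [hopt.minCost_eq]
  set N := optimum c k Finset.univ
  obtain ⟨M, hM⟩ : ∃ M : Finset (Fin m × Fin n), M.map regularEdge = N := by
    refine ⟨Finset.univ.filter fun e => regularEdge e ∈ N, ?_⟩
    ext ⟨i, b⟩
    simp only [Finset.mem_map, Finset.mem_filter, Finset.mem_univ, true_and]
    constructor
    · rintro ⟨e, he, h⟩
      rwa [← h]
    · intro h
      rcases i with i | f
      · exact ⟨(i, b), h, rfl⟩
      · exact absurd (mem_rows.2 ⟨b, h⟩)
          (notMem_rows_of_top hopt.2.1 (hc.2.2 f (Finset.notMem_empty f)))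
  have hMk : IsKMatching k m n M := by
    rw [← map_regularEdge_mem_matchings (ε := ε), hM]
    exact hopt.1
  rw [← hM, toReal_cost_map hc.2.1]
  refine le_antisymm ?_ (minMatchingCost_le _ hm hn hMk)
  obtain ⟨M', hM', h⟩ := exists_totalCost_eq (regularCosts c) hm hn
  rw [← h, ← toReal_cost_map hc.2.1, ← toReal_cost_map hc.2.1, hM]
  refine ENNReal.toReal_mono ?_ (hopt.2.2 _ (map_regularEdge_mem_matchings.2 hM'))
  exact ENNReal.sum_ne_top.2 fun e he => by
    obtain ⟨f, _, rfl⟩ := Finset.mem_map.1 he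
    exact hc.2.1 _ _

theorem integral_exp_minMatchingCost (s : ℝ) (hm : k ≤ m) (hn : k ≤ n) :
    ∫ c, Real.exp (-s * minMatchingCost k c) ∂costLaw m n =
      (coverIntegral (Fin m) s k (Finset.univ : Finset (Fin n)) (∅ : Finset ε)).toReal := by
  have hmeas := measurable_minMatchingCost (k := k) hm hn
  rw [← map_regularCosts (ε := ε), integral_map measurable_regularCosts.aemeasurable (by fun_prop),
    integral_eq_lintegral_of_nonneg_ae (ae_of_all _ fun _ => (Real.exp_pos _).le)
      ((by fun_prop : Measurable fun c : Fin m × Fin n → ℝ =>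
        Real.exp (-s * minMatchingCost k c)).comp measurable_regularCosts).aestronglyMeasurable]
  congr 1
  refine lintegral_congr_ae ?_
  filter_upwards [ae_good ∅] with c hc
  have hopt := hc.isOptimal_optimum (r := k) (T := Finset.univ) (by simpa using hm) (by simpa using hn)
  have hcov : Covers ∅ (optimum c k Finset.univ) := fun e he => absurd he (Finset.notMem_empty e)
  rw [if_pos hcov, expCost_of_ne_top, hc.toReal_minCost hm hn, neg_mul]
  rw [hopt.minCost_eq]
  exact hopt.2.1

end CostLaw

/-! ### Exponential moments and tail of the exponential law -/

section Exponential

theorem lintegral_exp_mul_expMeasure {t : ℝ} (ht : t < 1) :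
    ∫⁻ x, ENNReal.ofReal (Real.exp (t * x)) ∂expMeasure 1 = ENNReal.ofReal (1 / (1 - t)) := by
  change ∫⁻ x, _ ∂(volume.withDensity (exponentialPDF 1)) = _
  have hm : ∀ r, Measurable (exponentialPDF r) := fun r =>
    (measurable_exponentialPDFReal r).ennreal_ofReal
  have h1 : 0 < 1 - t := by linarith
  rw [lintegral_withDensity_eq_lintegral_mul _ (hm 1) (by fun_prop),
    ← mul_one (ENNReal.ofReal (1 / (1 - t))), ← lintegral_exponentialPDF_eq_one h1,
    ← lintegral_const_mul _ (hm _)]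
  refine lintegral_congr fun x => ?_
  rcases lt_or_ge x 0 with hx | hx
  · simp [exponentialPDF_of_neg hx]
  · rw [Pi.mul_apply, exponentialPDF_of_nonneg hx, exponentialPDF_of_nonneg hx,
      ← ENNReal.ofReal_mul (by positivity), ← ENNReal.ofReal_mul (by positivity), one_mul, one_mul,
      ← Real.exp_add, ← mul_assoc, one_div, inv_mul_cancel₀ h1.ne', one_mul]
    ring_nf

theorem integrable_exp_mul_expMeasure {t : ℝ} (ht : t < 1) :
    Integrable (fun x => Real.exp (t * x)) (expMeasure 1) := by
  rw [← lintegral_ofReal_ne_top_iff_integrable (by fun_prop) (ae_of_all _ fun _ => (Real.exp_pos _).le),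
    lintegral_exp_mul_expMeasure ht]
  exact ENNReal.ofReal_ne_top

theorem integral_exp_mul_expMeasure {t : ℝ} (ht : t < 1) :
    ∫ x, Real.exp (t * x) ∂expMeasure 1 = 1 / (1 - t) := by
  have h1 : 0 < 1 - t := by linarith
  rw [integral_eq_lintegral_of_nonneg_ae (ae_of_all _ fun _ => (Real.exp_pos _).le) (by fun_prop),
    lintegral_exp_mul_expMeasure ht, ENNReal.toReal_ofReal (by positivity)]

theorem expMeasure_Ioi {y : ℝ} (hy : 0 ≤ y) :
    (expMeasure 1) (Set.Ioi y) = ENNReal.ofReal (Real.exp (-y)) := by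
  have h := cdf_expMeasure_eq one_pos y
  rw [if_pos hy, one_mul, cdf_eq_real] at h
  rw [← Set.compl_Iic, ← ofReal_measureReal, probReal_compl_eq_one_sub measurableSet_Iic, h]
  simp

end Exponential

/-! ### Integrability, bounds, and divergence at the zeros of the denominator -/

section CostLaw

variable {k m n : ℕ}

theorem map_eval_costLaw (e : Fin m × Fin n) :
    (costLaw m n).map (fun c => c e) = expMeasure 1 :=
  (measurePreserving_eval (fun _ : Fin m × Fin n => expMeasure 1) e).map_eq

theorem ae_costLaw_nonneg : ∀ᵐ c ∂costLaw m n, ∀ e, 0 ≤ c e := by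
  rw [ae_all_iff]
  intro e
  have := ae_expMeasure_nonneg
  rw [← map_eval_costLaw e] at this
  exact ae_of_ae_map (measurable_pi_apply e).aemeasurable this

theorem iIndepFun_costLaw : iIndepFun (fun (e : Fin m × Fin n) c => c e) (costLaw m n) :=
  iIndepFun_pi (X := fun _ x => x) (μ := fun _ => expMeasure 1) fun _ => by fun_prop

theorem integrable_exp_mul_eval {t : ℝ} (ht : t < 1) (e : Fin m × Fin n) :
    Integrable (fun c => Real.exp (t * c e)) (costLaw m n) := by
  have := integrable_exp_mul_expMeasure ht
  rw [← map_eval_costLaw e] at this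
  exact this.comp_measurable (by fun_prop)

theorem mgf_eval {t : ℝ} (ht : t < 1) (e : Fin m × Fin n) :
    mgf (fun c => c e) (costLaw m n) t = 1 / (1 - t) := by
  have := integral_exp_mul_expMeasure ht
  rwa [← map_eval_costLaw e, integral_map (measurable_pi_apply e).aemeasurable (by fun_prop)] at this

theorem integrable_exp_totalCost {t : ℝ} (ht : t < 1) (M : Finset (Fin m × Fin n)) :
    Integrable (fun c => Real.exp (t * totalCost c M)) (costLaw m n) := by
  have := iIndepFun_costLaw.integrable_exp_mul_sum (fun e => by fun_prop) (s := M)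
    fun e _ => integrable_exp_mul_eval ht e
  simpa [totalCost] using this

theorem integral_exp_totalCost {t : ℝ} (ht : t < 1) (M : Finset (Fin m × Fin n)) :
    ∫ c, Real.exp (t * totalCost c M) ∂costLaw m n = 1 / (1 - t) ^ M.card := by
  have := iIndepFun_costLaw.mgf_sum (fun e => by fun_prop) M (t := t)
  simp only [mgf_eval ht, Finset.prod_const, one_div, inv_pow] at this
  simpa [mgf, totalCost] using this

theorem minMatchingCost_nonneg {c : Fin m × Fin n → ℝ} (hc : ∀ e, 0 ≤ c e) (hm : k ≤ m)
    (hn : k ≤ n) : 0 ≤ minMatchingCost k c := by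
  obtain ⟨M, _, h⟩ := exists_totalCost_eq c hm hn
  rw [← h]
  exact Finset.sum_nonneg fun e _ => hc e

theorem integrable_exp_minMatchingCost (hm : k ≤ m) (hn : k ≤ n) {t : ℝ} (ht : t < 1) :
    Integrable (fun c => Real.exp (t * minMatchingCost k c)) (costLaw m n) := by
  have hmeas := measurable_minMatchingCost (k := k) hm hn
  obtain ⟨M, hM⟩ := exists_isKMatching hm hn
  refine ((integrable_const (1 : ℝ)).add (integrable_exp_totalCost ht M)).mono' (by fun_prop) ?_
  filter_upwards [ae_costLaw_nonneg] with c hc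
  have h0 := minMatchingCost_nonneg hc hm hn
  have h1 := minMatchingCost_le c hm hn hM
  rw [Real.norm_eq_abs, Real.abs_exp, Pi.add_apply]
  rcases le_total t 0 with h | h
  · have : Real.exp (t * minMatchingCost k c) ≤ 1 :=
      Real.exp_le_one_iff.2 (mul_nonpos_of_nonpos_of_nonneg h h0)
    linarith [Real.exp_pos (t * totalCost c M)]
  · have : Real.exp (t * minMatchingCost k c) ≤ Real.exp (t * totalCost c M) :=
      Real.exp_le_exp.2 (mul_le_mul_of_nonneg_left h1 h)
    linarith

/-- The minimum is at most the cost of one fixed matching, a sum of `k` independent exponential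
variables. -/
theorem le_integral_exp_minMatchingCost (hm : k ≤ m) (hn : k ≤ n) {t : ℝ} (ht : t ≤ 0) :
    1 / (1 - t) ^ k ≤ ∫ c, Real.exp (t * minMatchingCost k c) ∂costLaw m n := by
  obtain ⟨M, hM⟩ := exists_isKMatching hm hn
  have ht1 : t < 1 := by linarith
  have h := integral_exp_totalCost ht1 M
  rw [hM.1] at h
  rw [← h]
  refine integral_mono (integrable_exp_totalCost ht1 M) (integrable_exp_minMatchingCost hm hn ht1)
    fun c => Real.exp_le_exp.2 ?_
  exact mul_le_mul_of_nonpos_left (minMatchingCost_le c hm hn hM) ht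

theorem integral_exp_minMatchingCost_le (hm : k ≤ m) (hn : k ≤ n) {t : ℝ} (ht : t ≤ 0) :
    ∫ c, Real.exp (t * minMatchingCost k c) ∂costLaw m n ≤
      1 / (1 - t / ((m : ℝ) * n)) ^ k := by
  rcases ht.eq_or_lt with rfl | ht
  · simp
  -- The upper bound needs a single extra row.
  have h1 := integral_exp_minMatchingCost (ε := Unit) (-t) hm hn
  have h2 := toReal_coverIntegral_le (α := Fin m) (ε := Unit) (neg_pos.2 ht) (ν := n) k
    (Finset.univ : Finset (Fin n)) (by simpa using hm) (by simpa using hn) (by simp)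
  rw [← h1] at h2
  simpa [neg_div, sub_eq_add_neg] using h2

open Polynomial in
theorem exists_integral_exp_mul_eq_eval (hm : k ≤ m) (hn : k ≤ n) : ∃ P : ℝ[X], ∀ t < 0,
    (∫ c, Real.exp (t * minMatchingCost k c) ∂costLaw m n) *
      (matchingDenominator k m n).eval t = P.eval t := by
  -- The descending induction needs `k + 1` extra rows.
  obtain ⟨P, hP⟩ := isPoly_coverIntegral (α := Fin m) k (Finset.univ : Finset (Fin n))
    (∅ : Finset (Fin (k + 1))) (by simpa using hm) (by simpa using hn) (by simp)
  refine ⟨P, fun t ht => ?_⟩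
  have h := hP (-t) (neg_pos.2 ht)
  beta_reduce at h
  rw [← integral_exp_minMatchingCost (-t) hm hn] at h
  simpa using h

/-- The edges avoiding the first `i` rows and the first `j` columns. -/
def block (m n i j : ℕ) : Finset (Fin m × Fin n) :=
  Finset.univ.filter fun e => i ≤ e.1 ∧ j ≤ e.2

theorem card_block (m n i j : ℕ) : (block m n i j).card = (m - i) * (n - j) := by
  have h : ∀ m i : ℕ, (Finset.univ.filter fun a : Fin m => i ≤ a).card = m - i := fun m i => by
    rw [← Finset.card_map Fin.valEmbedding]
    have : (Finset.univ.filter fun a : Fin m => i ≤ a).map Fin.valEmbedding = Finset.Ico i m := by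
      ext x
      simp only [Finset.mem_map, Finset.mem_filter, Finset.mem_univ, true_and,
        Fin.valEmbedding_apply, Finset.mem_Ico]
      exact ⟨by rintro ⟨a, ha, rfl⟩; exact ⟨ha, a.2⟩, fun hx => ⟨⟨x, hx.2⟩, hx.1, rfl⟩⟩
    rw [this, Nat.card_Ico]
  rw [← h m i, ← h n j, ← Finset.card_product]
  congr 1
  ext e
  simp [block]

/-- At most `i` edges of a matching meet the first `i` rows, and at most `j` meet the first `j`
columns. -/
theorem le_card_inter_block {M : Finset (Fin m × Fin n)} (hM : IsKMatching k m n M)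
    (i j : ℕ) : k - i - j ≤ (M ∩ block m n i j).card := by
  have h1 : (M.filter fun e => e.1.1 < i).card ≤ i := by
    rw [← Finset.card_range i]
    refine Finset.card_le_card_of_injOn (fun e => e.1.1) (fun e he => ?_) fun e he f hf h => ?_
    · simpa using (Finset.mem_filter.1 he).2
    · by_contra hne
      exact (hM.2 e (Finset.mem_filter.1 he).1 f (Finset.mem_filter.1 hf).1 hne).1 (Fin.ext h)
  have h2 : (M.filter fun e => e.2.1 < j).card ≤ j := by
    rw [← Finset.card_range j]
    refine Finset.card_le_card_of_injOn (fun e => e.2.1) (fun e he => ?_) fun e he f hf h => ?_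
    · simpa using (Finset.mem_filter.1 he).2
    · by_contra hne
      exact (hM.2 e (Finset.mem_filter.1 he).1 f (Finset.mem_filter.1 hf).1 hne).2 (Fin.ext h)
  have h3 : M ⊆ (M ∩ block m n i j) ∪
      ((M.filter fun e => e.1.1 < i) ∪ M.filter fun e => e.2.1 < j) := by
    intro e he
    simp only [Finset.mem_union, Finset.mem_inter, Finset.mem_filter, block, Finset.mem_univ, he,
      true_and]
    omega
  have h4 := (Finset.card_le_card h3).trans ((Finset.card_union_le _ _).trans
    (Nat.add_le_add_left (Finset.card_union_le _ _) _))
  rw [hM.1] at h4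
  omega

theorem costLaw_lt_block (i j : ℕ) {y : ℝ} (hy : 0 ≤ y) :
    costLaw m n {c | ∀ e ∈ block m n i j, y < c e} =
      ENNReal.ofReal (Real.exp (-(((m - i) * (n - j) : ℕ) * y))) := by
  have h : {c : Fin m × Fin n → ℝ | ∀ e ∈ block m n i j, y < c e} =
      Set.univ.pi fun e => if e ∈ block m n i j then Set.Ioi y else Set.univ := by
    ext c
    simp only [Set.mem_ofPred_eq, Set.mem_pi, Set.mem_univ, true_imp_iff]
    refine forall_congr' fun e => ?_
    split_ifs with he <;> simp [he]
  rw [h, costLaw, Measure.pi_pi]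
  have h1 : ∀ e, (expMeasure 1) (if e ∈ block m n i j then Set.Ioi y else Set.univ) =
      if e ∈ block m n i j then ENNReal.ofReal (Real.exp (-y)) else 1 := fun e => by
    split_ifs
    · exact expMeasure_Ioi hy
    · exact measure_univ
  simp only [h1]
  rw [Finset.prod_ite_mem, Finset.univ_inter, Finset.prod_const, card_block,
    ← ENNReal.ofReal_pow (Real.exp_pos _).le, ← Real.exp_nat_mul]
  simp

theorem mul_le_minMatchingCost (hm : k ≤ m) (hn : k ≤ n) (i j : ℕ) {y : ℝ} (hy : 0 ≤ y)
    {c : Fin m × Fin n → ℝ} (hc : ∀ e, 0 ≤ c e) (hyc : ∀ e ∈ block m n i j, y < c e) :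
    (k - i - j : ℕ) * y ≤ minMatchingCost k c := by
  obtain ⟨M, hM, h⟩ := exists_totalCost_eq c hm hn
  rw [← h]
  calc ((k - i - j : ℕ) : ℝ) * y ≤ (M ∩ block m n i j).card * y :=
        mul_le_mul_of_nonneg_right (Nat.cast_le.2 (le_card_inter_block hM i j)) hy
    _ ≤ ∑ e ∈ M ∩ block m n i j, c e := by
        rw [← nsmul_eq_mul]
        exact Finset.card_nsmul_le_sum _ _ _ fun e he => (hyc e (Finset.mem_inter.1 he).2).le
    _ ≤ totalCost c M :=
        Finset.sum_le_sum_of_subset_of_nonneg Finset.inter_subset_left fun e _ _ => hc e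

/-- All `N = (m - i) (n - j)` edges of the block exceed `l` with probability `exp (-N l)`, and then
the minimum is at least `(k - i - j) l`, so the integrand is at least `exp (N l)`. The integral over
this event is thus at least `1` for every `l`, although the events decrease to the empty set. -/
theorem not_integrable_exp_minMatchingCost (hm : k ≤ m) (hn : k ≤ n) {i j : ℕ} (hij : i + j < k) :
    ¬ Integrable (fun c => Real.exp ((((m : ℝ) - i) * ((n : ℝ) - j)) / ((k : ℝ) - i - j) *
      minMatchingCost k c)) (costLaw m n) := by
  intro hint
  set N : ℕ := (m - i) * (n - j) with hN
  set f : ℕ := k - i - j with hf'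
  have hf : (0 : ℝ) < f := Nat.cast_pos.2 (by omega)
  have hθ : (((m : ℝ) - i) * ((n : ℝ) - j)) / ((k : ℝ) - i - j) = N / f := by
    rw [hN, hf', Nat.cast_mul, Nat.cast_sub (by omega), Nat.cast_sub (by omega),
      Nat.cast_sub (by omega), Nat.cast_sub (by omega)]
  rw [hθ] at hint
  set A : ℕ → Set (Fin m × Fin n → ℝ) := fun l => {c | ∀ e ∈ block m n i j, (l : ℝ) < c e}
  have hA : ∀ l, MeasurableSet (A l) := fun l => by
    have : A l = ⋂ e ∈ block m n i j, {c | (l : ℝ) < c e} := by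
      ext c
      simp [A]
    rw [this]
    exact Finset.measurableSet_biInter _ fun e _ => measurableSet_lt (by fun_prop) (by fun_prop)
  have hanti : Antitone A := fun l l' h c hc e he => (Nat.cast_le.2 h).trans_lt (hc e he)
  have hempty : ⋂ l, A l = ∅ := by
    refine Set.eq_empty_of_forall_notMem fun c hc => ?_
    have hpos : 0 < (block m n i j).card := by
      rw [card_block]
      exact Nat.mul_pos (by omega) (by omega)
    obtain ⟨e, he⟩ := Finset.card_pos.1 hpos
    obtain ⟨l, hl⟩ := exists_nat_gt (c e)
    exact absurd (Set.mem_iInter.1 hc l e he) (not_lt.2 hl.le)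
  have hlim := tendsto_setIntegral_of_antitone hA hanti ⟨0, hint.integrableOn⟩
  rw [hempty, setIntegral_empty] at hlim
  refine absurd (ge_of_tendsto' hlim fun l => ?_) (not_le.2 one_pos)
  have hl : (0 : ℝ) ≤ l := Nat.cast_nonneg l
  have h1 : ∫ _ in A l, Real.exp (N * l) ∂costLaw m n = 1 := by
    rw [setIntegral_const, Measure.real, costLaw_lt_block i j hl,
      ENNReal.toReal_ofReal (Real.exp_pos _).le, smul_eq_mul, ← Real.exp_add, neg_add_cancel,
      Real.exp_zero]
  rw [← h1]
  refine setIntegral_mono_ae_restrict (integrable_const _).integrableOn hint.integrableOn ?_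
  filter_upwards [ae_restrict_mem (hA l), ae_restrict_of_ae ae_costLaw_nonneg] with c hc hc0
  refine Real.exp_le_exp.2 ?_
  have := mul_le_mul_of_nonneg_left (mul_le_minMatchingCost hm hn i j hl hc0 hc)
    (by positivity : (0 : ℝ) ≤ N / f)
  rwa [← mul_assoc, div_mul_cancel₀ _ hf.ne'] at this

end CostLaw

/-! ### Degree and zeros of the denominator -/

section Denominator

open Polynomial

variable {k m n : ℕ}

theorem card_filter_add_lt (k : ℕ) :
    ((Finset.range k ×ˢ Finset.range k).filter fun p => p.1 + p.2 < k).card = (k + 1).choose 2 := by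
  rw [Finset.card_filter, Finset.sum_product]
  have h : ∀ i ∈ Finset.range k, (∑ j ∈ Finset.range k, if i + j < k then 1 else 0) = k - i := by
    intro i _
    rw [← Finset.card_filter]
    have : ((Finset.range k).filter fun j => i + j < k) = Finset.range (k - i) := by
      ext j
      simp only [Finset.mem_filter, Finset.mem_range]
      omega
    rw [this, Finset.card_range]
  rw [Finset.sum_congr rfl h, ← Finset.sum_range_reflect, Nat.choose_two_right, ← Finset.sum_range_id,
    Finset.sum_range_succ']
  refine Finset.sum_congr rfl fun i hi => ?_
  rw [Finset.mem_range] at hi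
  omega

/-- The coefficients of `matchingDenominator` are nonzero. -/
theorem coeff_pos (hm : k ≤ m) (hn : k ≤ n) {i j : ℕ} (hij : i + j < k) :
    0 < ((k : ℝ) - i - j) / (((m : ℝ) - i) * ((n : ℝ) - j)) := by
  have h1 : (i : ℝ) + j < k := by exact_mod_cast hij
  have h2 : (k : ℝ) ≤ m := Nat.cast_le.2 hm
  have h3 : (k : ℝ) ≤ n := Nat.cast_le.2 hn
  have h4 : (0 : ℝ) ≤ i := Nat.cast_nonneg i
  have h5 : (0 : ℝ) ≤ j := Nat.cast_nonneg j
  exact div_pos (by linarith) (mul_pos (by linarith) (by linarith))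

theorem degree_one_sub_C_mul_X {a : ℝ} (ha : a ≠ 0) : (1 - C a * X : ℝ[X]).degree = 1 := by
  have : (1 - C a * X : ℝ[X]) = C (-a) * X + C 1 := by
    simp only [map_neg, map_one]
    ring
  rw [this, degree_linear (neg_ne_zero.2 ha)]

theorem degree_matchingDenominator (hm : k ≤ m) (hn : k ≤ n) :
    (matchingDenominator k m n).degree = (((k + 1).choose 2 : ℕ) : WithBot ℕ) := by
  rw [matchingDenominator, degree_prod, Finset.sum_congr rfl fun p hp =>
    degree_one_sub_C_mul_X (coeff_pos hm hn (Finset.mem_filter.1 hp).2).ne', Finset.sum_const,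
    card_filter_add_lt, nsmul_one]

theorem exists_of_aeval_matchingDenominator_eq_zero (hm : k ≤ m) (hn : k ≤ n) {z : ℂ}
    (hz : aeval z (matchingDenominator k m n) = 0) : ∃ i j : ℕ, i + j < k ∧
      z.re = (((m : ℝ) - i) * ((n : ℝ) - j)) / ((k : ℝ) - i - j) := by
  rw [matchingDenominator, map_prod, Finset.prod_eq_zero_iff] at hz
  obtain ⟨p, hp, h⟩ := hz
  have hp' := (Finset.mem_filter.1 hp).2
  refine ⟨p.1, p.2, hp', ?_⟩
  have hpos := coeff_pos hm hn hp'
  rw [← inv_div]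
  set a := ((k : ℝ) - p.1 - p.2) / (((m : ℝ) - p.1) * ((n : ℝ) - p.2))
  have h1 : (a : ℂ) * z = 1 := by
    rw [map_sub, map_one, map_mul, aeval_C, aeval_X, sub_eq_zero] at h
    exact h.symm
  have h2 := congrArg Complex.re h1
  rw [Complex.re_ofReal_mul, Complex.one_re] at h2
  exact eq_inv_of_mul_eq_one_right h2

end Denominator

/-! ### Degree of the numerator -/

section Degree

open Polynomial Filter Asymptotics

theorem degree_le_of_isBigO_atBot {P Q : ℝ[X]} (h : P.eval =O[atBot] Q.eval) :
    P.degree ≤ Q.degree := by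
  by_contra! hlt
  have hP : P ≠ 0 := by
    rintro rfl
    simp at hlt
  exact isLittleO_irrefl (eventually_atBot_not_isRoot P hP).frequently
    (h.trans_isLittleO (isLittleO_atBot_of_degree_lt _ _ hlt))

/-- At `-∞` the bounds make `Q` big-O of `P (1 - t)^k` and `P (1 - a t)^k` big-O of `Q`, so the
degrees of `P` and `Q` differ by `k`. The case `a = 0` is admitted for `k = 0`, where `m n` may
vanish. -/
theorem degree_eq_of_bounds {P Q : ℝ[X]} {F : ℝ → ℝ} {k d : ℕ} {a : ℝ} (ha : 0 ≤ a)
    (hak : k ≠ 0 → a ≠ 0) (hQ : Q.degree = ((d + k : ℕ) : WithBot ℕ))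
    (hP : ∀ t < 0, F t * Q.eval t = P.eval t) (hl : ∀ t < 0, 1 / (1 - t) ^ k ≤ F t)
    (hu : ∀ t < 0, F t ≤ 1 / (1 - a * t) ^ k) : P.degree = (d : WithBot ℕ) := by
  have hdeg : ∀ b : ℝ, (k ≠ 0 → b ≠ 0) → (P * (1 - C b * X) ^ k).degree = P.degree + k := by
    intro b hb
    rw [degree_mul, degree_pow]
    rcases eq_or_ne k 0 with rfl | hk
    · simp
    · rw [degree_one_sub_C_mul_X (hb hk), nsmul_one]
  have h1 : Q.eval =O[atBot] (P * (1 - C 1 * X) ^ k).eval := by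
    refine IsBigO.of_bound 1 ?_
    filter_upwards [eventually_lt_atBot 0] with t ht
    have h0 : 0 < (1 - t) ^ k := pow_pos (by linarith) k
    have h2 := hl t ht
    rw [div_le_iff₀ h0] at h2
    simp only [eval_mul, eval_pow, eval_sub, eval_one, eval_C, eval_X, one_mul, ← hP t ht]
    rw [mul_right_comm, norm_mul, Real.norm_of_nonneg (zero_le_one.trans h2)]
    exact le_mul_of_one_le_left (norm_nonneg _) h2
  have h2 : (P * (1 - C a * X) ^ k).eval =O[atBot] Q.eval := by
    refine IsBigO.of_bound 1 ?_
    filter_upwards [eventually_lt_atBot 0] with t ht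
    have h0 : 0 < (1 - a * t) ^ k := pow_pos (by nlinarith) k
    have h2 := hu t ht
    have h3 : 0 ≤ F t := (one_div_nonneg.2 (pow_nonneg (by linarith) k)).trans (hl t ht)
    rw [le_div_iff₀ h0] at h2
    simp only [eval_mul, eval_pow, eval_sub, eval_one, eval_C, eval_X, ← hP t ht]
    rw [mul_right_comm, norm_mul, Real.norm_of_nonneg (mul_nonneg h3 h0.le)]
    exact mul_le_mul_of_nonneg_right h2 (norm_nonneg _)
  have h3 := degree_le_of_isBigO_atBot h1
  have h4 := degree_le_of_isBigO_atBot h2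
  rw [hdeg 1 fun _ => one_ne_zero, hQ] at h3
  rw [hdeg a hak, hQ] at h4
  have h5 := le_antisymm h4 h3
  have hP0 : P ≠ 0 := by
    rintro rfl
    rw [degree_zero, WithBot.bot_add] at h5
    exact WithBot.bot_ne_coe h5
  rw [degree_eq_natDegree hP0] at h5 ⊢
  have h6 : P.natDegree + k = d + k := by exact_mod_cast h5
  rw [Nat.add_right_cancel h6]

end Degree

/-! ### Analytic continuation to the domain of the generating function -/

section Continuation

open Polynomial Filter

variable {Ω : Type*} [MeasurableSpace Ω] {μ : Measure Ω} [IsProbabilityMeasure μ] {Y : Ω → ℝ}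

theorem integrable_cexp_iff (hY : AEMeasurable Y μ) (z : ℂ) :
    Integrable (fun ω => Complex.exp (z * Y ω)) μ ↔
      Integrable (fun ω => Real.exp (z.re * Y ω)) μ := by
  rw [← integrable_norm_iff (by fun_prop)]
  simp [Complex.norm_exp]

theorem Iio_subset_interior_integrableExpSet (hY : AEMeasurable Y μ) (h0 : ∀ᵐ ω ∂μ, 0 ≤ Y ω)
    {t : ℝ} (ht : Integrable (fun ω => Real.exp (t * Y ω)) μ) :
    Set.Iio t ⊆ interior (integrableExpSet Y μ) := by
  refine interior_maximal (fun u hu => ?_) isOpen_Iio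
  refine ht.mono' (by fun_prop) ?_
  filter_upwards [h0] with ω hω
  rw [Real.norm_eq_abs, Real.abs_exp]
  exact Real.exp_le_exp.2 (mul_le_mul_of_nonneg_right (le_of_lt hu) hω)

/-- Both sides are analytic over the interior of the real domain, a convex and hence connected
region of the plane, and agree at real points near `-1`. -/
theorem complexMGF_mul_aeval_of_mem_interior (hY : AEMeasurable Y μ) (h0 : ∀ᵐ ω ∂μ, 0 ≤ Y ω)
    {P Q : ℝ[X]} (hP : ∀ t < 0, mgf Y μ t * Q.eval t = P.eval t) {z : ℂ}
    (hz : z.re ∈ interior (integrableExpSet Y μ)) :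
    complexMGF Y μ z * aeval z Q = aeval z P := by
  set U := {z : ℂ | z.re ∈ interior (integrableExpSet Y μ)}
  have hpre : IsPreconnected U :=
    (convex_integrableExpSet.interior.linear_preimage Complex.reLm).isPreconnected
  have han : ∀ R : ℝ[X], AnalyticOnNhd ℂ (fun z : ℂ => aeval z R) U := fun R =>
    AnalyticOnNhd.aeval_polynomial analyticOnNhd_id R
  have hneg : ((-1 : ℝ) : ℂ) ∈ U := by
    refine Iio_subset_interior_integrableExpSet hY h0 (t := 0) (by simp) ?_
    simp
  refine (analyticOnNhd_complexMGF.mul (han Q)).eqOn_of_preconnected_of_frequently_eq (han P) hpre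
    hneg ?_ hz
  have htend : Tendsto (fun t : ℝ => (t : ℂ)) (𝓝[≠] (-1)) (𝓝[≠] ((-1 : ℝ) : ℂ)) :=
    Complex.continuous_ofReal.continuousWithinAt.tendsto_nhdsWithin fun t ht h =>
      ht (Complex.ofReal_injective h)
  refine htend.frequently (Eventually.frequently ?_)
  filter_upwards [mem_nhdsWithin_of_mem_nhds (Iio_mem_nhds (by norm_num : (-1 : ℝ) < 0))] with t ht
  have h := hP t ht
  rw [complexMGF_ofReal]
  have haeval : ∀ R : ℝ[X], aeval (t : ℂ) R = ((R.eval t : ℝ) : ℂ) := fun R =>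
    aeval_algebraMap_apply_eq_algebraMap_eval t R
  rw [haeval, haeval, ← h]
  push_cast
  rfl

/-- An identity between a moment generating function on the negative half-line and a quotient of
polynomials extends to the domain of the function. -/
theorem integral_cexp_mul_aeval (hY : AEMeasurable Y μ) (h0 : ∀ᵐ ω ∂μ, 0 ≤ Y ω)
    {P Q : ℝ[X]} (hP : ∀ t < 0, mgf Y μ t * Q.eval t = P.eval t) {z : ℂ}
    (hz : Integrable (fun ω => Complex.exp (z * Y ω)) μ) :
    (∫ ω, Complex.exp (z * Y ω) ∂μ) * aeval z Q = aeval z P := by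
  -- A boundary point is approached from the left; since `Y ≥ 0`, the integrand at `z` dominates in
  -- norm.
  set u : ℕ → ℂ := fun l => z - ((1 / ((l : ℝ) + 1) : ℝ) : ℂ) with hu
  have hre : ∀ l, (u l).re < z.re := fun l => by
    simp only [hu, Complex.sub_re, Complex.ofReal_re]
    linarith [Nat.one_div_pos_of_nat (α := ℝ) (n := l)]
  have hlim : Tendsto u atTop (𝓝 z) := by
    have := (Complex.continuous_ofReal.tendsto 0).comp (tendsto_one_div_add_atTop_nhds_zero_nat (𝕜 := ℝ))
    simpa [hu, Function.comp_def] using tendsto_const_nhds (x := z).sub this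
  have hz' := (integrable_cexp_iff hY z).1 hz
  have heq : ∀ l, complexMGF Y μ (u l) * aeval (u l) Q = aeval (u l) P := fun l =>
    complexMGF_mul_aeval_of_mem_interior hY h0 hP
      (Iio_subset_interior_integrableExpSet hY h0 hz' (hre l))
  have hint : Tendsto (fun l => complexMGF Y μ (u l)) atTop
      (𝓝 (∫ ω, Complex.exp (z * Y ω) ∂μ)) := by
    refine tendsto_integral_of_dominated_convergence (fun ω => Real.exp (z.re * Y ω))
      (fun l => by fun_prop) hz' (fun l => ?_) (ae_of_all _ fun ω => ?_)
    · filter_upwards [h0] with ω hω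
      rw [Complex.norm_exp, Complex.re_mul_ofReal]
      exact Real.exp_le_exp.2 (mul_le_mul_of_nonneg_right (hre l).le hω)
    · exact (Complex.continuous_exp.tendsto _).comp (hlim.mul_const _)
  have hpoly : ∀ R : ℝ[X], Tendsto (fun l => aeval (u l) R) atTop (𝓝 (aeval z R)) := fun R =>
    (R.continuous_aeval.tendsto z).comp hlim
  exact tendsto_nhds_unique (hint.mul (hpoly Q)) ((hpoly P).congr fun l => (heq l).symm)

end Continuation

/-! ### Assembly and transfer to arbitrary probability spaces -/

section Main

variable {k m n : ℕ}

open Polynomial in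
theorem exists_generatingFunction_numerator (hm : k ≤ m) (hn : k ≤ n) :
    ∃ P : ℝ[X], P.degree = ((k.choose 2 : ℕ) : WithBot ℕ) ∧
      ∀ z : ℂ, Integrable (fun c => Complex.exp (z * (minMatchingCost k c : ℝ))) (costLaw m n) →
        aeval z (matchingDenominator k m n) ≠ 0 ∧
        ∫ c, Complex.exp (z * (minMatchingCost k c : ℝ)) ∂costLaw m n =
          aeval z P / aeval z (matchingDenominator k m n) := by
  have hmeas : AEMeasurable (minMatchingCost k) (costLaw m n) :=
    (measurable_minMatchingCost hm hn).aemeasurable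
  have h0 : ∀ᵐ c ∂costLaw m n, 0 ≤ minMatchingCost k c := by
    filter_upwards [ae_costLaw_nonneg] with c hc
    exact minMatchingCost_nonneg hc hm hn
  obtain ⟨P, hP⟩ := exists_integral_exp_mul_eq_eval hm hn
  refine ⟨P, ?_, fun z hz => ?_⟩
  · refine degree_eq_of_bounds (k := k) (a := ((m : ℝ) * n)⁻¹) (by positivity) (fun hk => ?_) ?_ hP
      (fun t ht => le_integral_exp_minMatchingCost hm hn ht.le) fun t ht => ?_
    · have hm0 : (m : ℝ) ≠ 0 := Nat.cast_ne_zero.2 (by omega)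
      have hn0 : (n : ℝ) ≠ 0 := Nat.cast_ne_zero.2 (by omega)
      positivity
    · rw [degree_matchingDenominator hm hn, Nat.choose_succ_succ' k 1, Nat.choose_one_right,
        add_comm]
    · rw [mul_comm _ t, ← div_eq_mul_inv]
      exact integral_exp_minMatchingCost_le hm hn ht.le
  · have hQ : aeval z (matchingDenominator k m n) ≠ 0 := fun h => by
      obtain ⟨i, j, hij, hre⟩ := exists_of_aeval_matchingDenominator_eq_zero hm hn h
      have := (integrable_cexp_iff hmeas z).1 hz
      rw [hre] at this
      exact not_integrable_exp_minMatchingCost hm hn hij this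
    exact ⟨hQ, (eq_div_iff hQ).2 (integral_cexp_mul_aeval hmeas h0 hP hz)⟩

variable {Ω : Type*} [MeasurableSpace Ω] {μ : Measure Ω} [IsProbabilityMeasure μ]

theorem map_eq_costLaw {X : Fin m × Fin n → Ω → ℝ} (hlaw : ∀ e, HasLaw (X e) (expMeasure 1) μ)
    (hindep : iIndepFun X μ) : μ.map (fun ω e => X e ω) = costLaw m n := by
  rw [(iIndepFun_iff_map_fun_eq_pi_map fun e => (hlaw e).aemeasurable).1 hindep, costLaw]
  simp only [(hlaw _).map_eq]

end Main

end Matching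

open Matching in
theorem propositionP {Ω : Type*} [MeasurableSpace Ω] (μ : Measure Ω) [IsProbabilityMeasure μ]
    (k m n : ℕ) (hkm : k ≤ m) (hkn : k ≤ n)
    (X : Fin m × Fin n → Ω → ℝ)
    (hlaw : ∀ e, HasLaw (X e) (expMeasure 1) μ)
    (hindep : iIndepFun X μ)
    (C : Ω → ℝ) (hC : C = fun ω => minMatchingCost k (fun e => X e ω)) :
    (∀ᶠ z in 𝓝 (0 : ℂ), Integrable (fun ω => Complex.exp (z * (C ω : ℂ))) μ) ∧
    (matchingDenominator k m n).degree = (((k + 1).choose 2 : ℕ) : WithBot ℕ) ∧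
    (∃ P : Polynomial ℝ, P.degree = ((k.choose 2 : ℕ) : WithBot ℕ) ∧
      ∀ z : ℂ, Integrable (fun ω => Complex.exp (z * (C ω : ℂ))) μ →
        Polynomial.aeval z (matchingDenominator k m n) ≠ 0 ∧
        ∫ ω, Complex.exp (z * (C ω : ℂ)) ∂μ =
          Polynomial.aeval z P / Polynomial.aeval z (matchingDenominator k m n)) ∧
    (∀ t : ℝ, t ≤ 0 →
      Integrable (fun ω => Real.exp (t * C ω)) μ ∧
      1 / (1 - t) ^ k ≤ ∫ ω, Real.exp (t * C ω) ∂μ ∧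
      ∫ ω, Real.exp (t * C ω) ∂μ ≤ 1 / (1 - t / ((m : ℝ) * (n : ℝ))) ^ k) := by
  subst hC
  have hX : AEMeasurable (fun ω e => X e ω) μ := aemeasurable_pi_lambda _ fun e => (hlaw e).aemeasurable
  have hmap := map_eq_costLaw hlaw hindep
  have hmeas := measurable_minMatchingCost (k := k) hkm hkn
  have hint : ∀ z : ℂ, Integrable
      (fun ω => Complex.exp (z * (minMatchingCost k fun e => X e ω : ℝ))) μ ↔
      Integrable (fun c => Complex.exp (z * (minMatchingCost k c : ℝ))) (costLaw m n) := fun z => by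
    rw [← hmap, integrable_map_measure (by fun_prop) hX]
    rfl
  have hintegral : ∀ z : ℂ, ∫ ω, Complex.exp (z * (minMatchingCost k fun e => X e ω : ℝ)) ∂μ =
      ∫ c, Complex.exp (z * (minMatchingCost k c : ℝ)) ∂costLaw m n := fun z => by
    rw [← hmap, integral_map hX (by fun_prop)]
  have hreal : ∀ t : ℝ, ∫ ω, Real.exp (t * minMatchingCost k fun e => X e ω) ∂μ =
      ∫ c, Real.exp (t * minMatchingCost k c) ∂costLaw m n := fun t => by
    rw [← hmap, integral_map hX (by fun_prop)]
  refine ⟨?_, degree_matchingDenominator hkm hkn, ?_, fun t ht => ⟨?_, ?_, ?_⟩⟩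
  · have : ∀ᶠ z : ℂ in 𝓝 0, z.re < 1 :=
      Complex.continuous_re.continuousAt.eventually_lt_const (by simp)
    filter_upwards [this] with z hz
    rw [hint, integrable_cexp_iff hmeas.aemeasurable]
    exact integrable_exp_minMatchingCost hkm hkn hz
  · obtain ⟨P, hdeg, hP⟩ := exists_generatingFunction_numerator hkm hkn
    refine ⟨P, hdeg, fun z hz => ?_⟩
    rw [hintegral]
    exact hP z ((hint z).1 hz)
  · have h := integrable_exp_minMatchingCost hkm hkn (ht.trans_lt one_pos)
    rw [← hmap] at h
    exact h.comp_aemeasurable hX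
  · rw [hreal]
    exact le_integral_exp_minMatchingCost hkm hkn ht
  · rw [hreal]
    exact integral_exp_minMatchingCost_le hkm hkn ht
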